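/- Let $0<q<1$ with $\frac{\log(1-q)}{\log q}\in\mathbb{Z}$ and let $\alpha>-\frac12$. Put $\mathbb{R}_q=\{\pm q^n:n\in\mathbb{Z}\}\cup\{0\}$; functions are complex valued functions on $\mathbb{R}_q$. Notation: * $(a;q)_n=\prod_{k=0}^{n-1}(1-aq^k)$, $(a;q)_\infty=\prod_{k\ge0}(1-aq^k)$, $\Gamma_q(x)=\frac{(q;q)_\infty}{(q^x;q)_\infty}(1-q)^{1-x}$; * $\int_0^a F(t)\,d_qt=(1-q)a\sum_{n\ge0}F(aq^n)q^n$, $\int_0^\infty F(t)\,d_qt=(1-q)\sum_{n\in\mathbb{Z}}F(q^n)q^n$, $\int_a^\infty=\int_0^\infty-\int_0^a$ (absolutely convergent series); * $D_qf(x)=\frac{f(x)-f(qx)}{(1-q)x}$ for $x\ne0$ and $D_qf(0)=f'(0)$ (derivative along $\mathbb{R}_q$); * $\mathcal{S}_{*q}$ is the space of even, infinitely $q$-differentiable $f$ with $\sup_{x\in\mathbb{R}_q}(1+x^2)^m|D_q^kf(x)|<\infty$ for all $k,m\in\mathbb{N}$; for $\beta\ge-\frac12$, $\mathcal{S}_{*q,\beta}$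 is the subspace of those $f$ with $\int_0^\infty f(x)x^{2k+2\beta+1}d_qx=0$ for $k=0,1,2,\dots$; * for $\beta\ge-\frac12$ the $q$-Bessel operator is $\Delta_{q,\beta}f(z)=q^{2\beta+1}(D_q^2f)(q^{-1}z)+\frac{1-q^{2\beta+1}}{(1-q)q^{-1}z}(D_qf)(q^{-1}z)$, the generalized translation is $$T_{q,x}^{\beta}f(y)=\sum_{n\ge0}\frac{(1-q)^{2n}q^{n(n-1)}}{(q^2;q^2)_n(q^{2\beta+2};q^2)_n}\,x^{2n}\,(\Delta_{q,\beta})^nf(y),\qquad y\in\{q^m : m\in\mathbb{Z}\},$$ and the $q$-Bessel convolution of order $\beta$ is $$f*_{\beta}g(x)=\frac{(1+q^{-1})^{-\beta}}{\Gamma_{q^2}(\beta+1)}\int_0^\infty T_{q,x}^{\beta}f(y)\,g(y)\,y^{2\beta+1}d_qy .$$ We write $*_B$ for $*_\alpha$ and $*_q$ for $*_{-1/2}$; * the $q$-Riemann–Liouville and $q$-Weyl transforms are, for $x\in\mathbb{R}_q$, $$R_{\alpha,q}f(x)=\frac{(1+q)\Gamma_{q^2}(\alpha+1)}{\Gamma_{q^2}(\frac12)\Gamma_{q^2}(\alpha+\frac12)}\int_0^1\frac{(t^2q^2;q^2)_\infty}{(t^2q^{2\alpha+1};q^2)_\infty}f(xt)\,d_qt,$$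 $$W_{\alpha,q}f(x)=\frac{q(1+q^{-1})^{-\alpha+\frac12}}{\Gamma_{q^2}(\alpha+\frac12)}\int_{q|x|}^\infty\frac{(q^2x^2/t^2;q^2)_\infty}{(q^{2\alpha+1}x^2/t^2;q^2)_\infty}f(t)\,t^{2\alpha}d_qt .$$ Then: (i) For all $f,g\in\mathcal{S}_{*q,\alpha}$, on $\mathbb{R}_q$, $$W_{\alpha,q}(f*_Bg)=W_{\alpha,q}(f)*_qW_{\alpha,q}(g).$$ (ii) For all $f,g\in\mathcal{S}_{*q,-1/2}$ there is exactly one $W_{\alpha,q}^{-1}(g)\in\mathcal{S}_{*q,\alpha}$ whose image under $W_{\alpha,q}$ is $g$, and on $\mathbb{R}_q$, $$R_{\alpha,q}(f*_qg)=R_{\alpha,q}(f)*_BW_{\alpha,q}^{-1}(g).$$ In both parts all the series and $q$-integrals that define the two sides converge absolutely. -/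

import Mathlib

/-! Functions on `ℝ_q` are represented by functions `ℝ → ℂ` of which only the values on
`ℝ_q = {± q ^ n} ∪ {0}` matter: every operator below reads its arguments only there, and two such
functions are identified when they agree on `ℝ_q` (`Set.EqOn _ _ (qReals q)`). -/

/-- `ℝ_q = {± q ^ n : n ∈ ℤ} ∪ {0}`. -/
def qReals (q : ℝ) : Set ℝ := {x | x = 0 ∨ ∃ n : ℤ, x = q ^ n ∨ x = -q ^ n}

/-- The infinite `q`-shifted factorial `(a; q)_∞`. -/
noncomputable def qPochInf (a q : ℝ) : ℝ := ∏' k : ℕ, (1 - a * q ^ k)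

/-- The finite `q`-shifted factorial `(a; q)_n`. -/
noncomputable def qPoch (a q : ℝ) (n : ℕ) : ℝ := ∏ k ∈ Finset.range n, (1 - a * q ^ k)

/-- Jackson's `q`-Gamma function `Γ_q`. -/
noncomputable def qGamma (q x : ℝ) : ℝ :=
  qPochInf q q / qPochInf (q ^ x) q * (1 - q) ^ (1 - x)

/-- The Jackson integral `∫_0^a F(t) d_q t`. -/
noncomputable def qIntTo (q a : ℝ) (F : ℝ → ℂ) : ℂ :=
  ((1 - q) * a : ℝ) * ∑' n : ℕ, F (a * q ^ n) * ((q ^ n : ℝ) : ℂ)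

/-- The series defining `∫_0^a F(t) d_q t` converges absolutely. -/
def QIntegrableTo (q a : ℝ) (F : ℝ → ℂ) : Prop :=
  Summable fun n : ℕ => F (a * q ^ n) * ((q ^ n : ℝ) : ℂ)

/-- The Jackson integral `∫_0^∞ F(t) d_q t`. -/
noncomputable def qInt (q : ℝ) (F : ℝ → ℂ) : ℂ :=
  ((1 - q : ℝ) : ℂ) * ∑' n : ℤ, F (q ^ n) * ((q ^ n : ℝ) : ℂ)

/-- The series defining `∫_0^∞ F(t) d_q t` converges absolutely. -/
def QIntegrable (q : ℝ) (F : ℝ → ℂ) : Prop :=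
  Summable fun n : ℤ => F (q ^ n) * ((q ^ n : ℝ) : ℂ)

/-- The `q`-derivative `D_q f`; its value at `0` is the derivative at `0` (along `ℝ_q`). -/
noncomputable def qDeriv (q : ℝ) (f : ℝ → ℂ) (x : ℝ) : ℂ :=
  open Classical in
  if x = 0 then derivWithin f (qReals q) 0
  else (f x - f (q * x)) / (((1 - q) * x : ℝ) : ℂ)

/-- The space `S_{*q}(ℝ_q)`: even functions on `ℝ_q`, infinitely `q`-differentiable (for `D_q` the
only point where this is a condition is `0`), fast decreasing with all their `q`-derivatives. -/
structure IsQSchwartz (q : ℝ) (f : ℝ → ℂ) : Prop where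
  even : ∀ x ∈ qReals q, f (-x) = f x
  differentiable : ∀ k : ℕ, DifferentiableWithinAt ℝ ((qDeriv q)^[k] f) (qReals q) 0
  decay : ∀ k m : ℕ, ∃ C : ℝ, ∀ x ∈ qReals q, (1 + x ^ 2) ^ m * ‖(qDeriv q)^[k] f x‖ ≤ C

/-- The space `S_{*q,α}(ℝ_q)`: the functions `f` in `S_{*q}(ℝ_q)` such that
`∫_0^∞ f(x) x^{2k+2α+1} d_q x = 0` for `k = 0, 1, 2, …`. -/
def qSchwartzMoment (q α : ℝ) : Set (ℝ → ℂ) :=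
  {f | IsQSchwartz q f ∧
    ∀ k : ℕ, qInt q (fun x => f x * ((x ^ (2 * (k : ℝ) + 2 * α + 1) : ℝ) : ℂ)) = 0}

/-- The `q`-Bessel operator `Δ_{q,α}`,
`Δ_{q,α} f (z) = q^{2α+1} (D_q² f)(q⁻¹ z) + (1 - q^{2α+1}) / ((1 - q) q⁻¹ z) (D_q f)(q⁻¹ z)`
(it is only applied at points `z ≠ 0`). -/
noncomputable def qBesselOp (q α : ℝ) (f : ℝ → ℂ) (z : ℝ) : ℂ :=
  ((q ^ (2 * α + 1) : ℝ) : ℂ) * qDeriv q (qDeriv q f) (q⁻¹ * z)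
    + (((1 - q ^ (2 * α + 1)) / ((1 - q) * (q⁻¹ * z)) : ℝ) : ℂ) * qDeriv q f (q⁻¹ * z)

/-- The coefficients `b_n` of the normalized third `q`-Bessel function
`j_α(z; q²) = ∑ (-1)^n b_n z^{2n}`. -/
noncomputable def qBesselCoeff (q α : ℝ) (n : ℕ) : ℝ :=
  (1 - q) ^ (2 * n) * q ^ (n * (n - 1))
    / (qPoch (q ^ 2) (q ^ 2) n * qPoch (q ^ (2 * α + 2)) (q ^ 2) n)

/-- The terms of the series for the generalized `q`-Bessel translation. -/
noncomputable def qTranslateTerm (q α x : ℝ) (f : ℝ → ℂ) (y : ℝ) (n : ℕ) : ℂ :=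
  ((qBesselCoeff q α n * x ^ (2 * n) : ℝ) : ℂ) * (qBesselOp q α)^[n] f y

/-- The generalized `q`-Bessel translation
`T_{q,x}^α f (y) = ∑ b_n x^{2n} (Δ_{q,α})^n f (y)`, for `y ∈ ℝ_{q,+}`.
For `x = 0` it is the identity. -/
noncomputable def qTranslate (q α x : ℝ) (f : ℝ → ℂ) (y : ℝ) : ℂ :=
  ∑' n : ℕ, qTranslateTerm q α x f y n

/-- The constant `c_{α,q}`. -/
noncomputable def qBesselConst (q α : ℝ) : ℝ := (1 + q⁻¹) ^ (-α) / qGamma (q ^ 2) (α + 1)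

/-- The integrand `T_{q,x}^α f (y) g(y) y^{2α+1}` of the `q`-convolution. -/
noncomputable def qConvIntegrand (q α : ℝ) (f g : ℝ → ℂ) (x y : ℝ) : ℂ :=
  qTranslate q α x f y * g y * ((y ^ (2 * α + 1) : ℝ) : ℂ)

/-- The `q`-Bessel convolution product `f *_B g` of order `α`; for `α = -1/2` it is the `q`-even
convolution product `f *_q g`. -/
noncomputable def qConv (q α : ℝ) (f g : ℝ → ℂ) (x : ℝ) : ℂ :=
  (qBesselConst q α : ℂ) * qInt q (qConvIntegrand q α f g x)

/-- The series and the integral that define the convolution at every point of `ℝ_q` converge. -/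
def QConvDefined (q α : ℝ) (f g : ℝ → ℂ) : Prop :=
  ∀ x ∈ qReals q, (∀ m : ℤ, Summable (qTranslateTerm q α x f (q ^ m))) ∧
    QIntegrable q (qConvIntegrand q α f g x)

/-- The kernel `(q² s²; q²)_∞ / (q^{2α+1} s²; q²)_∞`. -/
noncomputable def qKernel (q α s : ℝ) : ℝ :=
  qPochInf (s ^ 2 * q ^ 2) (q ^ 2) / qPochInf (s ^ 2 * q ^ (2 * α + 1)) (q ^ 2)

/-- The integrand of the `q`-Riemann-Liouville transform. -/
noncomputable def qRLIntegrand (q α : ℝ) (f : ℝ → ℂ) (x t : ℝ) : ℂ :=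
  (qKernel q α t : ℂ) * f (x * t)

/-- The `q`-Riemann-Liouville transform `R_{α,q}`. -/
noncomputable def qRL (q α : ℝ) (f : ℝ → ℂ) (x : ℝ) : ℂ :=
  (((1 + q) * qGamma (q ^ 2) (α + 1) /
      (qGamma (q ^ 2) (1 / 2) * qGamma (q ^ 2) (α + 1 / 2)) : ℝ) : ℂ)
    * qIntTo q 1 (qRLIntegrand q α f x)

/-- The integral that defines `R_{α,q} f` converges at every point of `ℝ_q`. -/
def QRLDefined (q α : ℝ) (f : ℝ → ℂ) : Prop :=
  ∀ x ∈ qReals q, QIntegrableTo q 1 (qRLIntegrand q α f x)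

/-- The integrand of the `q`-Weyl transform. -/
noncomputable def qWeylIntegrand (q α : ℝ) (f : ℝ → ℂ) (x t : ℝ) : ℂ :=
  (qKernel q α (x / t) : ℂ) * f t * ((t ^ (2 * α) : ℝ) : ℂ)

/-- The `q`-Weyl transform `W_{α,q}`; the integral `∫_{q|x|}^∞` is `∫_0^∞ - ∫_0^{q|x|}`. The
absolute value is the even extension to the negative points of `ℝ_q`. -/
noncomputable def qWeyl (q α : ℝ) (f : ℝ → ℂ) (x : ℝ) : ℂ :=
  ((q * (1 + q⁻¹) ^ (-α + 1 / 2) / qGamma (q ^ 2) (α + 1 / 2) : ℝ) : ℂ)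
    * (qInt q (qWeylIntegrand q α f x) - qIntTo q (q * |x|) (qWeylIntegrand q α f x))

/-- The integrals that define `W_{α,q} f` converge at every point of `ℝ_q`. -/
def QWeylDefined (q α : ℝ) (f : ℝ → ℂ) : Prop :=
  ∀ x ∈ qReals q, QIntegrable q (qWeylIntegrand q α f x) ∧
    QIntegrableTo q (q * |x|) (qWeylIntegrand q α f x)

/-- `h` is an inverse image of `g` under `W_{α,q} : S_{*q,α}(ℝ_q) → S_{*q,-1/2}(ℝ_q)`. -/
def IsQWeylPreimage (q α : ℝ) (g h : ℝ → ℂ) : Prop :=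
  h ∈ qSchwartzMoment q α ∧ Set.EqOn (qWeyl q α h) g (qReals q)

/-- The inverse transform `W_{α,q}⁻¹ : S_{*q,-1/2}(ℝ_q) → S_{*q,α}(ℝ_q)`. -/
noncomputable def qWeylInv (q α : ℝ) (g : ℝ → ℂ) : ℝ → ℂ :=
  Classical.epsilon (IsQWeylPreimage q α g)

/-! Everything is carried over to sequences by a discrete `q`-Bessel transform. For an order β put w
= q^(2β+2) and let J_w be the rescaled third `q`-Bessel function. The class S_{*q,β} consists, on
ℝ_q, exactly of the sums f(x) = ∑_k F(k) J_w(x q^k) w^k over the lattice, where F decreases faster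
than every exponential at both ends. This is `exists_isBesselRep` in one direction and
`IsBesselRep.mem_qSchwartzMoment` in the other. The sequence F is determined by f
(`IsBesselRep.eqOn_iff`), so identities between functions become termwise identities between
sequences.

The transform is invertible because the sequences n ↦ J_w(q^(n+k)) are eigenvectors, with distinct
eigenvalues, of a symmetric second-order difference operator. They are therefore orthogonal
(`tsum_latticeJ_mul_of_ne`), and the transform is an involution up to a positive constant
(`hankel_hankel`). That constant is never evaluated, since it cancels at the end. Convergence rests
on the Gaussian decay of J_w(q^(-N)) (`exists_besselJ_neg_le`). In the description of S_{*q,β},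
smoothness of f at 0 gives the decay of F at -∞, and the vanishing moments are equivalent to its
decay at +∞.

On sequences each operation is elementary. Translation by x multiplies F(k) by J_w(x q^k)
(`hasSum_qTranslateTerm`), so convolution is a constant times the pointwise product
(`IsBesselRep.qConv`). A `q`-Sonine formula, which follows from the `q`-binomial theorem, integrates
the Bessel function of order -1/2 to that of order α (`tsum_qKernel_mul_besselJ`). Hence R_{α,q}
multiplies F(k) by q^(-(2α+1)k), and the transposed formula shows that W_{α,q} multiplies F by a
nonzero constant (`IsBesselRep.qRL`, `IsBesselRep.qWeyl`). So W_{α,q} is a bijection between the two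
classes, and both parts reduce to one relation between the normalizing constants, `qBesselConst_eq`.
-/

section Shifted

open Filter Topology

/-! ### `q`-shifted factorials, the `q`-binomial theorem and Euler's expansion. -/

section qShifted

variable {p a : ℝ}

theorem multipliable_one_sub_mul_pow (hp0 : 0 < p) (hp1 : p < 1) (a : ℝ) :
    Multipliable fun k : ℕ => 1 - a * p ^ k := by
  have h : Summable fun k : ℕ => ‖-(a * p ^ k)‖ := by
    simp only [norm_neg, norm_mul, norm_pow]
    refine (summable_geometric_of_lt_one (norm_nonneg _) ?_).mul_left _
    rwa [Real.norm_of_nonneg hp0.le]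
  simpa [sub_eq_add_neg] using multipliable_one_add_of_summable h

theorem tendsto_qPoch (hp0 : 0 < p) (hp1 : p < 1) (a : ℝ) :
    Tendsto (qPoch a p) atTop (𝓝 (qPochInf a p)) :=
  (multipliable_one_sub_mul_pow hp0 hp1 a).tendsto_prod_tprod_nat

theorem qPoch_zero : qPoch a p 0 = 1 := by simp [qPoch]

theorem qPoch_succ (n : ℕ) : qPoch a p (n + 1) = qPoch a p n * (1 - a * p ^ n) := by
  simp [qPoch, Finset.prod_range_succ]

theorem qPochInf_eq_mul (hp0 : 0 < p) (hp1 : p < 1) (a : ℝ) (n : ℕ) :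
    qPochInf a p = qPoch a p n * qPochInf (a * p ^ n) p := by
  have h := (multipliable_one_sub_mul_pow hp0 hp1 a)
  have h' : Multipliable fun k : ℕ => 1 - a * p ^ (k + n) := by
    simpa [pow_add, mul_assoc, mul_comm (p ^ n)] using
      multipliable_one_sub_mul_pow hp0 hp1 (a * p ^ n)
  rw [qPochInf, ← h'.prod_mul_tprod_nat_mul' (f := fun k : ℕ => 1 - a * p ^ k), qPochInf, qPoch]
  simp [pow_add, mul_assoc, mul_comm (p ^ n)]

theorem mul_pow_lt_one (hp0 : 0 < p) (hp1 : p < 1) (ha0 : 0 ≤ a) (ha1 : a < 1) (k : ℕ) :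
    a * p ^ k < 1 :=
  (mul_le_of_le_one_right ha0 (pow_le_one₀ hp0.le hp1.le)).trans_lt ha1

theorem qPoch_pos (hp0 : 0 < p) (hp1 : p < 1) (ha0 : 0 ≤ a) (ha1 : a < 1) (n : ℕ) :
    0 < qPoch a p n :=
  Finset.prod_pos fun k _ => sub_pos.2 (mul_pow_lt_one hp0 hp1 ha0 ha1 k)

theorem qPoch_le_one (hp0 : 0 < p) (hp1 : p < 1) (ha0 : 0 ≤ a) (ha1 : a < 1) (n : ℕ) :
    qPoch a p n ≤ 1 :=
  Finset.prod_le_one (fun k _ => (sub_pos.2 (mul_pow_lt_one hp0 hp1 ha0 ha1 k)).le)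
    fun k _ => sub_le_self _ (by positivity)

theorem qPochInf_pos (hp0 : 0 < p) (hp1 : p < 1) (ha0 : 0 ≤ a) (ha1 : a < 1) :
    0 < qPochInf a p := by
  have hf : ∀ k : ℕ, 0 < 1 - a * p ^ k := fun k => sub_pos.2 (mul_pow_lt_one hp0 hp1 ha0 ha1 k)
  have hs : Summable fun k : ℕ => -(a * p ^ k) :=
    ((summable_geometric_of_lt_one hp0.le hp1).mul_left a).neg
  have := Real.rexp_tsum_eq_tprod hf
    (by simpa [sub_eq_add_neg] using Real.summable_log_one_add_of_summable hs)
  rw [qPochInf, ← this]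
  exact Real.exp_pos _

theorem qPochInf_le_one (hp0 : 0 < p) (hp1 : p < 1) (ha0 : 0 ≤ a) (ha1 : a < 1) :
    qPochInf a p ≤ 1 :=
  le_of_tendsto' (tendsto_qPoch hp0 hp1 a) (qPoch_le_one hp0 hp1 ha0 ha1)

theorem qPochInf_le_qPoch (hp0 : 0 < p) (hp1 : p < 1) (ha0 : 0 ≤ a) (ha1 : a < 1) (n : ℕ) :
    qPochInf a p ≤ qPoch a p n := by
  rw [qPochInf_eq_mul hp0 hp1 a n]
  exact mul_le_of_le_one_right (qPoch_pos hp0 hp1 ha0 ha1 n).le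
    (qPochInf_le_one hp0 hp1 (by positivity) (mul_pow_lt_one hp0 hp1 ha0 ha1 n))

theorem qPochInf_eq_zero {k : ℕ} (h : a * p ^ k = 1) : qPochInf a p = 0 :=
  tprod_of_exists_eq_zero ⟨k, by rw [h, sub_self]⟩

theorem qPochInf_zero : qPochInf 0 p = 1 := by simp [qPochInf]

theorem tendsto_qPochInf_mul_pow (hp0 : 0 < p) (hp1 : p < 1) (ha0 : 0 ≤ a) (ha1 : a < 1) :
    Tendsto (fun n : ℕ => qPochInf (a * p ^ n) p) atTop (𝓝 1) := by
  have hne := (qPochInf_pos hp0 hp1 ha0 ha1).ne'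
  have h : Tendsto (fun n => qPochInf a p / qPoch a p n) atTop (𝓝 (qPochInf a p / qPochInf a p)) :=
    tendsto_const_nhds.div (tendsto_qPoch hp0 hp1 a) hne
  rw [div_self hne] at h
  refine h.congr fun n => ?_
  rw [qPochInf_eq_mul hp0 hp1 a n, mul_div_cancel_left₀ _ (qPoch_pos hp0 hp1 ha0 ha1 n).ne']

/-- Dominated convergence. This is the continuity at 0 that ends the iteration of the functional
equations in `qBinomial` and `hasSum_euler`. -/
theorem tendsto_tsum_mul_pow_zero (hp0 : 0 < p) (hp1 : p < 1) {c : ℕ → ℝ} (hc : Summable c) :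
    Tendsto (fun n : ℕ => ∑' k : ℕ, c k * (p ^ n) ^ k) atTop (𝓝 (c 0)) := by
  have h : Tendsto (fun n : ℕ => ∑' k : ℕ, c k * (p ^ n) ^ k) atTop
      (𝓝 (∑' k : ℕ, c k * 0 ^ k)) := by
    refine tendsto_tsum_of_dominated_convergence hc.norm (fun k => ?_) (.of_forall fun n k => ?_)
    · exact ((tendsto_pow_atTop_nhds_zero_of_lt_one hp0.le hp1).pow k).const_mul _
    · rw [norm_mul]
      refine mul_le_of_le_one_right (norm_nonneg _) ?_
      rw [Real.norm_of_nonneg (by positivity)]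
      exact pow_le_one₀ (by positivity) (pow_le_one₀ hp0.le hp1.le)
  rwa [tsum_eq_single 0 (fun k hk => by simp [hk]), pow_zero, mul_one] at h

theorem summable_pow_mul_pow {q : ℝ} (hq0 : 0 < q) (hq1 : q < 1) (t : ℝ) :
    Summable fun n : ℕ => q ^ (n * (n - 1)) * t ^ n := by
  rcases eq_or_ne t 0 with rfl | ht
  · exact summable_of_ne_finset_zero (s := {0}) fun n hn => by simp_all
  refine summable_of_ratio_test_tendsto_lt_one (l := 0) one_pos
    (.of_forall fun n => by positivity) ?_
  have h : Tendsto (fun n : ℕ => (q ^ 2) ^ n * |t|) atTop (𝓝 (0 * |t|)) :=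
    (tendsto_pow_atTop_nhds_zero_of_lt_one (by positivity)
      (pow_lt_one₀ hq0.le hq1 two_ne_zero)).mul_const _
  rw [zero_mul] at h
  refine h.congr fun n => ?_
  have : (n + 1) * (n + 1 - 1) = n * (n - 1) + 2 * n := by
    cases n <;> simp; ring
  rw [this, pow_add, pow_succ t, norm_mul, norm_mul, norm_mul, norm_mul, ← pow_mul,
    Real.norm_of_nonneg (pow_nonneg hq0.le (2 * n)), Real.norm_eq_abs t]
  have h1 : ‖q ^ (n * (n - 1))‖ ≠ 0 := norm_ne_zero_iff.2 (pow_ne_zero _ hq0.ne')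
  have h2 : ‖t ^ n‖ ≠ 0 := norm_ne_zero_iff.2 (pow_ne_zero _ ht)
  field_simp

/-- The series h satisfies (1 - z) h(z) = (1 - az) h(pz). Iterating along z p^n and using h(z p^n) →
1 yields the product. -/
theorem qBinomial (hp0 : 0 < p) (hp1 : p < 1) (ha0 : 0 ≤ a) (ha1 : a < 1) {z : ℝ}
    (hz0 : 0 ≤ z) (hz1 : z < 1) :
    HasSum (fun k : ℕ => qPoch a p k / qPoch p p k * z ^ k)
      (qPochInf (a * z) p / qPochInf z p) := by
  have hP := fun n => qPoch_pos hp0 hp1 hp0.le hp1 n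
  have hbd : ∀ k, ‖qPoch a p k / qPoch p p k‖ ≤ 1 / qPochInf p p := fun k => by
    rw [Real.norm_of_nonneg (div_pos (qPoch_pos hp0 hp1 ha0 ha1 k) (hP k)).le]
    exact div_le_div₀ zero_le_one (qPoch_le_one hp0 hp1 ha0 ha1 k)
      (qPochInf_pos hp0 hp1 hp0.le hp1) (qPochInf_le_qPoch hp0 hp1 hp0.le hp1 k)
  have hs : ∀ z : ℝ, 0 ≤ z → z < 1 →
      Summable fun k : ℕ => qPoch a p k / qPoch p p k * z ^ k := fun z hz0 hz1 => by
    refine ((summable_geometric_of_lt_one hz0 hz1).mul_left (1 / qPochInf p p)).of_norm_bounded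
      fun k => ?_
    rw [norm_mul, norm_pow, Real.norm_of_nonneg hz0]
    gcongr
    exact hbd k
  set h : ℝ → ℝ := fun z => ∑' k : ℕ, qPoch a p k / qPoch p p k * z ^ k with hh
  have hfe : ∀ z, 0 ≤ z → z < 1 → (1 - z) * h z = (1 - a * z) * h (z * p) := by
    intro z hz0 hz1
    have hs1 := hs z hz0 hz1
    have hs2 := hs (z * p) (by positivity) (by nlinarith)
    have e1 : h z - h (z * p) = z * (h z - a * h (z * p)) := by
      simp only [hh]
      rw [← hs1.tsum_sub hs2, ← tsum_mul_left, ← hs1.tsum_sub (hs2.mul_left a), ← tsum_mul_left,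
        (hs1.sub hs2).tsum_eq_zero_add]
      simp only [pow_zero, sub_self, zero_add]
      refine tsum_congr fun k => ?_
      rw [qPoch_succ, qPoch_succ, mul_pow, mul_pow]
      have h1 : qPoch p p k ≠ 0 := (hP k).ne'
      have h2 : 1 - p * p ^ k ≠ 0 := (sub_pos.2 (mul_pow_lt_one hp0 hp1 hp0.le hp1 k)).ne'
      rw [pow_succ p k]
      generalize p ^ k = X at h2 ⊢
      generalize hD : 1 - p * X = D at h2 ⊢
      field_simp
      rw [← hD]
      ring
    linarith
  have hit : ∀ n : ℕ, qPoch z p n * h z = qPoch (a * z) p n * h (z * p ^ n) := by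
    intro n
    induction n with
    | zero => simp [qPoch]
    | succ n ih =>
      have hlt := mul_pow_lt_one hp0 hp1 hz0 hz1 n
      have := hfe (z * p ^ n) (by positivity) hlt
      rw [qPoch_succ, qPoch_succ, pow_succ, ← mul_assoc z]
      linear_combination (1 - z * p ^ n) * ih + qPoch (a * z) p n * this
  have hlim : Tendsto (fun n : ℕ => h (z * p ^ n)) atTop (𝓝 1) := by
    have := tendsto_tsum_mul_pow_zero hp0 hp1 (hs z hz0 hz1)
    simp only [qPoch_zero, pow_zero, div_one, mul_one] at this
    simpa only [hh, mul_pow, mul_assoc] using this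
  have := tendsto_nhds_unique (((tendsto_qPoch hp0 hp1 z).mul_const (h z)).congr hit)
    ((tendsto_qPoch hp0 hp1 (a * z)).mul hlim)
  have hsum := (hs z hz0 hz1).hasSum
  have he : h z = qPochInf (a * z) p / qPochInf z p := by
    rw [eq_div_iff (qPochInf_pos hp0 hp1 hz0 hz1).ne']
    linarith
  rw [← he]
  exact hsum

theorem abs_eulerCoeff_le {q : ℝ} (hq0 : 0 < q) (hq1 : q < 1) (k : ℕ) (x : ℝ) :
    ‖(-1) ^ k * q ^ (k * (k - 1)) / qPoch (q ^ 2) (q ^ 2) k * x ^ k‖ ≤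
      (qPochInf (q ^ 2) (q ^ 2))⁻¹ * (q ^ (k * (k - 1)) * |x| ^ k) := by
  have hp0 : 0 < q ^ 2 := by positivity
  have hp1 : q ^ 2 < 1 := pow_lt_one₀ hq0.le hq1 two_ne_zero
  rw [norm_mul, norm_div, norm_mul, norm_pow, norm_neg, norm_one, one_pow, one_mul, norm_pow x,
    Real.norm_of_nonneg (qPoch_pos hp0 hp1 hp0.le hp1 k).le,
    Real.norm_of_nonneg (by positivity : 0 ≤ q ^ (k * (k - 1))), Real.norm_eq_abs, div_eq_inv_mul,
    mul_assoc]
  gcongr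
  · exact qPochInf_pos hp0 hp1 hp0.le hp1
  · exact qPochInf_le_qPoch hp0 hp1 hp0.le hp1 k

/-- Same method as `qBinomial`: the series satisfies h(x) = (1 - x) h(q²x), which is iterated down
to h → 1. -/
theorem hasSum_euler {q : ℝ} (hq0 : 0 < q) (hq1 : q < 1) (x : ℝ) :
    HasSum (fun k : ℕ => (-1) ^ k * q ^ (k * (k - 1)) / qPoch (q ^ 2) (q ^ 2) k * x ^ k)
      (qPochInf x (q ^ 2)) := by
  have hp0 : 0 < q ^ 2 := by positivity
  have hp1 : q ^ 2 < 1 := pow_lt_one₀ hq0.le hq1 two_ne_zero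
  have hP := fun n => qPoch_pos hp0 hp1 hp0.le hp1 n
  have hs : ∀ x : ℝ,
      Summable fun k : ℕ => (-1) ^ k * q ^ (k * (k - 1)) / qPoch (q ^ 2) (q ^ 2) k * x ^ k :=
    fun x => ((summable_pow_mul_pow hq0 hq1 |x|).mul_left _).of_norm_bounded
      fun k => abs_eulerCoeff_le hq0 hq1 k x
  set h : ℝ → ℝ := fun x =>
    ∑' k : ℕ, (-1) ^ k * q ^ (k * (k - 1)) / qPoch (q ^ 2) (q ^ 2) k * x ^ k with hh
  have hfe : ∀ x, h x = (1 - x) * h (x * q ^ 2) := by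
    intro x
    have e1 : h x - h (x * q ^ 2) = -x * h (x * q ^ 2) := by
      simp only [hh]
      rw [← (hs x).tsum_sub (hs _), ← tsum_mul_left, ((hs x).sub (hs _)).tsum_eq_zero_add]
      simp only [pow_zero, sub_self, zero_add]
      refine tsum_congr fun k => ?_
      have : (k + 1) * (k + 1 - 1) = k * (k - 1) + 2 * k := by
        cases k <;> simp; ring
      rw [qPoch_succ, mul_pow, mul_pow, this, pow_add]
      have h1 : qPoch (q ^ 2) (q ^ 2) k ≠ 0 := (hP k).ne'
      have h2 : 1 - q ^ 2 * (q ^ 2) ^ k ≠ 0 :=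
        (sub_pos.2 (mul_pow_lt_one hp0 hp1 hp0.le hp1 k)).ne'
      field_simp
      ring
    linarith
  have hit : ∀ n : ℕ, h x = qPoch x (q ^ 2) n * h (x * (q ^ 2) ^ n) := by
    intro n
    induction n with
    | zero => simp [qPoch]
    | succ n ih =>
      rw [ih, qPoch_succ, hfe (x * (q ^ 2) ^ n), pow_succ (q ^ 2) n, ← mul_assoc x,
        ← mul_assoc (qPoch x (q ^ 2) n)]
  have hlim : Tendsto (fun n : ℕ => h (x * (q ^ 2) ^ n)) atTop (𝓝 1) := by
    have := tendsto_tsum_mul_pow_zero hp0 hp1 (hs x)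
    simp only [qPoch_zero, pow_zero, div_one, mul_one, zero_mul] at this
    simpa only [hh, mul_pow, mul_assoc] using this
  have := tendsto_nhds_unique (tendsto_const_nhds.congr hit)
    ((tendsto_qPoch hp0 hp1 x).mul hlim)
  rw [mul_one] at this
  rw [← this]
  exact (hs x).hasSum

end qShifted

end Shifted

/-! ### The third `q`-Bessel function: difference equation and decay. -/

section Bessel

open Filter Topology

/-- The parameters of a `q`-Bessel function: the base `q` and `w = q ^ (2 β + 2)`. -/
structure IsBesselParam (q w : ℝ) : Prop where
  q_pos : 0 < q
  q_lt_one : q < 1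
  w_pos : 0 < w
  w_lt_one : w < 1

/-- The coefficients of the third `q`-Bessel function, rescaled by `1 - q`. -/
noncomputable def besselCoeff (q w : ℝ) (n : ℕ) : ℝ :=
  q ^ (n * (n - 1)) / (qPoch (q ^ 2) (q ^ 2) n * qPoch w (q ^ 2) n)

/-- The third `q`-Bessel function, rescaled by `1 - q`. -/
noncomputable def besselJ (q w y : ℝ) : ℝ :=
  ∑' n : ℕ, (-1) ^ n * besselCoeff q w n * (y ^ 2) ^ n

section besselJ

variable {q w : ℝ}

namespace IsBesselParam

theorem sq_pos (h : IsBesselParam q w) : 0 < q ^ 2 := pow_pos h.q_pos 2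

theorem sq_lt_one (h : IsBesselParam q w) : q ^ 2 < 1 :=
  pow_lt_one₀ h.q_pos.le h.q_lt_one two_ne_zero

end IsBesselParam

theorem mul_pred_succ (n : ℕ) : (n + 1) * (n + 1 - 1) = n * (n - 1) + 2 * n := by
  cases n <;> simp; ring

theorem besselCoeff_zero : besselCoeff q w 0 = 1 := by simp [besselCoeff, qPoch]

theorem besselCoeff_pos (h : IsBesselParam q w) (n : ℕ) : 0 < besselCoeff q w n :=
  div_pos (pow_pos h.q_pos _) (mul_pos
    (qPoch_pos h.sq_pos h.sq_lt_one h.sq_pos.le h.sq_lt_one n)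
    (qPoch_pos h.sq_pos h.sq_lt_one h.w_pos.le h.w_lt_one n))

theorem exists_besselCoeff_le (h : IsBesselParam q w) :
    ∃ M, 0 ≤ M ∧ ∀ n, besselCoeff q w n ≤ M * q ^ (n * (n - 1)) := by
  have h1 := qPochInf_pos h.sq_pos h.sq_lt_one h.sq_pos.le h.sq_lt_one
  have h2 := qPochInf_pos h.sq_pos h.sq_lt_one h.w_pos.le h.w_lt_one
  refine ⟨(qPochInf (q ^ 2) (q ^ 2) * qPochInf w (q ^ 2))⁻¹, by positivity, fun n => ?_⟩
  rw [besselCoeff, div_eq_inv_mul]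
  have := h.q_pos
  gcongr
  · exact (qPoch_pos h.sq_pos h.sq_lt_one h.sq_pos.le h.sq_lt_one n).le
  · exact qPochInf_le_qPoch h.sq_pos h.sq_lt_one h.sq_pos.le h.sq_lt_one n
  · exact qPochInf_le_qPoch h.sq_pos h.sq_lt_one h.w_pos.le h.w_lt_one n

theorem besselCoeff_succ (h : IsBesselParam q w) (n : ℕ) :
    besselCoeff q w (n + 1) * ((1 - (q ^ 2) ^ (n + 1)) * (1 - w * (q ^ 2) ^ n)) =
      (q ^ 2) ^ n * besselCoeff q w n := by
  have h1 := (qPoch_pos h.sq_pos h.sq_lt_one h.sq_pos.le h.sq_lt_one n).ne'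
  have h2 := (qPoch_pos h.sq_pos h.sq_lt_one h.w_pos.le h.w_lt_one n).ne'
  have h3 := (sub_pos.2 (mul_pow_lt_one h.sq_pos h.sq_lt_one h.sq_pos.le h.sq_lt_one n)).ne'
  have h4 := (sub_pos.2 (mul_pow_lt_one h.sq_pos h.sq_lt_one h.w_pos.le h.w_lt_one n)).ne'
  rw [besselCoeff, besselCoeff, qPoch_succ, qPoch_succ, mul_pred_succ, pow_add, pow_mul q 2 n,
    pow_succ' (q ^ 2) n]
  generalize q ^ 2 * (q ^ 2) ^ n = X at h3 ⊢
  generalize hD : 1 - X = D at h3 ⊢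
  generalize hE : 1 - w * (q ^ 2) ^ n = E at h4 ⊢
  field_simp

theorem summable_besselCoeff (h : IsBesselParam q w) (t : ℝ) :
    Summable fun n => besselCoeff q w n * t ^ n := by
  obtain ⟨M, hM, hb⟩ := exists_besselCoeff_le h
  refine ((summable_pow_mul_pow h.q_pos h.q_lt_one |t|).mul_left M).of_norm_bounded fun n => ?_
  rw [norm_mul, norm_pow, Real.norm_eq_abs t, Real.norm_of_nonneg (besselCoeff_pos h n).le,
    ← mul_assoc]
  gcongr
  exact hb n

theorem summable_besselJ (h : IsBesselParam q w) (y : ℝ) :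
    Summable fun n : ℕ => (-1) ^ n * besselCoeff q w n * (y ^ 2) ^ n := by
  refine (summable_besselCoeff h (y ^ 2)).of_norm_bounded fun n => ?_
  rw [norm_mul, norm_mul, norm_pow, norm_neg, norm_one, one_pow, one_mul,
    Real.norm_of_nonneg (besselCoeff_pos h n).le, Real.norm_of_nonneg (by positivity)]

theorem besselJ_abs (y : ℝ) : besselJ q w |y| = besselJ q w y := by simp [besselJ]

theorem besselJ_neg (y : ℝ) : besselJ q w (-y) = besselJ q w y := by simp [besselJ]

/-- Comparison of power series coefficients by `besselCoeff_succ`. The constant terms cancel on the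
left, so the left index shifts by one against the right. This is the eigenvalue equation of J for
the `q`-Bessel operator. -/
theorem besselJ_recurrence (h : IsBesselParam q w) (y : ℝ) :
    besselJ q w (y / q) - (1 + w / q ^ 2) * besselJ q w y + w / q ^ 2 * besselJ q w (y * q) =
      -(y ^ 2 / q ^ 2) * besselJ q w y := by
  have hq := h.q_pos.ne'
  simp only [besselJ]
  rw [← tsum_mul_left, ← tsum_mul_left, ← tsum_mul_left,
    ← (summable_besselJ h _).tsum_sub ((summable_besselJ h _).mul_left _),
    ← ((summable_besselJ h _).sub ((summable_besselJ h _).mul_left _)).tsum_add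
      ((summable_besselJ h _).mul_left _),
    (((summable_besselJ h _).sub ((summable_besselJ h _).mul_left _)).add
      ((summable_besselJ h _).mul_left _)).tsum_eq_zero_add]
  simp only [pow_zero, besselCoeff_zero]
  rw [show (1 * 1 * 1 - (1 + w / q ^ 2) * (1 * 1 * 1) + w / q ^ 2 * (1 * 1 * 1) : ℝ) = 0 by ring,
    zero_add]
  refine tsum_congr fun n => ?_
  have := besselCoeff_succ h n
  have e : (y / q) ^ 2 = y ^ 2 * (q ^ 2)⁻¹ := by rw [div_pow, div_eq_mul_inv]
  rw [e, mul_pow y q 2]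
  generalize hY : y ^ 2 = Y
  have hp : q ^ 2 ≠ 0 := by positivity
  generalize q ^ 2 = p at *
  rw [mul_pow, mul_pow, inv_pow]
  have hpn : p ^ n ≠ 0 := pow_ne_zero _ hp
  rw [pow_succ p n] at this ⊢
  generalize p ^ n = X at *
  generalize besselCoeff q w (n + 1) = c at *
  generalize besselCoeff q w n = d at *
  field_simp
  linear_combination (-1) ^ n * (-1) * Y ^ (n + 1) * this

/-- The quotient (w;q²)_∞ / (w;q²)_n is (w q^(2n);q²)_∞. Expanding it by Euler's series in k and
summing over n first gives Euler's series again, now in y² q^(2k). -/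
theorem qPochInf_mul_besselJ (h : IsBesselParam q w) (y : ℝ) :
    qPochInf w (q ^ 2) * besselJ q w y =
      ∑' k : ℕ, (-1) ^ k * q ^ (k * (k - 1)) / qPoch (q ^ 2) (q ^ 2) k * w ^ k *
        qPochInf (y ^ 2 * (q ^ 2) ^ k) (q ^ 2) := by
  have hM := qPochInf_pos h.sq_pos h.sq_lt_one h.sq_pos.le h.sq_lt_one
  set A : ℕ → ℕ → ℝ := fun n k =>
    ((-1) ^ n * q ^ (n * (n - 1)) / qPoch (q ^ 2) (q ^ 2) n * (y ^ 2) ^ n) *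
      ((-1) ^ k * q ^ (k * (k - 1)) / qPoch (q ^ 2) (q ^ 2) k * (w * (q ^ 2) ^ n) ^ k) with hA
  have hsA : Summable (Function.uncurry A) := by
    have hs := fun x => (summable_pow_mul_pow h.q_pos h.q_lt_one x).mul_left
      (qPochInf (q ^ 2) (q ^ 2))⁻¹
    have hq := h.q_pos
    refine ((hs |y ^ 2|).mul_of_nonneg (hs 1) (fun n => by positivity)
      (fun n => by positivity)).of_norm_bounded fun ⟨n, k⟩ => ?_
    simp only [Function.uncurry, hA]
    rw [norm_mul]
    gcongr
    · exact abs_eulerCoeff_le h.q_pos h.q_lt_one n _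
    · refine (abs_eulerCoeff_le h.q_pos h.q_lt_one k _).trans ?_
      gcongr
      rw [abs_of_nonneg (mul_nonneg h.w_pos.le (by positivity))]
      exact (mul_pow_lt_one h.sq_pos h.sq_lt_one h.w_pos.le h.w_lt_one n).le
  have h1 : ∀ n, ∑' k, A n k = qPochInf w (q ^ 2) * ((-1) ^ n * besselCoeff q w n * (y ^ 2) ^ n) := by
    intro n
    simp only [hA]
    rw [tsum_mul_left, (hasSum_euler h.q_pos h.q_lt_one _).tsum_eq,
      qPochInf_eq_mul h.sq_pos h.sq_lt_one w n, besselCoeff]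
    have h1 := (qPoch_pos h.sq_pos h.sq_lt_one h.w_pos.le h.w_lt_one n).ne'
    field_simp
  have h2 : ∀ k, ∑' n, A n k = (-1) ^ k * q ^ (k * (k - 1)) / qPoch (q ^ 2) (q ^ 2) k * w ^ k *
        qPochInf (y ^ 2 * (q ^ 2) ^ k) (q ^ 2) := by
    intro k
    rw [← (hasSum_euler h.q_pos h.q_lt_one _).tsum_eq, ← tsum_mul_left]
    refine tsum_congr fun n => ?_
    simp only [hA, mul_pow]
    rw [← pow_mul (q ^ 2) n k, ← pow_mul (q ^ 2) k n, mul_comm n k]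
    ring
  rw [besselJ, ← tsum_mul_left, ← tsum_congr h1, ← tsum_congr h2]
  exact hsA.tsum_comm.symm

/-- At y = q^(-N) the factor (q^(2(k-N));q²)_∞ in `qPochInf_mul_besselJ` vanishes for k ≤ N. The
series thus starts at k = N + 1, whose coefficient carries q^(N(N+1)). -/
theorem exists_besselJ_neg_le (h : IsBesselParam q w) :
    ∃ C, ∀ N : ℕ, |besselJ q w ((q ^ N)⁻¹)| ≤ C * q ^ (N * (N + 1)) := by
  have hM := qPochInf_pos h.sq_pos h.sq_lt_one h.sq_pos.le h.sq_lt_one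
  have hW := qPochInf_pos h.sq_pos h.sq_lt_one h.w_pos.le h.w_lt_one
  have hq := h.q_pos
  have hq1 := h.q_lt_one
  refine ⟨(qPochInf w (q ^ 2))⁻¹ * ((qPochInf (q ^ 2) (q ^ 2))⁻¹ * (1 - q)⁻¹), fun N => ?_⟩
  have key := qPochInf_mul_besselJ h ((q ^ N)⁻¹)
  set f : ℕ → ℝ := fun k => (-1) ^ k * q ^ (k * (k - 1)) / qPoch (q ^ 2) (q ^ 2) k * w ^ k *
        qPochInf (((q ^ N)⁻¹) ^ 2 * (q ^ 2) ^ k) (q ^ 2) with hf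
  have hbase : ((q ^ N)⁻¹) ^ 2 * (q ^ 2) ^ N = 1 := by
    rw [← pow_mul, inv_pow, ← pow_mul, mul_comm 2 N, inv_mul_cancel₀ (by positivity)]
  have hf0 : ∀ k ∈ Finset.range (N + 1), f k = 0 := by
    intro k hk
    have : k ≤ N := Nat.lt_succ_iff.1 (Finset.mem_range.1 hk)
    simp only [hf]
    rw [qPochInf_eq_zero (k := N - k), mul_zero]
    rw [mul_assoc, ← pow_add, Nat.add_sub_of_le this, hbase]
  have hfb : ∀ j, ‖f (j + (N + 1))‖ ≤
      (qPochInf (q ^ 2) (q ^ 2))⁻¹ * q ^ (N * (N + 1)) * q ^ j := by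
    intro j
    have hb : ((q ^ N)⁻¹) ^ 2 * (q ^ 2) ^ (j + (N + 1)) = q ^ 2 * (q ^ 2) ^ j := by
      rw [show j + (N + 1) = N + (j + 1) by ring, pow_add, ← mul_assoc, hbase, one_mul, pow_succ']
    have hlt := mul_pow_lt_one h.sq_pos h.sq_lt_one h.sq_pos.le h.sq_lt_one j
    have hp := qPochInf_pos h.sq_pos h.sq_lt_one (by positivity) hlt
    simp only [hf]
    rw [norm_mul, hb, Real.norm_of_nonneg hp.le]
    refine (mul_le_of_le_one_right (norm_nonneg _)
      (qPochInf_le_one h.sq_pos h.sq_lt_one (by positivity) hlt)).trans ?_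
    refine (abs_eulerCoeff_le h.q_pos h.q_lt_one _ _).trans ?_
    rw [mul_assoc, ← pow_add, abs_of_pos h.w_pos]
    gcongr
    refine (mul_le_of_le_one_right (by positivity) (pow_le_one₀ h.w_pos.le h.w_lt_one.le)).trans ?_
    -- The exponent (j+N+1)(j+N) is at least N(N+1) + j, which leaves a geometric series in j.
    refine pow_le_pow_of_le_one hq.le hq1.le ?_
    rw [show j + (N + 1) - 1 = j + N by omega]
    nlinarith
  have hgeo := (hasSum_geometric_of_lt_one hq.le hq1).mul_left
    ((qPochInf (q ^ 2) (q ^ 2))⁻¹ * q ^ (N * (N + 1)))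
  have hsf : Summable f := by
    rw [← summable_nat_add_iff (N + 1)]
    exact hgeo.summable.of_norm_bounded hfb
  have hle : ‖∑' k, f k‖ ≤ (qPochInf (q ^ 2) (q ^ 2))⁻¹ * q ^ (N * (N + 1)) * (1 - q)⁻¹ := by
    rw [← hsf.sum_add_tsum_nat_add (N + 1), Finset.sum_eq_zero hf0, zero_add]
    exact tsum_of_norm_bounded hgeo hfb
  rw [← key, norm_mul, Real.norm_of_nonneg hW.le, Real.norm_eq_abs] at hle
  rw [mul_assoc, ← div_eq_inv_mul, le_div_iff₀ hW, mul_comm]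
  linarith

end besselJ

end Bessel

/-! ### Bounds for the `q`-Bessel function on ℝ_q. -/

section Lattice

open Filter Topology

section lattice

variable {q w : ℝ}

theorem zero_mem_qReals : (0 : ℝ) ∈ qReals q := Or.inl rfl

theorem zpow_mem_qReals (n : ℤ) : q ^ n ∈ qReals q := Or.inr ⟨n, Or.inl rfl⟩

theorem neg_mem_qReals {x : ℝ} (hx : x ∈ qReals q) : -x ∈ qReals q := by
  rcases hx with rfl | ⟨n, rfl | rfl⟩
  · simpa using zero_mem_qReals
  · exact Or.inr ⟨n, Or.inr rfl⟩
  · exact Or.inr ⟨n, Or.inl (neg_neg _)⟩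

theorem mul_zpow_mem_qReals (hq : q ≠ 0) {x : ℝ} (hx : x ∈ qReals q) (k : ℤ) :
    x * q ^ k ∈ qReals q := by
  rcases hx with rfl | ⟨n, rfl | rfl⟩
  · simpa using zero_mem_qReals
  · exact Or.inr ⟨n + k, Or.inl (by rw [zpow_add₀ hq])⟩
  · exact Or.inr ⟨n + k, Or.inr (by rw [zpow_add₀ hq, neg_mul])⟩

theorem mul_pow_mem_qReals (hq : q ≠ 0) {x : ℝ} (hx : x ∈ qReals q) (k : ℕ) :
    x * q ^ k ∈ qReals q := by
  simpa using mul_zpow_mem_qReals hq hx k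

theorem exists_abs_eq_zpow (hq : 0 < q) {x : ℝ} (hx : x ∈ qReals q) (h0 : x ≠ 0) :
    ∃ n : ℤ, |x| = q ^ n := by
  rcases hx with rfl | ⟨n, rfl | rfl⟩
  · exact absurd rfl h0
  · exact ⟨n, abs_of_pos (zpow_pos hq n)⟩
  · exact ⟨n, by rw [abs_neg, abs_of_pos (zpow_pos hq n)]⟩

theorem exists_pow_mul_pow_le (hq0 : 0 < q) (hq1 : q < 1) (t : ℝ) :
    ∃ C, ∀ n : ℕ, q ^ (n * (n - 1)) * t ^ n ≤ C := by
  obtain ⟨C, hC⟩ := (summable_pow_mul_pow hq0 hq1 t).tendsto_atTop_zero.bddAbove_range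
  exact ⟨C, fun n => hC ⟨n, rfl⟩⟩

theorem abs_besselJ_sub_le (h : IsBesselParam q w) (s : ℕ) {y : ℝ} (hy : |y| ≤ 1) :
    |besselJ q w y - ∑ l ∈ Finset.range s, (-1) ^ l * besselCoeff q w l * (y ^ 2) ^ l| ≤
      (∑' l, besselCoeff q w l) * (y ^ 2) ^ s := by
  have hy2 : y ^ 2 ≤ 1 := (sq_le_one_iff_abs_le_one y).2 hy
  have hs : Summable (besselCoeff q w) := by simpa using summable_besselCoeff h 1
  have hpos := fun n => (besselCoeff_pos h n).le
  rw [besselJ, ← (summable_besselJ h y).sum_add_tsum_nat_add s, add_sub_cancel_left]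
  have h1 : ∀ l, ‖(-1) ^ (l + s) * besselCoeff q w (l + s) * (y ^ 2) ^ (l + s)‖ ≤
      besselCoeff q w (l + s) * (y ^ 2) ^ s := by
    intro l
    rw [norm_mul, norm_mul, norm_pow, norm_neg, norm_one, one_pow, one_mul,
      Real.norm_of_nonneg (hpos _), Real.norm_of_nonneg (by positivity)]
    have := hpos (l + s)
    gcongr ?_ * ?_
    exact pow_le_pow_of_le_one (sq_nonneg y) hy2 (Nat.le_add_left s l)
  have hs' := (summable_nat_add_iff s).2 hs
  refine (tsum_of_norm_bounded (hs'.hasSum.mul_right _) h1).trans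
    (mul_le_mul_of_nonneg_right ?_ (by positivity))
  rw [← hs.sum_add_tsum_nat_add s]
  exact le_add_of_nonneg_left (Finset.sum_nonneg fun i _ => hpos i)

/-- Outside the unit interval a lattice point is ±q^(-N), and there the factor q^(N(N+1)) beats the
power q^(-Ns). -/
theorem exists_besselJ_mul_pow_le (h : IsBesselParam q w) (s : ℕ) :
    ∃ C, ∀ y ∈ qReals q, |besselJ q w y| * |y| ^ s ≤ C := by
  have hq := h.q_pos
  obtain ⟨C, hC⟩ := exists_besselJ_neg_le h
  obtain ⟨D, hD⟩ := exists_pow_mul_pow_le hq h.q_lt_one (q ^ 2 * (q ^ s)⁻¹)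
  have hC0 : 0 ≤ C := by simpa using (abs_nonneg _).trans (hC 0)
  refine ⟨max (∑' l, besselCoeff q w l) (C * D), fun y hy => ?_⟩
  rcases le_or_gt |y| 1 with h1 | h1
  · refine le_max_of_le_left ?_
    have := abs_besselJ_sub_le h 0 h1
    simp only [Finset.range_zero, Finset.sum_empty, sub_zero, pow_zero, mul_one] at this
    exact (mul_le_of_le_one_right (abs_nonneg _) (pow_le_one₀ (abs_nonneg _) h1)).trans this
  · refine le_max_of_le_right ?_
    obtain ⟨n, hn⟩ := exists_abs_eq_zpow hq hy (fun h0 => by simp [h0] at h1; linarith)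
    have hn0 : n < 0 := by
      by_contra! hc
      exact absurd (zpow_le_one₀ hq h.q_lt_one.le hc) (by rw [← hn]; exact not_le.2 h1)
    obtain ⟨N, rfl⟩ : ∃ N : ℕ, n = -(N : ℤ) := ⟨n.natAbs, by omega⟩
    rw [zpow_neg, zpow_natCast] at hn
    rw [← besselJ_abs y, hn]
    calc |besselJ q w (q ^ N)⁻¹| * (q ^ N)⁻¹ ^ s
        ≤ C * q ^ (N * (N + 1)) * (q ^ N)⁻¹ ^ s := by gcongr; exact hC N
      _ = C * (q ^ (N * (N - 1)) * (q ^ 2 * (q ^ s)⁻¹) ^ N) := by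
          have : N * (N + 1) = N * (N - 1) + 2 * N := by cases N <;> simp; ring
          rw [this, pow_add, pow_mul q 2 N, mul_pow (q ^ 2), inv_pow, inv_pow, ← pow_mul q N s,
            ← pow_mul q s N, mul_comm N s]
          ring
      _ ≤ C * D := by gcongr; exact hD N

theorem exists_besselJ_le (h : IsBesselParam q w) :
    ∃ C, 0 ≤ C ∧ ∀ y ∈ qReals q, |besselJ q w y| ≤ C := by
  obtain ⟨C, hC⟩ := exists_besselJ_mul_pow_le h 0
  simp only [pow_zero, mul_one] at hC
  exact ⟨C, (abs_nonneg _).trans (hC 0 zero_mem_qReals), hC⟩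

/-- The Taylor estimate holds uniformly on the whole lattice: for |y| > 1 both the bounded J and
every term with l < s are dominated by a multiple of y^(2s). -/
theorem exists_besselJ_sub_le (h : IsBesselParam q w) (s : ℕ) :
    ∃ C, ∀ y ∈ qReals q,
      |besselJ q w y - ∑ l ∈ Finset.range s, (-1) ^ l * besselCoeff q w l * (y ^ 2) ^ l| ≤
        C * (y ^ 2) ^ s := by
  obtain ⟨C, hC0, hC⟩ := exists_besselJ_le h
  have hpos := fun n => (besselCoeff_pos h n).le
  refine ⟨max (∑' l, besselCoeff q w l) (C + ∑ l ∈ Finset.range s, besselCoeff q w l),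
    fun y hy => ?_⟩
  rcases le_or_gt |y| 1 with h1 | h1
  · refine (abs_besselJ_sub_le h s h1).trans ?_
    gcongr
    exact le_max_left _ _
  · have hy2 : 1 ≤ y ^ 2 := by rw [← sq_abs]; nlinarith
    refine le_trans ?_ (mul_le_mul_of_nonneg_right (le_max_right _ _) (by positivity))
    refine (abs_sub _ _).trans ?_
    rw [add_mul, Finset.sum_mul]
    refine add_le_add ((hC y hy).trans (le_mul_of_one_le_right hC0 (one_le_pow₀ hy2))) ?_
    refine (Finset.abs_sum_le_sum_abs _ _).trans (Finset.sum_le_sum fun l hl => ?_)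
    rw [abs_mul, abs_mul, abs_pow, abs_neg, abs_one, one_pow, one_mul, abs_of_nonneg (hpos l),
      abs_of_nonneg (by positivity : 0 ≤ (y ^ 2) ^ l)]
    have := hpos l
    gcongr ?_ * ?_
    exact pow_le_pow_right₀ hy2 (Finset.mem_range.1 hl).le

end lattice

/-! ### Growth classes of bilateral sequences. -/

section sequences

/-- Bilateral sequences that decrease faster than any exponential in both directions. -/
def IsRapid (F : ℤ → ℂ) : Prop := ∀ t : ℝ, 0 < t → ∃ C, ∀ k, ‖F k‖ ≤ C * t ^ k

/-- Bounded bilateral sequences that decrease faster than any exponential at `-∞`. -/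
def IsDecay (u : ℤ → ℂ) : Prop := ∀ t : ℝ, 1 ≤ t → ∃ C, ∀ k, ‖u k‖ ≤ C * t ^ k

theorem IsRapid.isDecay {F : ℤ → ℂ} (hF : IsRapid F) : IsDecay F :=
  fun t ht => hF t (zero_lt_one.trans_le ht)

theorem nonneg_of_forall_norm_le {F : ℤ → ℂ} {C t : ℝ} (h : ∀ k, ‖F k‖ ≤ C * t ^ k) : 0 ≤ C := by
  simpa using (norm_nonneg _).trans (h 0)

theorem summable_zpow_of_le {f : ℤ → ℝ} (hf : ∀ k, 0 ≤ f k) {C a D b : ℝ} (ha0 : 0 < a)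
    (ha1 : a < 1) (hb : 1 < b) (h1 : ∀ k, f k ≤ C * a ^ k) (h2 : ∀ k, f k ≤ D * b ^ k) :
    Summable f := by
  refine Summable.of_nat_of_neg ?_ ?_
  · refine .of_nonneg_of_le (fun n => hf n) (fun n => ?_)
      ((summable_geometric_of_lt_one ha0.le ha1).mul_left C)
    simpa using h1 n
  · refine .of_nonneg_of_le (fun n => hf _) (fun n => ?_)
      ((summable_geometric_of_lt_one (inv_nonneg.2 (zero_lt_one.trans hb).le)
        (inv_lt_one_of_one_lt₀ hb)).mul_left D)
    simpa using h2 (-n)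

theorem IsDecay.summable {u : ℤ → ℂ} (hu : IsDecay u) {r : ℝ} (hr0 : 0 < r) (hr1 : r < 1) :
    Summable fun k => ‖u k‖ * r ^ k := by
  obtain ⟨C, hC⟩ := hu 1 le_rfl
  -- The rate 2/r turns the weight r^k into 2^k, which is summable towards -∞; boundedness alone
  -- handles +∞.
  obtain ⟨D, hD⟩ := hu (2 / r) ((one_le_div hr0).2 (by linarith))
  refine summable_zpow_of_le (C := C) (D := D) (fun k => by positivity) hr0 hr1 one_lt_two
    (fun k => ?_) (fun k => ?_)
  · have := hC k
    rw [one_zpow, mul_one] at this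
    gcongr
  · calc ‖u k‖ * r ^ k ≤ D * (2 / r) ^ k * r ^ k := by gcongr; exact hD k
      _ = D * 2 ^ k := by rw [mul_assoc, ← mul_zpow, div_mul_cancel₀ _ hr0.ne']

theorem IsRapid.summable {F : ℤ → ℂ} (hF : IsRapid F) {r : ℝ} (hr0 : 0 < r) :
    Summable fun k => ‖F k‖ * r ^ k := by
  obtain ⟨C, hC⟩ := hF (1 / (2 * r)) (by positivity)
  obtain ⟨D, hD⟩ := hF (2 / r) (by positivity)
  refine summable_zpow_of_le (C := C) (a := 1 / 2) (D := D) (fun k => by positivity)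
    (by norm_num) (by norm_num) one_lt_two (fun k => ?_) (fun k => ?_)
  · calc ‖F k‖ * r ^ k ≤ C * (1 / (2 * r)) ^ k * r ^ k := by gcongr; exact hC k
      _ = C * (1 / 2) ^ k := by
        rw [mul_assoc, ← mul_zpow]
        congr 2
        field_simp
  · calc ‖F k‖ * r ^ k ≤ D * (2 / r) ^ k * r ^ k := by gcongr; exact hD k
      _ = D * 2 ^ k := by rw [mul_assoc, ← mul_zpow, div_mul_cancel₀ _ hr0.ne']

theorem IsRapid.const_mul {F : ℤ → ℂ} (hF : IsRapid F) (c : ℂ) : IsRapid fun k => c * F k := by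
  intro t ht
  obtain ⟨C, hC⟩ := hF t ht
  refine ⟨‖c‖ * C, fun k => ?_⟩
  rw [norm_mul, mul_assoc]
  gcongr
  exact hC k

theorem IsRapid.mul {F G : ℤ → ℂ} (hF : IsRapid F) (hG : IsRapid G) :
    IsRapid fun k => F k * G k := by
  intro t ht
  obtain ⟨C, hC⟩ := hF t ht
  obtain ⟨D, hD⟩ := hG 1 one_pos
  have hC0 := nonneg_of_forall_norm_le hC
  refine ⟨D * C, fun k => ?_⟩
  rw [norm_mul, mul_comm, mul_assoc]
  gcongr
  · exact nonneg_of_forall_norm_le hD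
  · simpa using hD k
  · exact hC k

theorem IsRapid.mul_ofReal_zpow {F : ℤ → ℂ} (hF : IsRapid F) {r : ℝ} (hr : 0 < r) :
    IsRapid fun k => F k * ((r ^ k : ℝ) : ℂ) := by
  intro t ht
  obtain ⟨C, hC⟩ := hF (t / r) (by positivity)
  refine ⟨C, fun k => ?_⟩
  rw [norm_mul, Complex.norm_real, Real.norm_of_nonneg (by positivity)]
  calc ‖F k‖ * r ^ k ≤ C * (t / r) ^ k * r ^ k := by gcongr; exact hC k
    _ = C * t ^ k := by rw [mul_assoc, ← mul_zpow, div_mul_cancel₀ _ hr.ne']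

theorem IsDecay.shift {u : ℤ → ℂ} (hu : IsDecay u) (m : ℤ) : IsDecay fun k => u (k + m) := by
  intro t ht
  obtain ⟨C, hC⟩ := hu t ht
  refine ⟨C * t ^ m, fun k => (hC _).trans_eq ?_⟩
  rw [zpow_add₀ (zero_lt_one.trans_le ht).ne']
  ring

theorem IsDecay.isRapid {u : ℤ → ℂ} (hu : IsDecay u) {q : ℝ} (hq0 : 0 < q) (hq1 : q < 1)
    (h : ∀ s : ℕ, ∃ C, ∀ k, ‖u k‖ ≤ C * (q ^ k) ^ s) : IsRapid u := by
  intro t ht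
  rcases le_or_gt 1 t with h1 | h1
  · exact hu t h1
  obtain ⟨s, hs⟩ := exists_pow_lt_of_lt_one ht hq1
  obtain ⟨C, hC⟩ := h s
  obtain ⟨D, hD⟩ := hu 1 le_rfl
  have hC0 : 0 ≤ C := by simpa using (norm_nonneg _).trans (hC 0)
  refine ⟨max C D, fun k => ?_⟩
  rcases le_or_gt 0 k with hk | hk
  · obtain ⟨n, rfl⟩ := Int.eq_ofNat_of_zero_le hk
    refine (hC _).trans ?_
    gcongr
    · exact le_max_left _ _
    · rw [zpow_natCast, zpow_natCast, ← pow_mul, mul_comm, pow_mul]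
      gcongr
  · refine ((hD k).trans_eq (by simp)).trans ((le_max_right C D).trans ?_)
    refine le_mul_of_one_le_right (hC0.trans (le_max_left _ _)) ?_
    exact one_le_zpow_of_nonpos₀ ht h1.le hk.le

theorem isDecay_of_mul_pow_le {u : ℤ → ℂ} {q : ℝ} (hq0 : 0 < q) (hq1 : q < 1)
    (h : ∀ s : ℕ, ∃ C, ∀ k, ‖u k‖ * (q ^ k) ^ s ≤ C) : IsDecay u := by
  intro t ht
  obtain ⟨s, hs⟩ := exists_pow_lt_of_lt_one (inv_pos.2 (zero_lt_one.trans_le ht)) hq1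
  obtain ⟨C, hC⟩ := h s
  obtain ⟨D, hD⟩ := h 0
  have hD0 : 0 ≤ D := (by positivity : 0 ≤ ‖u 0‖ * (q ^ (0 : ℤ)) ^ 0).trans (hD 0)
  have ht0 := zero_lt_one.trans_le ht
  refine ⟨max C D, fun k => ?_⟩
  rcases le_or_gt 0 k with hk | hk
  · refine (by simpa using hD k : ‖u k‖ ≤ D).trans ((le_max_right C D).trans ?_)
    exact le_mul_of_one_le_right (hD0.trans (le_max_right _ _)) (one_le_zpow₀ ht hk)
  · obtain ⟨n, rfl⟩ : ∃ n : ℕ, k = -(n : ℤ) := ⟨k.natAbs, by omega⟩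
    have := hC (-(n : ℤ))
    rw [← le_div_iff₀ (by positivity), div_eq_mul_inv] at this
    refine this.trans (mul_le_mul (le_max_left _ _) ?_ (by positivity)
      (hD0.trans (le_max_right _ _)))
    rw [zpow_neg, zpow_neg, inv_pow, inv_inv, zpow_natCast, zpow_natCast, ← pow_mul, mul_comm,
      pow_mul, ← inv_pow]
    gcongr

end sequences

end Lattice

/-! ### Orthogonality and inversion of the discrete `q`-Bessel transform. -/

section Hankel

open Filter Topology

/-- The values of the `q`-Bessel function on the lattice `q ^ ℤ`. -/
noncomputable def latticeJ (q w : ℝ) (n : ℤ) : ℂ := (besselJ q w (q ^ n) : ℝ)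

/-- The `q`-Bessel operator on bilateral sequences, without the factor `q ^ 2 / (1 - q) ^ 2`. -/
noncomputable def besselLap (q w : ℝ) (u : ℤ → ℂ) (n : ℤ) : ℂ :=
  ((((q ^ n) ^ 2)⁻¹ : ℝ) : ℂ) *
    (u (n - 1) - ((1 + w / q ^ 2 : ℝ) : ℂ) * u n + ((w / q ^ 2 : ℝ) : ℂ) * u (n + 1))

/-- The bilateral `q`-Bessel sum evaluated at a real point. -/
noncomputable def besselSynth (q w : ℝ) (F : ℤ → ℂ) (x : ℝ) : ℂ :=
  ∑' k : ℤ, F k * (besselJ q w (x * q ^ k) : ℝ) * ((w ^ k : ℝ) : ℂ)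

/-- The discrete `q`-Bessel transform of a bilateral sequence. -/
noncomputable def hankel (q w : ℝ) (u : ℤ → ℂ) (k : ℤ) : ℂ :=
  ∑' n : ℤ, u n * latticeJ q w (n + k) * ((w ^ n : ℝ) : ℂ)

/-- The normalization of the discrete `q`-Bessel transform. -/
noncomputable def besselNorm (q w : ℝ) : ℝ := ∑' n : ℤ, besselJ q w (q ^ n) ^ 2 * w ^ n

section hankel

variable {q w : ℝ}

theorem besselSynth_zpow (h : IsBesselParam q w) (F : ℤ → ℂ) (m : ℤ) :
    besselSynth q w F (q ^ m) = hankel q w F m := by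
  simp only [besselSynth, hankel, latticeJ]
  exact tsum_congr fun k => by rw [add_comm, zpow_add₀ h.q_pos.ne']

theorem exists_norm_latticeJ_le (h : IsBesselParam q w) :
    ∃ C, 0 ≤ C ∧ ∀ n, ‖latticeJ q w n‖ ≤ C := by
  obtain ⟨C, hC0, hC⟩ := exists_besselJ_le h
  exact ⟨C, hC0, fun n => by simpa [latticeJ] using hC _ (zpow_mem_qReals n)⟩

theorem isDecay_latticeJ (h : IsBesselParam q w) : IsDecay (latticeJ q w) := by
  refine isDecay_of_mul_pow_le h.q_pos h.q_lt_one fun s => ?_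
  obtain ⟨C, hC⟩ := exists_besselJ_mul_pow_le h s
  refine ⟨C, fun k => ?_⟩
  simpa [latticeJ, abs_of_pos (zpow_pos h.q_pos k)] using hC _ (zpow_mem_qReals k)

theorem exists_norm_latticeJ_sub_le (h : IsBesselParam q w) :
    ∃ C, ∀ n : ℤ, ‖latticeJ q w (n - 1) - latticeJ q w n‖ ≤ C * (q ^ n) ^ 2 := by
  obtain ⟨C, hC⟩ := exists_besselJ_sub_le h 1
  have hq := h.q_pos.ne'
  refine ⟨C * (q ^ 2)⁻¹ + C, fun n => ?_⟩
  have h1 := hC _ (zpow_mem_qReals (n - 1))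
  have h2 := hC _ (zpow_mem_qReals n)
  simp only [Finset.sum_range_one, pow_zero, besselCoeff_zero, mul_one, pow_one] at h1 h2
  rw [latticeJ, latticeJ, ← Complex.ofReal_sub, Complex.norm_real, Real.norm_eq_abs]
  calc |besselJ q w (q ^ (n - 1)) - besselJ q w (q ^ n)|
      = |(besselJ q w (q ^ (n - 1)) - 1) - (besselJ q w (q ^ n) - 1)| := by ring_nf
    _ ≤ _ := abs_sub _ _
    _ ≤ _ := add_le_add h1 h2
    _ = _ := by rw [zpow_sub_one₀ hq]; ring

theorem besselLap_latticeJ (h : IsBesselParam q w) (k n : ℤ) :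
    besselLap q w (fun n => latticeJ q w (n + k)) n =
      ((-((q ^ k) ^ 2 / q ^ 2) : ℝ) : ℂ) * latticeJ q w (n + k) := by
  have hq := h.q_pos.ne'
  have := besselJ_recurrence h (q ^ (n + k))
  simp only [besselLap, latticeJ]
  rw [show n - 1 + k = (n + k) - 1 by ring, show n + 1 + k = (n + k) + 1 by ring,
    zpow_sub_one₀ hq, zpow_add_one₀ hq, ← div_eq_mul_inv]
  norm_cast
  rw [this, zpow_add₀ hq]
  field_simp

/-- The summand is V n - V (n + 1) for the weighted Casoratian V, so the sum telescopes. The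
hypotheses on first differences compensate the factor q^(-2n) and make V summable at +∞. -/
theorem besselLap_green (h : IsBesselParam q w) {u v : ℤ → ℂ} (hu : IsDecay u) (hv : IsDecay v)
    (hu' : ∃ C, ∀ n : ℤ, ‖u (n - 1) - u n‖ ≤ C * (q ^ n) ^ 2)
    (hv' : ∃ C, ∀ n : ℤ, ‖v (n - 1) - v n‖ ≤ C * (q ^ n) ^ 2) :
    HasSum (fun n => (besselLap q w u n * v n - u n * besselLap q w v n) * ((w ^ n : ℝ) : ℂ)) 0 := by
  obtain ⟨C, hC⟩ := hu'
  obtain ⟨D, hD⟩ := hv'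
  have hq := h.q_pos
  have hw := h.w_pos
  set V : ℤ → ℂ := fun n => (((w / q ^ 2) ^ n : ℝ) : ℂ) * (u (n - 1) * v n - v (n - 1) * u n) with hV
  have hVs : Summable V := by
    refine (((hv.summable hw h.w_lt_one).mul_left C).add
      ((hu.summable hw h.w_lt_one).mul_left D)).of_norm_bounded fun n => ?_
    have e : u (n - 1) * v n - v (n - 1) * u n =
      (u (n - 1) - u n) * v n - (v (n - 1) - v n) * u n := by ring
    simp only [hV]
    rw [norm_mul, e, Complex.norm_real, Real.norm_of_nonneg (by positivity)]
    calc (w / q ^ 2) ^ n * ‖(u (n - 1) - u n) * v n - (v (n - 1) - v n) * u n‖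
        ≤ (w / q ^ 2) ^ n * (C * (q ^ n) ^ 2 * ‖v n‖ + D * (q ^ n) ^ 2 * ‖u n‖) := by
          gcongr
          refine (norm_sub_le _ _).trans ?_
          rw [norm_mul, norm_mul]
          gcongr
          · exact hC n
          · exact hD n
      _ = C * (‖v n‖ * w ^ n) + D * (‖u n‖ * w ^ n) := by
          have : (q ^ n) ^ 2 = (q ^ 2) ^ n := by
            rw [← zpow_natCast, ← zpow_natCast, zpow_comm]
          rw [this, div_zpow]
          field_simp
  have hsh : HasSum (fun n => V (n + 1)) (∑' n, V n) :=
    (Equiv.addRight (1 : ℤ)).hasSum_iff.2 hVs.hasSum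
  have := hVs.hasSum.sub hsh
  rw [sub_self] at this
  refine this.congr_fun fun n => ?_
  simp only [hV, besselLap]
  rw [zpow_add_one₀ (by positivity), add_sub_cancel_right, div_zpow]
  have : (q ^ n) ^ 2 = (q ^ 2) ^ n := by
    rw [← zpow_natCast, ← zpow_natCast, zpow_comm]
  rw [this]
  push_cast
  field_simp
  ring

theorem summable_latticeJ_mul_latticeJ (h : IsBesselParam q w) (k l : ℤ) :
    Summable fun n => latticeJ q w (n + k) * latticeJ q w (n + l) * ((w ^ n : ℝ) : ℂ) := by
  obtain ⟨C, hC0, hC⟩ := exists_norm_latticeJ_le h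
  refine ((((isDecay_latticeJ h).shift k).summable h.w_pos h.w_lt_one).mul_left C).of_norm_bounded
    fun n => ?_
  have hw := zpow_pos h.w_pos n
  rw [norm_mul, norm_mul, Complex.norm_real, Real.norm_of_nonneg hw.le,
    mul_comm ‖latticeJ q w (n + k)‖, mul_assoc]
  gcongr
  exact hC _

/-- Both factors are eigenvectors of `besselLap`, with eigenvalues -q^(2k-2) and -q^(2l-2). These
differ, and Green's identity forces the pairing to vanish. -/
theorem tsum_latticeJ_mul_of_ne (h : IsBesselParam q w) {k l : ℤ} (hkl : k ≠ l) :
    ∑' n, latticeJ q w (n + k) * latticeJ q w (n + l) * ((w ^ n : ℝ) : ℂ) = 0 := by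
  have hq := h.q_pos
  have hd : ∀ k : ℤ, ∃ C, ∀ n : ℤ,
      ‖latticeJ q w (n - 1 + k) - latticeJ q w (n + k)‖ ≤ C * (q ^ n) ^ 2 := by
    intro k
    obtain ⟨C, hC⟩ := exists_norm_latticeJ_sub_le h
    refine ⟨C * (q ^ k) ^ 2, fun n => ?_⟩
    have := hC (n + k)
    rw [zpow_add₀ hq.ne', add_sub_right_comm] at this
    linarith
  have hg := besselLap_green h ((isDecay_latticeJ h).shift k) ((isDecay_latticeJ h).shift l)
    (hd k) (hd l)
  have hne : (((q ^ l) ^ 2 / q ^ 2 - (q ^ k) ^ 2 / q ^ 2 : ℝ) : ℂ) ≠ 0 := by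
    rw [Complex.ofReal_ne_zero, sub_ne_zero]
    intro he
    rw [div_left_inj' (by positivity)] at he
    have := (pow_left_inj₀ (zpow_pos hq l).le (zpow_pos hq k).le two_ne_zero).1 he
    exact hkl ((zpow_right_injective₀ hq h.q_lt_one.ne this).symm)
  have h2 : HasSum (fun n => (((q ^ l) ^ 2 / q ^ 2 - (q ^ k) ^ 2 / q ^ 2 : ℝ) : ℂ) *
      (latticeJ q w (n + k) * latticeJ q w (n + l) * ((w ^ n : ℝ) : ℂ))) 0 := by
    refine hg.congr_fun fun n => ?_
    rw [besselLap_latticeJ h, besselLap_latticeJ h]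
    push_cast
    ring
  have h3 := h2.tsum_eq
  rw [tsum_mul_left] at h3
  exact (mul_eq_zero.1 h3).resolve_left hne

theorem ofReal_besselNorm :
    (besselNorm q w : ℂ) = ∑' n, latticeJ q w n * latticeJ q w n * ((w ^ n : ℝ) : ℂ) := by
  rw [besselNorm, Complex.ofReal_tsum]
  refine tsum_congr fun n => ?_
  simp only [latticeJ]
  push_cast
  ring

theorem tsum_latticeJ_mul_self (h : IsBesselParam q w) (k : ℤ) :
    ∑' n, latticeJ q w (n + k) * latticeJ q w (n + k) * ((w ^ n : ℝ) : ℂ) =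
      besselNorm q w * (((w ^ k)⁻¹ : ℝ) : ℂ) := by
  rw [ofReal_besselNorm, ← tsum_mul_right, ← (Equiv.subRight k).tsum_eq]
  refine tsum_congr fun n => ?_
  have hw := h.w_pos.ne'
  simp only [Equiv.subRight_apply, sub_add_cancel]
  rw [mul_assoc _ _ (((w ^ k)⁻¹ : ℝ) : ℂ), ← Complex.ofReal_mul, zpow_sub₀ hw, div_eq_mul_inv]

theorem tendsto_zpow_natCast_atTop {q : ℝ} (hq0 : 0 < q) (hq1 : q < 1) :
    Tendsto (fun n : ℕ => q ^ (n : ℤ)) atTop (𝓝 0) := by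
  simpa using tendsto_pow_atTop_nhds_zero_of_lt_one hq0.le hq1

theorem tendsto_besselJ (h : IsBesselParam q w) {y : ℕ → ℝ} (hy : ∀ n, y n ∈ qReals q)
    (hlim : Tendsto y atTop (𝓝 0)) : Tendsto (fun n => besselJ q w (y n)) atTop (𝓝 1) := by
  obtain ⟨C, hC⟩ := exists_besselJ_sub_le h 1
  rw [tendsto_iff_norm_sub_tendsto_zero]
  have h0 : Tendsto (fun n => C * (y n ^ 2) ^ 1) atTop (𝓝 (C * (0 ^ 2) ^ 1)) :=
    ((hlim.pow 2).pow 1).const_mul C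
  simp only [ne_eq, OfNat.ofNat_ne_zero, not_false_eq_true, zero_pow, one_ne_zero, mul_zero] at h0
  refine squeeze_zero (fun n => norm_nonneg _) (fun n => ?_) h0
  simpa [besselCoeff_zero] using hC _ (hy n)

/-- Since J(q^n) → 1, some term of this nonnegative series is positive. Nothing more about its value
is needed. -/
theorem besselNorm_pos (h : IsBesselParam q w) : 0 < besselNorm q w := by
  have hw := h.w_pos
  have hs : Summable fun n : ℤ => besselJ q w (q ^ n) ^ 2 * w ^ n := by
    have := (summable_latticeJ_mul_latticeJ h 0 0).norm
    refine this.congr fun n => ?_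
    have hw := zpow_pos h.w_pos n
    simp only [add_zero, latticeJ]
    rw [norm_mul, norm_mul, Complex.norm_real, Complex.norm_real, Real.norm_of_nonneg hw.le,
      Real.norm_eq_abs, abs_mul_abs_self, sq]
  have hlim := tendsto_besselJ h (fun n : ℕ => zpow_mem_qReals (q := q) (n : ℤ))
    (tendsto_zpow_natCast_atTop h.q_pos h.q_lt_one)
  obtain ⟨n, hn⟩ := (hlim.eventually_ne one_ne_zero).exists
  exact hs.tsum_pos (fun n => by positivity) n (by positivity)

/-- The discrete `q`-Bessel transform is, up to the factor `besselNorm q w`, an involution. -/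
theorem hankel_hankel (h : IsBesselParam q w) {a : ℤ → ℂ} (ha : Summable fun n => ‖a n‖ * w ^ n)
    (m : ℤ) : hankel q w (hankel q w a) m = besselNorm q w * a m := by
  obtain ⟨C, hC0, hC⟩ := exists_norm_latticeJ_le h
  have hw := h.w_pos
  set f : ℤ → ℤ → ℂ := fun k n => a n * latticeJ q w (n + k) * ((w ^ n : ℝ) : ℂ) *
    (latticeJ q w (k + m) * ((w ^ k : ℝ) : ℂ)) with hf
  have hfs : Summable (Function.uncurry f) := by
    refine (((((isDecay_latticeJ h).shift m).summable hw h.w_lt_one).mul_left C).mul_of_nonneg ha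
      (fun k => by positivity) (fun n => by positivity)).of_norm_bounded fun ⟨k, n⟩ => ?_
    simp only [Function.uncurry, hf]
    rw [norm_mul, norm_mul, norm_mul, norm_mul, Complex.norm_real, Complex.norm_real,
      Real.norm_of_nonneg (zpow_pos hw n).le, Real.norm_of_nonneg (zpow_pos hw k).le]
    calc ‖a n‖ * ‖latticeJ q w (n + k)‖ * w ^ n * (‖latticeJ q w (k + m)‖ * w ^ k)
        ≤ ‖a n‖ * C * w ^ n * (‖latticeJ q w (k + m)‖ * w ^ k) := by gcongr; exact hC _
      _ = _ := by ring
  have h1 : hankel q w (hankel q w a) m = ∑' k, ∑' n, f k n := by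
    rw [hankel]
    refine tsum_congr fun k => ?_
    rw [hankel, mul_assoc, ← tsum_mul_right]
  -- After the exchange of sums, orthogonality leaves only the term n = m.
  rw [h1, ← hfs.tsum_comm, tsum_eq_single m]
  · have : ∀ k, f k m = a m * ((w ^ m : ℝ) : ℂ) *
        (latticeJ q w (k + m) * latticeJ q w (k + m) * ((w ^ k : ℝ) : ℂ)) := fun k => by
      simp only [hf]
      rw [add_comm m k]
      ring
    rw [tsum_congr this, tsum_mul_left, tsum_latticeJ_mul_self h]
    have : ((w ^ m : ℝ) : ℂ) * (((w ^ m)⁻¹ : ℝ) : ℂ) = 1 := by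
      rw [← Complex.ofReal_mul, mul_inv_cancel₀ (zpow_pos hw m).ne', Complex.ofReal_one]
    linear_combination a m * besselNorm q w * this
  · intro n hn
    have : ∀ k, f k n = a n * ((w ^ n : ℝ) : ℂ) *
        (latticeJ q w (k + n) * latticeJ q w (k + m) * ((w ^ k : ℝ) : ℂ)) := fun k => by
      simp only [hf]
      rw [add_comm n k]
      ring
    rw [tsum_congr this, tsum_mul_left, tsum_latticeJ_mul_of_ne h hn, mul_zero]

end hankel

end Hankel

/-! ### Taylor approximation at 0 and `q`-differentiability. -/

section Taylor

open Filter Topology Polynomial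

/-- Rapidly decreasing functions on `ℝ_q` with polynomial approximations of all orders at `0`. -/
structure HasTaylorDecay (q : ℝ) (f : ℝ → ℂ) : Prop where
  taylor : ∀ s : ℕ, ∃ (P : ℂ[X]) (C : ℝ), ∀ x ∈ qReals q, |x| ≤ 1 →
    ‖f x - P.eval (x : ℂ)‖ ≤ C * |x| ^ (s + 1)
  decay : ∀ m : ℕ, ∃ C : ℝ, ∀ x ∈ qReals q, 1 ≤ |x| → ‖f x‖ * |x| ^ m ≤ C

section taylor

variable {q : ℝ} {f : ℝ → ℂ}

theorem uniqueDiffWithinAt_qReals (hq0 : 0 < q) (hq1 : q < 1) :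
    UniqueDiffWithinAt ℝ (qReals q) 0 := by
  rw [uniqueDiffWithinAt_iff_accPt, accPt_iff_frequently]
  refine (tendsto_zpow_natCast_atTop hq0 hq1).frequently (Eventually.frequently (.of_forall fun n => ?_))
  exact ⟨(zpow_pos hq0 _).ne', zpow_mem_qReals _⟩

theorem hasDerivWithinAt_of_taylor {P : ℂ[X]} {C : ℝ} {s : ℕ}
    (h : ∀ x ∈ qReals q, |x| ≤ 1 → ‖f x - P.eval (x : ℂ)‖ ≤ C * |x| ^ (s + 2)) :
    HasDerivWithinAt f (P.coeff 1) (qReals q) 0 := by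
  have h1 : HasDerivWithinAt (fun x : ℝ => P.eval (x : ℂ)) (P.coeff 1) (qReals q) 0 := by
    have := (P.hasDerivAt (0 : ℂ)).comp_ofReal (z := 0)
    rw [← coeff_zero_eq_eval_zero, coeff_derivative] at this
    simpa using this.hasDerivWithinAt
  have h2 : HasDerivWithinAt (fun x : ℝ => f x - P.eval (x : ℂ)) 0 (qReals q) 0 := by
    rw [hasDerivWithinAt_iff_isLittleO]
    have h0 : f 0 - P.eval ((0 : ℝ) : ℂ) = 0 := by
      have := h 0 zero_mem_qReals (by simp)
      simpa using this
    simp only [h0, sub_zero, smul_zero]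
    have hO : (fun x : ℝ => f x - P.eval (x : ℂ)) =O[𝓝[qReals q] 0] fun x : ℝ => x ^ 2 := by
      refine Asymptotics.IsBigO.of_bound |C| ?_
      have : ∀ᶠ x : ℝ in 𝓝[qReals q] 0, |x| ≤ 1 := by
        refine eventually_nhdsWithin_of_eventually_nhds ?_
        have := (continuous_abs (G := ℝ)).tendsto 0
        rw [abs_zero] at this
        exact this.eventually (eventually_le_nhds one_pos)
      filter_upwards [this, self_mem_nhdsWithin] with x hx1 hx
      refine (h x hx hx1).trans ?_
      rw [norm_pow, Real.norm_eq_abs]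
      calc C * |x| ^ (s + 2) ≤ |C| * |x| ^ (s + 2) := by gcongr; exact le_abs_self C
        _ ≤ |C| * |x| ^ 2 := by
          gcongr ?_ * ?_
          exact pow_le_pow_of_le_one (abs_nonneg x) hx1 (by omega)
    have ho : (fun x : ℝ => x ^ 2) =o[𝓝[qReals q] 0] fun x : ℝ => x := by
      simpa using (Asymptotics.isLittleO_pow_pow (𝕜 := ℝ) one_lt_two).mono nhdsWithin_le_nhds
    exact hO.trans_isLittleO ho
  have h3 := h2.add h1
  rw [zero_add] at h3
  exact h3.congr_of_mem (fun x _ => (sub_add_cancel _ _).symm) zero_mem_qReals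

/-- P(x) - P(qx) has no constant term, so it is divisible by x. The value of the quotient at 0
matches the convention that `qDeriv` at 0 is the ordinary derivative. -/
theorem exists_qDeriv_polynomial (hq1 : q ≠ 1) (P : ℂ[X]) :
    ∃ Q : ℂ[X], Q.eval 0 = P.coeff 1 ∧ ∀ x : ℂ,
      P.eval x - P.eval (q * x) = (1 - q) * x * Q.eval x := by
  have hne : (1 - q : ℂ) ≠ 0 := by
    rw [sub_ne_zero]
    exact_mod_cast hq1.symm
  refine ⟨C (1 - q : ℂ)⁻¹ * (P - P.comp (C (q : ℂ) * X)).divX, ?_, fun x => ?_⟩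
  · rw [eval_mul, eval_C, ← coeff_zero_eq_eval_zero, coeff_divX, coeff_sub, comp_C_mul_X_coeff]
    field_simp
    ring
  · have := congrArg (eval x) (divX_mul_X_add (P - P.comp (C (q : ℂ) * X)))
    simp only [eval_add, eval_mul, eval_X, eval_sub, eval_comp, eval_C, coeff_sub,
      comp_C_mul_X_coeff, pow_zero, mul_one, sub_self, add_zero] at this
    rw [← this, eval_mul, eval_C]
    field_simp

theorem qDeriv_of_ne {x : ℝ} (hx : x ≠ 0) :
    qDeriv q f x = (f x - f (q * x)) / (((1 - q) * x : ℝ) : ℂ) := by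
  rw [qDeriv, if_neg hx]

theorem mul_mem_qReals (hq : q ≠ 0) {x : ℝ} (hx : x ∈ qReals q) : q * x ∈ qReals q := by
  simpa [mul_comm] using mul_pow_mem_qReals hq hx 1

namespace HasTaylorDecay

theorem differentiable (h : HasTaylorDecay q f) : DifferentiableWithinAt ℝ f (qReals q) 0 := by
  obtain ⟨P, C, hP⟩ := h.taylor 1
  exact (hasDerivWithinAt_of_taylor (s := 0) hP).differentiableWithinAt

theorem exists_norm_le (h : HasTaylorDecay q f) :
    ∃ B, ∀ x ∈ qReals q, |x| ≤ 1 → ‖f x‖ ≤ B := by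
  obtain ⟨P, D, hP⟩ := h.taylor 0
  obtain ⟨B, hB⟩ := (isCompact_Icc (a := (-1 : ℝ)) (b := 1)).exists_bound_of_continuousOn
    (f := fun x : ℝ => P.eval (x : ℂ)) (by fun_prop)
  refine ⟨|D| + B, fun x hx h1 => ?_⟩
  have h2 := hP x hx h1
  have h3 := hB x (abs_le.1 h1)
  have h4 : D * |x| ^ (0 + 1) ≤ |D| := by
    rw [zero_add, pow_one]
    refine (le_abs_self _).trans ?_
    rw [abs_mul, abs_abs]
    exact mul_le_of_le_one_right (abs_nonneg _) h1
  have := norm_add_le (f x - P.eval (x : ℂ)) (P.eval (x : ℂ))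
  rw [sub_add_cancel] at this
  linarith

/-- The `q`-difference quotient of a Taylor polynomial is again a polynomial, and division by (1 -
q)x costs the remainder one power of |x|. An approximation of order s + 1 for f thus yields order s
for its `q`-derivative. -/
theorem qDeriv (hq0 : 0 < q) (hq1 : q < 1) (h : HasTaylorDecay q f) :
    HasTaylorDecay q (qDeriv q f) := by
  have h1q : 0 < 1 - q := sub_pos.2 hq1
  have hn : ∀ x : ℝ, ‖(((1 - q) * x : ℝ) : ℂ)‖ = (1 - q) * |x| := fun x => by
    rw [Complex.norm_real, norm_mul, Real.norm_of_nonneg h1q.le, Real.norm_eq_abs]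
  refine ⟨fun s => ?_, fun m => ?_⟩
  · obtain ⟨P, C, hP⟩ := h.taylor (s + 1)
    obtain ⟨Q, hQ0, hQ⟩ := exists_qDeriv_polynomial hq1.ne P
    refine ⟨Q, (C + C) / (1 - q), fun x hx hx1 => ?_⟩
    rcases eq_or_ne x 0 with rfl | hx0
    · have hd := (hasDerivWithinAt_of_taylor hP).derivWithin (uniqueDiffWithinAt_qReals hq0 hq1)
      simp [_root_.qDeriv, hd, hQ0]
    · have hx0' : 0 < |x| := abs_pos.2 hx0
      have hC : 0 ≤ C := by
        have := (norm_nonneg _).trans (hP x hx hx1)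
        exact nonneg_of_mul_nonneg_left this (by positivity)
      have hd : (((1 - q) * x : ℝ) : ℂ) ≠ 0 := by
        rw [Complex.ofReal_ne_zero]; positivity
      have hqx : |q * x| ≤ |x| := by
        rw [abs_mul, abs_of_pos hq0]
        exact mul_le_of_le_one_left hx0'.le hq1.le
      have e : _root_.qDeriv q f x - Q.eval (x : ℂ) =
          ((f x - P.eval (x : ℂ)) - (f (q * x) - P.eval ((q * x : ℝ) : ℂ))) /
            (((1 - q) * x : ℝ) : ℂ) := by
        have := hQ x
        rw [qDeriv_of_ne hx0, eq_div_iff hd, sub_mul, div_mul_cancel₀ _ hd]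
        push_cast
        linear_combination this
      rw [e, norm_div, hn, div_le_iff₀ (by positivity)]
      refine (norm_sub_le _ _).trans ((add_le_add (hP x hx hx1)
        ((hP _ (mul_mem_qReals hq0.ne' hx) (hqx.trans hx1)).trans
          (mul_le_mul_of_nonneg_left (pow_le_pow_left₀ (abs_nonneg _) hqx _) hC))).trans_eq ?_)
      field_simp
      ring
  · obtain ⟨C, hC⟩ := h.decay m
    obtain ⟨B, hB⟩ := h.exists_norm_le
    obtain ⟨E, hE⟩ : ∃ E, ∀ x ∈ qReals q, ‖f x‖ * |x| ^ m ≤ E := by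
      refine ⟨max C B, fun x hx => ?_⟩
      rcases le_or_gt 1 |x| with h1 | h1
      · exact (hC x hx h1).trans (le_max_left _ _)
      · refine le_trans ?_ ((hB x hx h1.le).trans (le_max_right _ _))
        exact mul_le_of_le_one_right (norm_nonneg _) (pow_le_one₀ (abs_nonneg _) h1.le)
    refine ⟨(E + E / q ^ m) / (1 - q), fun x hx hx1 => ?_⟩
    have hx0 : x ≠ 0 := by rintro rfl; simp at hx1; linarith
    have h2 := hE _ (mul_mem_qReals hq0.ne' hx)
    have h3 := hE x hx
    rw [abs_mul, abs_of_pos hq0, mul_pow, ← mul_assoc, mul_right_comm, ← le_div_iff₀ (by positivity)]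
      at h2
    rw [qDeriv_of_ne hx0, norm_div, hn, div_mul_eq_mul_div, div_le_div_iff₀ (by positivity) h1q]
    have h4 : ‖f x - f (q * x)‖ * |x| ^ m ≤ E + E / q ^ m := by
      refine (mul_le_mul_of_nonneg_right (norm_sub_le _ _) (by positivity)).trans ?_
      rw [add_mul]
      exact add_le_add h3 h2
    have h5 : 0 ≤ E + E / q ^ m := le_trans (by positivity) h4
    nlinarith [mul_le_mul_of_nonneg_left hx1 (mul_nonneg h5 h1q.le),
      mul_le_mul_of_nonneg_right h4 h1q.le]

theorem iterate_qDeriv (hq0 : 0 < q) (hq1 : q < 1) (h : HasTaylorDecay q f) (k : ℕ) :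
    HasTaylorDecay q ((_root_.qDeriv q)^[k] f) := by
  induction k with
  | zero => exact h
  | succ k ih =>
    rw [Function.iterate_succ_apply']
    exact ih.qDeriv hq0 hq1

theorem isQSchwartz (hq0 : 0 < q) (hq1 : q < 1) (h : HasTaylorDecay q f)
    (heven : ∀ x ∈ qReals q, f (-x) = f x) : IsQSchwartz q f := by
  refine ⟨heven, fun k => (h.iterate_qDeriv hq0 hq1 k).differentiable, fun k m => ?_⟩
  have hk := h.iterate_qDeriv hq0 hq1 k
  generalize (_root_.qDeriv q)^[k] f = g at hk
  obtain ⟨C, hC⟩ := hk.decay (2 * m)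
  obtain ⟨B, hB⟩ := hk.exists_norm_le
  refine ⟨2 ^ m * max C B, fun x hx => ?_⟩
  rcases le_or_gt 1 |x| with h1 | h1
  · have h2 := hC x hx h1
    calc (1 + x ^ 2) ^ m * ‖g x‖ ≤ (2 * |x| ^ 2) ^ m * ‖g x‖ := by
          gcongr
          rw [← sq_abs]
          nlinarith
      _ = 2 ^ m * (‖g x‖ * |x| ^ (2 * m)) := by rw [mul_pow, pow_mul]; ring
      _ ≤ _ := by gcongr; exact h2.trans (le_max_left _ _)
  · have := hB x hx h1.le
    gcongr
    · rw [← sq_abs]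
      nlinarith [abs_nonneg x]
    · exact this.trans (le_max_right _ _)

end HasTaylorDecay

end taylor

end Taylor

/-! ### `q`-Bessel sums of rapid sequences lie in S_{*q,β}. -/

section Synthesis

open Filter Topology Polynomial

/-- `f` is on `ℝ_q` the `q`-Bessel transform of the rapidly decreasing sequence `F`. -/
structure IsBesselRep (q w : ℝ) (f : ℝ → ℂ) (F : ℤ → ℂ) : Prop where
  rapid : IsRapid F
  eq : ∀ x ∈ qReals q, f x = besselSynth q w F x

section synth

variable {q w : ℝ}

theorem sq_zpow_eq (q : ℝ) (k : ℤ) : (q ^ k) ^ 2 = (q ^ 2) ^ k := by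
  rw [← zpow_natCast, ← zpow_natCast, zpow_comm]

theorem mul_sq_pow_zpow (q w : ℝ) (l : ℕ) (k : ℤ) :
    (w * (q ^ 2) ^ l) ^ k = w ^ k * ((q ^ k) ^ 2) ^ l := by
  rw [mul_zpow, sq_zpow_eq, ← zpow_natCast, ← zpow_natCast ((q ^ 2) ^ k), zpow_comm]

theorem IsDecay.summable_moment {u : ℤ → ℂ} (h : IsBesselParam q w) (hu : IsDecay u) (l : ℕ) :
    Summable fun k => ‖u k‖ * (w * (q ^ 2) ^ l) ^ k :=
  hu.summable (mul_pos h.w_pos (pow_pos h.sq_pos l))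
    (mul_pow_lt_one h.sq_pos h.sq_lt_one h.w_pos.le h.w_lt_one l)

/-- The asymptotic expansion at `0` of a `q`-Bessel transform. -/
theorem exists_besselSynth_sub_le (h : IsBesselParam q w) {F : ℤ → ℂ}
    (hF : ∀ l : ℕ, Summable fun k => ‖F k‖ * (w * (q ^ 2) ^ l) ^ k) (s : ℕ) :
    ∃ C, ∀ x ∈ qReals q,
      ‖besselSynth q w F x - ∑ l ∈ Finset.range s, (((-1) ^ l * besselCoeff q w l : ℝ) : ℂ) *
        (∑' k, F k * (((w * (q ^ 2) ^ l) ^ k : ℝ) : ℂ)) * ((x : ℂ) ^ 2) ^ l‖ ≤ C * (x ^ 2) ^ s := by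
  have hq := h.q_pos
  have hw := h.w_pos
  obtain ⟨C, hC⟩ := exists_besselJ_sub_le h s
  obtain ⟨B, hB0, hB⟩ := exists_besselJ_le h
  refine ⟨∑' k, C * (‖F k‖ * (w * (q ^ 2) ^ s) ^ k), fun x hx => ?_⟩
  have hs0 : Summable fun k : ℤ => F k * (besselJ q w (x * q ^ k) : ℝ) * ((w ^ k : ℝ) : ℂ) := by
    have := hF 0
    simp only [pow_zero, mul_one] at this
    refine (this.mul_left B).of_norm_bounded fun k => ?_
    rw [norm_mul, norm_mul, Complex.norm_real, Complex.norm_real,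
      Real.norm_of_nonneg (zpow_pos hw k).le, Real.norm_eq_abs, mul_comm ‖F k‖, mul_assoc]
    gcongr
    exact hB _ (mul_zpow_mem_qReals hq.ne' hx k)
  have hsl : ∀ l ∈ Finset.range s, Summable fun k : ℤ =>
      (((-1) ^ l * besselCoeff q w l : ℝ) : ℂ) *
        (F k * (((w * (q ^ 2) ^ l) ^ k : ℝ) : ℂ)) * ((x : ℂ) ^ 2) ^ l := by
    intro l _
    refine (Summable.mul_left _ ?_).mul_right _
    refine (hF l).of_norm_bounded fun k => ?_
    rw [norm_mul, Complex.norm_real, Real.norm_of_nonneg (by positivity)]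
  have e : besselSynth q w F x - ∑ l ∈ Finset.range s, (((-1) ^ l * besselCoeff q w l : ℝ) : ℂ) *
        (∑' k, F k * (((w * (q ^ 2) ^ l) ^ k : ℝ) : ℂ)) * ((x : ℂ) ^ 2) ^ l =
      ∑' k, F k * ((w ^ k : ℝ) : ℂ) * ((besselJ q w (x * q ^ k) - ∑ l ∈ Finset.range s,
        (-1) ^ l * besselCoeff q w l * ((x * q ^ k) ^ 2) ^ l : ℝ) : ℂ) := by
    simp_rw [← tsum_mul_left, ← tsum_mul_right]
    rw [← Summable.tsum_finsetSum hsl, besselSynth, ← hs0.tsum_sub (summable_sum hsl)]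
    refine tsum_congr fun k => ?_
    rw [Complex.ofReal_sub, mul_sub, Complex.ofReal_sum, Finset.mul_sum]
    congr 1
    · ring
    · refine Finset.sum_congr rfl fun l _ => ?_
      rw [mul_sq_pow_zpow, mul_pow x]
      push_cast
      ring
  rw [e, ← tsum_mul_right]
  refine tsum_of_norm_bounded (((hF s).mul_left C).mul_right _).hasSum fun k => ?_
  rw [norm_mul, norm_mul, Complex.norm_real, Complex.norm_real,
    Real.norm_of_nonneg (zpow_pos hw k).le, Real.norm_eq_abs, mul_sq_pow_zpow]
  refine (mul_le_mul_of_nonneg_left (hC _ (mul_zpow_mem_qReals hq.ne' hx k))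
    (by positivity)).trans_eq ?_
  rw [mul_pow x]
  ring

theorem tendsto_besselSynth (h : IsBesselParam q w) {F : ℤ → ℂ} (hF : IsRapid F) {y : ℕ → ℝ}
    (hy : ∀ n, y n ∈ qReals q) (hlim : Tendsto y atTop (𝓝 0)) :
    Tendsto (fun n => besselSynth q w F (y n)) atTop (𝓝 (besselSynth q w F 0)) := by
  obtain ⟨C, hC⟩ := exists_besselSynth_sub_le h (hF.isDecay.summable_moment h) 1
  simp only [Finset.sum_range_one, pow_zero, mul_one, pow_one] at hC
  -- At x = 0 the error bound is zero, which identifies the constant coefficient with the value at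
  -- 0.
  have h0 := hC 0 zero_mem_qReals
  rw [zero_pow two_ne_zero, mul_zero, norm_le_zero_iff, sub_eq_zero] at h0
  rw [← h0] at hC
  rw [tendsto_iff_norm_sub_tendsto_zero]
  have h1 : Tendsto (fun n => C * (y n) ^ 2) atTop (𝓝 (C * 0 ^ 2)) := (hlim.pow 2).const_mul C
  rw [zero_pow two_ne_zero, mul_zero] at h1
  exact squeeze_zero (fun n => norm_nonneg _) (fun n => hC _ (hy n)) h1

/-- |x|^m |J(x q^k)| is at most C q^(-km), and the rapid decrease of F absorbs q^(-km). -/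
theorem exists_besselSynth_mul_pow_le (h : IsBesselParam q w) {F : ℤ → ℂ} (hF : IsRapid F)
    (m : ℕ) : ∃ C, ∀ x ∈ qReals q, ‖besselSynth q w F x‖ * |x| ^ m ≤ C := by
  have hq := h.q_pos
  have hw := h.w_pos
  obtain ⟨C, hC⟩ := exists_besselJ_mul_pow_le h m
  refine ⟨∑' k, C * (‖F k‖ * (w * (q ^ m)⁻¹) ^ k), fun x hx => ?_⟩
  have hb : ‖besselSynth q w F x * ((|x| ^ m : ℝ) : ℂ)‖ ≤
      ∑' k, C * (‖F k‖ * (w * (q ^ m)⁻¹) ^ k) := by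
    rw [besselSynth, ← tsum_mul_right]
    refine tsum_of_norm_bounded ((hF.summable (by positivity)).mul_left C).hasSum fun k => ?_
    have := hC _ (mul_zpow_mem_qReals hq.ne' hx k)
    rw [norm_mul, norm_mul, norm_mul, Complex.norm_real, Complex.norm_real, Complex.norm_real,
      Real.norm_of_nonneg (zpow_pos hw k).le, Real.norm_of_nonneg (by positivity : 0 ≤ |x| ^ m),
      Real.norm_eq_abs]
    rw [abs_mul, abs_of_pos (zpow_pos hq k), mul_pow, ← mul_assoc, ← le_div_iff₀ (by positivity)]
      at this
    calc ‖F k‖ * |besselJ q w (x * q ^ k)| * w ^ k * |x| ^ m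
        = ‖F k‖ * w ^ k * (|besselJ q w (x * q ^ k)| * |x| ^ m) := by ring
      _ ≤ ‖F k‖ * w ^ k * (C / (q ^ k) ^ m) := by gcongr
      _ = C * (‖F k‖ * (w * (q ^ m)⁻¹) ^ k) := by
        rw [mul_zpow, inv_zpow, ← zpow_natCast, ← zpow_natCast q, zpow_comm]
        ring
  rwa [norm_mul, Complex.norm_real, Real.norm_of_nonneg (by positivity : 0 ≤ |x| ^ m)] at hb

namespace IsBesselRep

variable {f : ℝ → ℂ} {F : ℤ → ℂ}

theorem even (hf : IsBesselRep q w f F) {x : ℝ} (hx : x ∈ qReals q) : f (-x) = f x := by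
  rw [hf.eq x hx, hf.eq _ (neg_mem_qReals hx), besselSynth, besselSynth]
  simp_rw [neg_mul, besselJ_neg]

theorem zpow_eq (h : IsBesselParam q w) (hf : IsBesselRep q w f F) (n : ℤ) :
    f (q ^ n) = hankel q w F n := by
  rw [hf.eq _ (zpow_mem_qReals n), besselSynth_zpow h]

theorem isDecay (h : IsBesselParam q w) (hf : IsBesselRep q w f F) :
    IsDecay fun n => f (q ^ n) := by
  refine isDecay_of_mul_pow_le h.q_pos h.q_lt_one fun s => ?_
  obtain ⟨C, hC⟩ := exists_besselSynth_mul_pow_le h hf.rapid s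
  refine ⟨C, fun k => ?_⟩
  rw [hf.eq _ (zpow_mem_qReals k)]
  simpa [abs_of_pos (zpow_pos h.q_pos k)] using hC _ (zpow_mem_qReals k)

theorem hankel_eq (h : IsBesselParam q w) (hf : IsBesselRep q w f F) (k : ℤ) :
    hankel q w (fun n => f (q ^ n)) k = besselNorm q w * F k := by
  rw [← hankel_hankel h (hf.rapid.summable h.w_pos)]
  simp_rw [hf.zpow_eq h]

theorem hasTaylorDecay (h : IsBesselParam q w) (hf : IsBesselRep q w f F) :
    HasTaylorDecay q f := by
  refine ⟨fun s => ?_, fun m => ?_⟩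
  · obtain ⟨C, hC⟩ := exists_besselSynth_sub_le h (hf.rapid.isDecay.summable_moment h) (s + 1)
    refine ⟨∑ l ∈ Finset.range (s + 1), Polynomial.C ((((-1) ^ l * besselCoeff q w l : ℝ) : ℂ) *
        (∑' k, F k * (((w * (q ^ 2) ^ l) ^ k : ℝ) : ℂ))) * (X ^ 2) ^ l, |C|, fun x hx hx1 => ?_⟩
    have := hC x hx
    rw [hf.eq x hx, eval_finsetSum]
    simp only [eval_mul, eval_C, eval_pow, eval_X]
    refine this.trans ?_
    calc C * (x ^ 2) ^ (s + 1) ≤ |C| * (x ^ 2) ^ (s + 1) := by gcongr; exact le_abs_self C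
      _ ≤ |C| * |x| ^ (s + 1) := by
        gcongr
        rw [← sq_abs]
        nlinarith [abs_nonneg x]
  · obtain ⟨C, hC⟩ := exists_besselSynth_mul_pow_le h hf.rapid m
    exact ⟨C, fun x hx _ => by rw [hf.eq x hx]; exact hC x hx⟩

/-- By inversion the transform of f is a multiple of F, hence flat as n → +∞. The moments of f are,
up to nonzero factors, the coefficients of the asymptotic expansion of that transform in powers of
q^(2n). They vanish one after another. -/
theorem moment_eq_zero (h : IsBesselParam q w) (hf : IsBesselRep q w f F) (l : ℕ) :
    ∑' n : ℤ, f (q ^ n) * (((w * (q ^ 2) ^ l) ^ n : ℝ) : ℂ) = 0 := by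
  have hq := h.q_pos
  induction l using Nat.strong_induction_on with
  | _ l ih =>
    obtain ⟨C, hC⟩ := exists_besselSynth_sub_le h ((hf.isDecay h).summable_moment h) (l + 1)
    -- This rate makes F(n) as small as the remainder of the expansion of order l + 1.
    obtain ⟨D, hD⟩ := hf.rapid ((q ^ 2) ^ (l + 1)) (by positivity)
    set M := ∑' n : ℤ, f (q ^ n) * (((w * (q ^ 2) ^ l) ^ n : ℝ) : ℂ) with hM
    have hN := besselNorm_pos h
    have hb : ∀ n : ℕ, ‖(((-1) ^ l * besselCoeff q w l : ℝ) : ℂ) * M‖ ≤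
        (C + besselNorm q w * D) * (q ^ 2) ^ n := by
      intro n
      have h1 := hC _ (zpow_mem_qReals (n : ℤ))
      rw [besselSynth_zpow h, hf.hankel_eq h, Finset.sum_range_succ, Finset.sum_eq_zero, zero_add,
        ← hM] at h1
      · have h2 := hD n
        have h3 := norm_sub_norm_le ((((-1) ^ l * besselCoeff q w l : ℝ) : ℂ) * M *
          (((q ^ (n : ℤ) : ℝ) : ℂ) ^ 2) ^ l) (besselNorm q w * F n)
        rw [norm_sub_rev, norm_mul (besselNorm q w : ℂ), Complex.norm_real,
          Real.norm_of_nonneg hN.le] at h3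
        have h4 : ‖(((-1) ^ l * besselCoeff q w l : ℝ) : ℂ) * M *
            (((q ^ (n : ℤ) : ℝ) : ℂ) ^ 2) ^ l‖ =
            ‖(((-1) ^ l * besselCoeff q w l : ℝ) : ℂ) * M‖ * ((q ^ 2) ^ n) ^ l := by
          rw [norm_mul, norm_pow, norm_pow, Complex.norm_real,
            Real.norm_of_nonneg (zpow_pos hq _).le, sq_zpow_eq, zpow_natCast]
        rw [h4] at h3
        simp only [zpow_natCast] at h3
        simp only [zpow_natCast, pow_succ _ l] at h1
        rw [pow_right_comm q n 2] at h1
        rw [zpow_natCast, ← pow_mul, mul_comm (l + 1), pow_mul, pow_succ _ l] at h2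
        have h5 : 0 < ((q ^ 2) ^ n) ^ l := by positivity
        rw [← mul_le_mul_iff_left₀ h5]
        have h6 := mul_le_mul_of_nonneg_left h2 hN.le
        linarith
      · intro i hi
        rw [ih i (Finset.mem_range.1 hi), mul_zero, zero_mul]
    have hlim : Tendsto (fun n : ℕ => (C + besselNorm q w * D) * (q ^ 2) ^ n) atTop (𝓝 0) := by
      simpa using (tendsto_pow_atTop_nhds_zero_of_lt_one h.sq_pos.le h.sq_lt_one).const_mul
        (C + besselNorm q w * D)
    have h0 := ge_of_tendsto' hlim hb
    rw [norm_le_zero_iff, mul_eq_zero, Complex.ofReal_eq_zero] at h0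
    refine h0.resolve_left (mul_ne_zero (pow_ne_zero _ (by norm_num)) (besselCoeff_pos h l).ne')

/-- Evenness and continuity at 0 along q^n extend the representation from the positive lattice to
ℝ_q; the `q`-Bessel sum has both properties itself. -/
theorem of_zpow (h : IsBesselParam q w) (hF : IsRapid F)
    (heven : ∀ x ∈ qReals q, f (-x) = f x)
    (hlim : Tendsto (fun n : ℕ => f (q ^ (n : ℤ))) atTop (𝓝 (f 0)))
    (heq : ∀ n : ℤ, f (q ^ n) = hankel q w F n) : IsBesselRep q w f F := by
  refine ⟨hF, fun x hx => ?_⟩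
  have hz : ∀ n : ℤ, f (q ^ n) = besselSynth q w F (q ^ n) := fun n => by
    rw [heq, besselSynth_zpow h]
  rcases hx with rfl | ⟨n, rfl | rfl⟩
  · refine tendsto_nhds_unique hlim ?_
    simp_rw [hz]
    exact tendsto_besselSynth h hF (fun n => zpow_mem_qReals _)
      (tendsto_zpow_natCast_atTop h.q_pos h.q_lt_one)
  · exact hz n
  · rw [heven _ (zpow_mem_qReals n), hz, besselSynth, besselSynth]
    simp_rw [neg_mul, besselJ_neg]

end IsBesselRep

theorem zpow_rpow (hq : 0 < q) (n : ℤ) (r : ℝ) : (q ^ n) ^ r = (q ^ r) ^ n := by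
  rw [← Real.rpow_intCast, ← Real.rpow_intCast, ← Real.rpow_mul hq.le, ← Real.rpow_mul hq.le,
    mul_comm]

theorem isBesselParam_rpow (hq0 : 0 < q) (hq1 : q < 1) {β : ℝ} (hβ : -1 < β) :
    IsBesselParam q (q ^ (2 * β + 2)) :=
  ⟨hq0, hq1, Real.rpow_pos_of_pos hq0 _, Real.rpow_lt_one hq0.le hq1 (by linarith)⟩

theorem zpow_rpow_mul_zpow (hq : 0 < q) (β : ℝ) (l : ℕ) (n : ℤ) :
    (q ^ n) ^ (2 * (l : ℝ) + 2 * β + 1) * q ^ n = (q ^ (2 * β + 2) * (q ^ 2) ^ l) ^ n := by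
  rw [zpow_rpow hq, ← mul_zpow]
  congr 1
  rw [← Real.rpow_add_one hq.ne', ← pow_mul, ← Real.rpow_natCast q, ← Real.rpow_add hq]
  congr 1
  push_cast
  ring

theorem qInt_moment (hq : 0 < q) (β : ℝ) (f : ℝ → ℂ) (l : ℕ) :
    qInt q (fun x => f x * ((x ^ (2 * (l : ℝ) + 2 * β + 1) : ℝ) : ℂ)) =
      ((1 - q : ℝ) : ℂ) *
        ∑' n : ℤ, f (q ^ n) * (((q ^ (2 * β + 2) * (q ^ 2) ^ l) ^ n : ℝ) : ℂ) := by
  rw [qInt]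
  congr 1
  refine tsum_congr fun n => ?_
  rw [← zpow_rpow_mul_zpow hq, Complex.ofReal_mul, mul_assoc]

theorem IsBesselRep.mem_qSchwartzMoment {f : ℝ → ℂ} {F : ℤ → ℂ} (hq0 : 0 < q) (hq1 : q < 1)
    {β : ℝ} (hβ : -1 < β) (hf : IsBesselRep q (q ^ (2 * β + 2)) f F) :
    f ∈ qSchwartzMoment q β := by
  have h := isBesselParam_rpow hq0 hq1 hβ
  refine ⟨(hf.hasTaylorDecay h).isQSchwartz hq0 hq1 fun x hx => hf.even hx, fun k => ?_⟩
  rw [qInt_moment hq0, hf.moment_eq_zero h, mul_zero]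

end synth

end Synthesis

/-! ### Functions of S_{*q,β} are `q`-Bessel sums of rapid sequences. -/

section Expansion

open Filter Topology Polynomial Asymptotics

section qTaylor

variable {q : ℝ} {f : ℝ → ℂ}

theorem exists_qAntideriv_polynomial (hq0 : 0 < q) (hq1 : q < 1) (P : ℂ[X]) (c : ℂ) :
    ∃ Q : ℂ[X], Q.eval 0 = c ∧ ∀ x : ℂ, Q.eval x - Q.eval (q * x) = (1 - q) * x * P.eval x := by
  suffices h : ∃ Q : ℂ[X], Q.eval 0 = 0 ∧
      ∀ x : ℂ, Q.eval x - Q.eval (q * x) = (1 - q) * x * P.eval x by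
    obtain ⟨Q, h0, hQ⟩ := h
    exact ⟨Q + C c, by simp [h0], fun x => by simp [← hQ]⟩
  induction P using Polynomial.induction_on' with
  | add P₁ P₂ h₁ h₂ =>
    obtain ⟨Q₁, h01, hQ₁⟩ := h₁
    obtain ⟨Q₂, h02, hQ₂⟩ := h₂
    refine ⟨Q₁ + Q₂, by simp [h01, h02], fun x => ?_⟩
    rw [eval_add, eval_add, eval_add, mul_add, ← hQ₁, ← hQ₂]
    ring
  | monomial n a =>
    have hne : (1 - (q : ℂ) ^ (n + 1)) ≠ 0 := by
      rw [sub_ne_zero]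
      exact_mod_cast (pow_lt_one₀ hq0.le hq1 n.succ_ne_zero).ne'
    refine ⟨monomial (n + 1) (a * (1 - q) / (1 - (q : ℂ) ^ (n + 1))), by simp, fun x => ?_⟩
    simp only [eval_monomial]
    rw [mul_pow]
    generalize hD : 1 - (q : ℂ) ^ (n + 1) = D at hne ⊢
    field_simp
    rw [← hD]
    ring

theorem exists_even_polynomial (P : ℂ[X]) :
    ∃ R : ℂ[X], ∀ x : ℂ, P.eval x + P.eval (-x) = 2 * R.eval (x ^ 2) := by
  induction P using Polynomial.induction_on' with
  | add P₁ P₂ h₁ h₂ =>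
    obtain ⟨R₁, hR₁⟩ := h₁
    obtain ⟨R₂, hR₂⟩ := h₂
    refine ⟨R₁ + R₂, fun x => ?_⟩
    rw [eval_add, eval_add, eval_add, mul_add, ← hR₁, ← hR₂]
    ring
  | monomial n a =>
    rcases Nat.even_or_odd' n with ⟨k, rfl | rfl⟩
    · refine ⟨monomial k a, fun x => ?_⟩
      simp only [eval_monomial, pow_mul, neg_sq]
      ring
    · refine ⟨0, fun x => ?_⟩
      simp only [eval_monomial, eval_zero, pow_succ, pow_mul]
      ring

/-- A `q`-analogue of integrating a Taylor expansion: Q is the `q`-antiderivative of P with Q(0) =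
f(0). The remainder changes by at most (1 - q) C |x|^(s+1) from x to qx, and the steps along x q^n
are summed. Continuity at 0 removes the limit term. -/
theorem exists_taylor_of_qDeriv (hq0 : 0 < q) (hq1 : q < 1)
    (hf : ContinuousWithinAt f (qReals q) 0) {s : ℕ} {P : ℂ[X]} {C : ℝ}
    (hP : ∀ x ∈ qReals q, x ≠ 0 → |x| ≤ 1 → ‖qDeriv q f x - P.eval (x : ℂ)‖ ≤ C * |x| ^ s) :
    ∃ Q : ℂ[X], ∀ x ∈ qReals q, x ≠ 0 → |x| ≤ 1 → ‖f x - Q.eval (x : ℂ)‖ ≤ C * |x| ^ (s + 1) := by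
  obtain ⟨Q, hQ0, hQ⟩ := exists_qAntideriv_polynomial hq0 hq1 P (f 0)
  refine ⟨Q, fun x hx hx0 hx1 => ?_⟩
  have h1q : 0 < 1 - q := sub_pos.2 hq1
  set r : ℝ → ℂ := fun x => f x - Q.eval (x : ℂ) with hr
  have hstep : ∀ x ∈ qReals q, x ≠ 0 → |x| ≤ 1 →
      ‖r x‖ ≤ ‖r (x * q)‖ + (1 - q) * (C * |x| ^ (s + 1)) := by
    intro x hx hx0 hx1
    have hd : (((1 - q) * x : ℝ) : ℂ) ≠ 0 := by
      rw [Complex.ofReal_ne_zero]; positivity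
    have e : r x = r (x * q) + (((1 - q) * x : ℝ) : ℂ) * (qDeriv q f x - P.eval (x : ℂ)) := by
      have := hQ x
      simp only [hr]
      rw [qDeriv_of_ne hx0, mul_sub, mul_div_cancel₀ _ hd, mul_comm x q]
      push_cast
      linear_combination -this
    rw [e]
    refine (norm_add_le _ _).trans (add_le_add le_rfl ?_)
    rw [norm_mul, Complex.norm_real, norm_mul, Real.norm_of_nonneg h1q.le, Real.norm_eq_abs,
      mul_assoc]
    refine mul_le_mul_of_nonneg_left ?_ h1q.le
    calc |x| * ‖qDeriv q f x - P.eval (x : ℂ)‖ ≤ |x| * (C * |x| ^ s) := by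
          gcongr; exact hP x hx hx0 hx1
      _ = C * |x| ^ (s + 1) := by ring
  have hC : 0 ≤ C := by
    have := (norm_nonneg _).trans (hP x hx hx0 hx1)
    have hx0' : 0 < |x| := abs_pos.2 hx0
    exact nonneg_of_mul_nonneg_left this (by positivity)
  -- The factor 1 - q^n is the sum of (1 - q) q^j over j < n; one uses q^(j(s+1)) ≤ q^j.
  have hit : ∀ n : ℕ, ‖r x‖ ≤ ‖r (x * q ^ n)‖ + C * |x| ^ (s + 1) * (1 - q ^ n) := by
    intro n
    induction n with
    | zero => simp
    | succ n ih =>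
      have habs : |x * q ^ n| = |x| * q ^ n := by rw [abs_mul, abs_of_pos (pow_pos hq0 n)]
      have hqn : q ^ n ≤ 1 := pow_le_one₀ hq0.le hq1.le
      have h2 := hstep (x * q ^ n) (mul_pow_mem_qReals hq0.ne' hx n)
        (mul_ne_zero hx0 (pow_pos hq0 n).ne')
        (by rw [habs]; exact mul_le_one₀ hx1 (by positivity) hqn)
      rw [habs, mul_assoc x, ← pow_succ] at h2
      have h3 : (|x| * q ^ n) ^ (s + 1) ≤ |x| ^ (s + 1) * q ^ n := by
        rw [mul_pow]
        gcongr
        exact pow_le_of_le_one (by positivity) hqn s.succ_ne_zero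
      have h4 : (1 - q) * (C * (|x| * q ^ n) ^ (s + 1)) ≤ (1 - q) * (C * (|x| ^ (s + 1) * q ^ n)) := by
        gcongr
      have h5 : C * |x| ^ (s + 1) * (1 - q ^ (n + 1)) =
        C * |x| ^ (s + 1) * (1 - q ^ n) + (1 - q) * (C * (|x| ^ (s + 1) * q ^ n)) := by ring
      linarith
  have hlim : Tendsto (fun n : ℕ => ‖r (x * q ^ n)‖ + C * |x| ^ (s + 1)) atTop
      (𝓝 (0 + C * |x| ^ (s + 1))) := by
    refine Tendsto.add_const _ ?_
    have ht : Tendsto (fun n : ℕ => x * q ^ n) atTop (𝓝 0) := by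
      simpa using (tendsto_pow_atTop_nhds_zero_of_lt_one hq0.le hq1).const_mul x
    have h1 : Tendsto (fun n : ℕ => f (x * q ^ n)) atTop (𝓝 (f 0)) :=
      hf.tendsto.comp (tendsto_nhdsWithin_iff.2
        ⟨ht, .of_forall fun n => mul_pow_mem_qReals hq0.ne' hx n⟩)
    have h2 : Tendsto (fun n : ℕ => Q.eval ((x * q ^ n : ℝ) : ℂ)) atTop (𝓝 (f 0)) := by
      have : Continuous fun y : ℝ => Q.eval (y : ℂ) := by fun_prop
      have := (this.tendsto 0).comp ht
      simpa [hQ0, Function.comp_def] using this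
    have h3 := (h1.sub h2).norm
    rwa [sub_self, norm_zero] at h3
  rw [zero_add] at hlim
  refine ge_of_tendsto' hlim fun n => (hit n).trans (add_le_add le_rfl ?_)
  have : 0 ≤ q ^ n := by positivity
  exact mul_le_of_le_one_right (by positivity) (by linarith)

/-- Induction on the order for all k at once: order s for the (k+1)-st `q`-derivative integrates to
order s + 1 for the k-th. Order 0 is boundedness. -/
theorem IsQSchwartz.exists_taylor (hq0 : 0 < q) (hq1 : q < 1) (hf : IsQSchwartz q f) (s k : ℕ) :
    ∃ (P : ℂ[X]) (C : ℝ), ∀ x ∈ qReals q, x ≠ 0 → |x| ≤ 1 →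
      ‖(qDeriv q)^[k] f x - P.eval (x : ℂ)‖ ≤ C * |x| ^ s := by
  induction s generalizing k with
  | zero =>
    obtain ⟨C, hC⟩ := hf.decay k 0
    exact ⟨0, C, fun x hx _ _ => by simpa using hC x hx⟩
  | succ s ih =>
    obtain ⟨P, C, hP⟩ := ih (k + 1)
    simp_rw [Function.iterate_succ_apply'] at hP
    obtain ⟨Q, hQ⟩ :=
      exists_taylor_of_qDeriv hq0 hq1 (hf.differentiable k).continuousWithinAt hP
    exact ⟨Q, C, hQ⟩

end qTaylor

/-- The sequences of values on `q ^ ℤ` of rapidly decreasing even smooth functions. -/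
structure IsEvenTaylor (q : ℝ) (u : ℤ → ℂ) : Prop where
  decay : IsDecay u
  taylor : ∀ s : ℕ, ∃ R : ℂ[X],
    (fun n : ℤ => u n - R.eval (((q ^ n) ^ 2 : ℝ) : ℂ)) =O[atTop] fun n : ℤ => ((q ^ n) ^ 2) ^ s

section evenTaylor

variable {q w : ℝ} {u : ℤ → ℂ}

theorem IsQSchwartz.isDecay {f : ℝ → ℂ} (hq0 : 0 < q) (hq1 : q < 1) (hf : IsQSchwartz q f) :
    IsDecay fun n => f (q ^ n) := by
  refine isDecay_of_mul_pow_le hq0 hq1 fun s => ?_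
  obtain ⟨C, hC⟩ := hf.decay 0 s
  refine ⟨C, fun k => le_trans ?_ (hC _ (zpow_mem_qReals k))⟩
  have := zpow_pos hq0 k
  rw [mul_comm]
  simp only [Function.iterate_zero, id]
  gcongr
  nlinarith

theorem IsQSchwartz.isEvenTaylor {f : ℝ → ℂ} (hq0 : 0 < q) (hq1 : q < 1) (hf : IsQSchwartz q f) :
    IsEvenTaylor q fun n => f (q ^ n) := by
  refine ⟨hf.isDecay hq0 hq1, fun s => ?_⟩
  -- Order 2s in x is order s in x². Averaging the approximations at x and -x removes the odd part
  -- of P.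
  obtain ⟨P, C, hP⟩ := hf.exists_taylor hq0 hq1 (2 * s) 0
  obtain ⟨R, hR⟩ := exists_even_polynomial P
  refine ⟨R, IsBigO.of_bound C ?_⟩
  filter_upwards [eventually_ge_atTop 0] with n hn
  have hpos := zpow_pos hq0 n
  have hle : |q ^ n| ≤ 1 := by
    rw [abs_of_pos hpos]
    exact zpow_le_one₀ hq0 hq1.le hn
  have h1 := hP _ (zpow_mem_qReals n) hpos.ne' hle
  have h2 := hP _ (neg_mem_qReals (zpow_mem_qReals n)) (neg_ne_zero.2 hpos.ne')
    (by rwa [abs_neg])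
  simp only [Function.iterate_zero, id] at h1 h2
  rw [hf.even _ (zpow_mem_qReals n), abs_neg] at h2
  have e : f (q ^ n) - R.eval (((q ^ n) ^ 2 : ℝ) : ℂ) =
      ((f (q ^ n) - P.eval ((q ^ n : ℝ) : ℂ)) + (f (q ^ n) - P.eval ((-q ^ n : ℝ) : ℂ))) / 2 := by
    have := hR ((q ^ n : ℝ) : ℂ)
    rw [Complex.ofReal_pow, Complex.ofReal_neg]
    linear_combination (1 / 2 : ℂ) * this
  rw [e, norm_div, Complex.norm_ofNat, Real.norm_of_nonneg (by positivity), ← pow_mul]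
  have h3 := norm_add_le (f (q ^ n) - P.eval ((q ^ n : ℝ) : ℂ))
    (f (q ^ n) - P.eval ((-q ^ n : ℝ) : ℂ))
  rw [abs_of_pos hpos] at h1 h2
  linarith

theorem isBigO_ofReal_left (c : ℤ → ℝ) : (fun n => (c n : ℂ)) =O[atTop] c :=
  IsBigO.of_bound 1 (.of_forall fun n => by simp)

theorem isBigO_eval_sq_zpow (hq0 : 0 < q) (hq1 : q < 1) (R : ℂ[X]) :
    (fun n : ℤ => R.eval (((q ^ n) ^ 2 : ℝ) : ℂ)) =O[atTop] fun _ => (1 : ℝ) := by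
  obtain ⟨B, hB⟩ := (isCompact_Icc (a := (0 : ℝ)) (b := 1)).exists_bound_of_continuousOn
    (f := fun x : ℝ => R.eval (x : ℂ)) (by fun_prop)
  refine IsBigO.of_bound B ?_
  filter_upwards [eventually_ge_atTop 0] with n hn
  have hpos := zpow_pos hq0 n
  simpa using hB ((q ^ n) ^ 2)
    ⟨by positivity, pow_le_one₀ hpos.le (zpow_le_one₀ hq0 hq1.le hn)⟩

theorem isBigO_sq_zpow_add (hq0 : 0 < q) {v : ℤ → ℂ} {s : ℕ} (m : ℤ)
    (hv : v =O[atTop] fun n : ℤ => ((q ^ n) ^ 2) ^ s) :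
    (fun n => v (n + m)) =O[atTop] fun n : ℤ => ((q ^ n) ^ 2) ^ s := by
  have h1 := hv.comp_tendsto (tendsto_atTop_add_const_right atTop m tendsto_id)
  refine h1.trans (IsBigO.of_bound (((q ^ m) ^ 2) ^ s) (.of_forall fun n => ?_))
  have := zpow_pos hq0 n
  have := zpow_pos hq0 m
  simp only [Function.comp, id]
  rw [Real.norm_of_nonneg (by positivity), Real.norm_of_nonneg (by positivity), zpow_add₀ hq0.ne']
  exact le_of_eq (by ring)

/-- The factor q^(-2n) is bounded for n < N, where the decay of b carries over. For n ≥ N only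
boundedness is required. -/
theorem IsDecay.of_isBigO (hq0 : 0 < q) (hq1 : q < 1) {v b : ℤ → ℂ} (hb : IsDecay b)
    (hv : v =O[atTop] fun _ => (1 : ℝ)) (hvb : ∀ n, ‖v n‖ ≤ ((q ^ n) ^ 2)⁻¹ * ‖b n‖) :
    IsDecay v := by
  intro t ht
  obtain ⟨D, hD⟩ := hb t ht
  obtain ⟨C, hC⟩ := hv.bound
  obtain ⟨N, hN⟩ := eventually_atTop.1 (hC.and (eventually_ge_atTop 0))
  have hD0 := nonneg_of_forall_norm_le hD
  have ht0 := zero_lt_one.trans_le ht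
  have hC0 : 0 ≤ C := by simpa using (norm_nonneg _).trans (hN N le_rfl).1
  refine ⟨max C (((q ^ N) ^ 2)⁻¹ * D), fun n => ?_⟩
  have htn := zpow_pos ht0 n
  have hqn := zpow_pos hq0 n
  have hqN := zpow_pos hq0 N
  rcases le_or_gt N n with hn | hn
  · obtain ⟨h1, h2⟩ := hN n hn
    rw [norm_one, mul_one] at h1
    refine h1.trans ((le_max_left _ _).trans (le_mul_of_one_le_right ?_ (one_le_zpow₀ ht h2)))
    exact hC0.trans (le_max_left _ _)
  · calc ‖v n‖ ≤ ((q ^ n) ^ 2)⁻¹ * ‖b n‖ := hvb n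
      _ ≤ ((q ^ N) ^ 2)⁻¹ * (D * t ^ n) := by
        refine mul_le_mul (inv_anti₀ (by positivity) (pow_le_pow_left₀ hqN.le ?_ 2)) (hD n)
          (norm_nonneg _) (by positivity)
        exact (zpow_le_zpow_iff_right_of_lt_one₀ hq0 hq1).2 hn.le
      _ = ((q ^ N) ^ 2)⁻¹ * D * t ^ n := by ring
      _ ≤ _ := by gcongr; exact le_max_right _ _

/-- Constants are annihilated because 1 - (1 + c) + c = 0, so the division by x leaves a polynomial.
-/
theorem exists_besselLap_polynomial {p c : ℂ} (R : ℂ[X]) :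
    ∃ S : ℂ[X], ∀ x : ℂ, x ≠ 0 →
      x⁻¹ * (R.eval (x * p⁻¹) - (1 + c) * R.eval x + c * R.eval (x * p)) = S.eval x := by
  induction R using Polynomial.induction_on' with
  | add P₁ P₂ h₁ h₂ =>
    obtain ⟨R₁, hR₁⟩ := h₁
    obtain ⟨R₂, hR₂⟩ := h₂
    refine ⟨R₁ + R₂, fun x hx => ?_⟩
    rw [eval_add, eval_add, eval_add, eval_add, ← hR₁ x hx, ← hR₂ x hx]
    ring
  | monomial n a =>
    rcases n with _ | n
    · refine ⟨0, fun x hx => ?_⟩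
      simp only [eval_monomial, pow_zero, eval_zero]
      ring
    · refine ⟨monomial n (a * (p⁻¹ ^ (n + 1) - (1 + c) + c * p ^ (n + 1))), fun x hx => ?_⟩
      simp only [eval_monomial, mul_pow, pow_succ x]
      field_simp

namespace IsEvenTaylor

theorem exists_norm_sub_le (hq0 : 0 < q) (hq1 : q < 1) (hu : IsEvenTaylor q u) :
    ∃ C, ∀ n : ℤ, ‖u (n - 1) - u n‖ ≤ C * (q ^ n) ^ 2 := by
  obtain ⟨R, hR⟩ := hu.taylor 1
  have h1 : (fun n : ℤ => u n - R.coeff 0) =O[atTop] fun n : ℤ => ((q ^ n) ^ 2) ^ 1 := by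
    have h2 : (fun n : ℤ => R.eval (((q ^ n) ^ 2 : ℝ) : ℂ) - R.coeff 0) =O[atTop]
        fun n : ℤ => ((q ^ n) ^ 2) ^ 1 := by
      have h3 := (isBigO_eval_sq_zpow hq0 hq1 R.divX).mul
        (isBigO_ofReal_left (fun n : ℤ => (q ^ n) ^ 2))
      refine (h3.congr_left fun n => ?_).trans (IsBigO.of_bound 1 (.of_forall fun n => ?_))
      · have := congrArg (eval (((q ^ n) ^ 2 : ℝ) : ℂ)) (divX_mul_X_add R)
        rw [← this]
        simp only [eval_add, eval_mul, eval_X, eval_C]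
        ring
      · simp
    exact (hR.add h2).congr_left fun n => by ring
  have h2 := (isBigO_sq_zpow_add hq0 (-1) h1).sub h1
  obtain ⟨C, hC⟩ := h2.bound
  obtain ⟨N, hN⟩ := eventually_atTop.1 hC
  obtain ⟨D, hD⟩ := hu.decay 1 le_rfl
  simp only [one_zpow, mul_one] at hD
  have hD0 : 0 ≤ D := (norm_nonneg _).trans (hD 0)
  have hqN := zpow_pos hq0 N
  refine ⟨max C ((D + D) / (q ^ N) ^ 2), fun n => ?_⟩
  have hqn := zpow_pos hq0 n
  rcases le_or_gt N n with hn | hn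
  · have := hN n hn
    rw [sub_sub_sub_cancel_right, pow_one, Real.norm_of_nonneg (by positivity)] at this
    exact this.trans (by gcongr; exact le_max_left _ _)
  · calc ‖u (n - 1) - u n‖ ≤ D + D := (norm_sub_le _ _).trans (add_le_add (hD _) (hD _))
      _ = (D + D) / (q ^ N) ^ 2 * (q ^ N) ^ 2 := by field_simp
      _ ≤ max C ((D + D) / (q ^ N) ^ 2) * (q ^ n) ^ 2 := by
        refine mul_le_mul (le_max_right _ _) (pow_le_pow_left₀ hqN.le ?_ 2) (by positivity)
          (le_max_of_le_right (by positivity))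
        exact (zpow_le_zpow_iff_right_of_lt_one₀ hq0 hq1).2 hn.le

theorem besselLap (hq0 : 0 < q) (hq1 : q < 1) (hu : IsEvenTaylor q u) (w : ℝ) :
    IsEvenTaylor q (besselLap q w u) := by
  have htaylor : ∀ s : ℕ, ∃ R : ℂ[X], (fun n : ℤ =>
      _root_.besselLap q w u n - R.eval (((q ^ n) ^ 2 : ℝ) : ℂ)) =O[atTop]
        fun n : ℤ => ((q ^ n) ^ 2) ^ s := by
    intro s
    obtain ⟨R, hR⟩ := hu.taylor (s + 1)
    obtain ⟨S, hS⟩ := exists_besselLap_polynomial (p := ((q ^ 2 : ℝ) : ℂ)) (c := ((w / q ^ 2 : ℝ) : ℂ)) R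
    refine ⟨S, ?_⟩
    have h1 := isBigO_sq_zpow_add hq0 (-1) hR
    have h2 := isBigO_sq_zpow_add hq0 1 hR
    have h3 := (h1.sub (hR.const_mul_left ((1 + w / q ^ 2 : ℝ) : ℂ))).add
      (h2.const_mul_left ((w / q ^ 2 : ℝ) : ℂ))
    have h4 := (isBigO_ofReal_left fun n : ℤ => ((q ^ n) ^ 2)⁻¹).mul h3
    refine (h4.congr_left fun n => ?_).trans (IsBigO.of_bound 1 (.of_forall fun n => ?_))
    · have hqn := zpow_pos hq0 n
      have hx : (((q ^ n) ^ 2 : ℝ) : ℂ) ≠ 0 := by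
        rw [Complex.ofReal_ne_zero]; positivity
      rw [← hS _ hx, _root_.besselLap, ← Complex.ofReal_inv, ← Complex.ofReal_mul,
        ← Complex.ofReal_inv, ← Complex.ofReal_mul, zpow_add₀ hq0.ne', zpow_add₀ hq0.ne', zpow_one,
        zpow_neg_one, mul_pow, mul_pow, inv_pow]
      rw [Complex.ofReal_add, Complex.ofReal_one, ← sub_eq_add_neg]
      ring
    · have hqn := zpow_pos hq0 n
      rw [norm_mul, Real.norm_of_nonneg (by positivity : 0 ≤ ((q ^ n) ^ 2)⁻¹),
        Real.norm_of_nonneg (by positivity), Real.norm_of_nonneg (by positivity), pow_succ]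
      refine le_of_eq ?_
      field_simp
      ring
  refine ⟨?_, htaylor⟩
  obtain ⟨R, hR⟩ := htaylor 0
  have hO : _root_.besselLap q w u =O[atTop] fun _ => (1 : ℝ) := by
    simp only [pow_zero] at hR
    exact (hR.add (isBigO_eval_sq_zpow hq0 hq1 R)).congr_left fun n => by ring
  refine IsDecay.of_isBigO hq0 hq1
    (b := fun n => u (n - 1) - ((1 + w / q ^ 2 : ℝ) : ℂ) * u n + ((w / q ^ 2 : ℝ) : ℂ) * u (n + 1))
    ?_ hO fun n => ?_
  · intro t ht
    obtain ⟨C₁, h₁⟩ := hu.decay.shift (-1) t ht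
    obtain ⟨C₂, h₂⟩ := hu.decay t ht
    obtain ⟨C₃, h₃⟩ := hu.decay.shift 1 t ht
    refine ⟨C₁ + ‖((1 + w / q ^ 2 : ℝ) : ℂ)‖ * C₂ + ‖((w / q ^ 2 : ℝ) : ℂ)‖ * C₃, fun n => ?_⟩
    refine (norm_add_le _ _).trans ?_
    rw [add_mul, add_mul, mul_assoc, mul_assoc]
    refine add_le_add ((norm_sub_le _ _).trans (add_le_add (h₁ n) ?_)) ?_
    · rw [norm_mul]
      gcongr
      exact h₂ n
    · rw [norm_mul]
      gcongr
      exact h₃ n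
  · have hqn := zpow_pos hq0 n
    rw [_root_.besselLap, norm_mul, Complex.norm_real, Real.norm_of_nonneg (by positivity)]

/-- Green's identity moves the operator onto the Bessel function, which is an eigenvector. The
first-difference condition on u comes from its even Taylor expansion. -/
theorem hankel_besselLap (h : IsBesselParam q w) (hu : IsEvenTaylor q u) (k : ℤ) :
    hankel q w (_root_.besselLap q w u) k =
      ((-((q ^ k) ^ 2 / q ^ 2) : ℝ) : ℂ) * hankel q w u k := by
  obtain ⟨C, hC0, hC⟩ := exists_norm_latticeJ_le h
  have hs : ∀ v : ℤ → ℂ, IsDecay v →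
      Summable fun n => v n * latticeJ q w (n + k) * ((w ^ n : ℝ) : ℂ) := by
    intro v hv
    refine ((hv.summable h.w_pos h.w_lt_one).mul_left C).of_norm_bounded fun n => ?_
    have hw := zpow_pos h.w_pos n
    rw [norm_mul, norm_mul, Complex.norm_real, Real.norm_of_nonneg hw.le, mul_comm ‖v n‖, mul_assoc]
    gcongr
    exact hC _
  have hd : ∃ C, ∀ n : ℤ,
      ‖latticeJ q w (n - 1 + k) - latticeJ q w (n + k)‖ ≤ C * (q ^ n) ^ 2 := by
    obtain ⟨C, hC⟩ := exists_norm_latticeJ_sub_le h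
    refine ⟨C * (q ^ k) ^ 2, fun n => ?_⟩
    have := hC (n + k)
    rw [zpow_add₀ h.q_pos.ne', add_sub_right_comm] at this
    linarith
  have hg := (besselLap_green h hu.decay ((isDecay_latticeJ h).shift k)
    (hu.exists_norm_sub_le h.q_pos h.q_lt_one) hd).tsum_eq
  have e := (hs _ (hu.besselLap h.q_pos h.q_lt_one w).decay).tsum_sub
    ((hs u hu.decay).mul_left ((-((q ^ k) ^ 2 / q ^ 2) : ℝ) : ℂ))
  rw [tsum_mul_left] at e
  rw [hankel, hankel, ← sub_eq_zero, ← e, ← hg]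
  refine tsum_congr fun n => ?_
  rw [besselLap_latticeJ h]
  ring

theorem exists_norm_hankel_le (h : IsBesselParam q w) (hu : IsDecay u) :
    ∃ C, ∀ k, ‖hankel q w u k‖ ≤ C := by
  obtain ⟨C, hC0, hC⟩ := exists_norm_latticeJ_le h
  refine ⟨∑' n, C * (‖u n‖ * w ^ n), fun k => ?_⟩
  refine tsum_of_norm_bounded ((hu.summable h.w_pos h.w_lt_one).mul_left C).hasSum fun n => ?_
  have hw := zpow_pos h.w_pos n
  rw [norm_mul, norm_mul, Complex.norm_real, Real.norm_of_nonneg hw.le, mul_comm ‖u n‖, mul_assoc]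
  gcongr
  exact hC _

/-- Smoothness turns into decay: `besselLap` preserves the class, and each application multiplies
the transform by a constant times q^(2k), which is large as k → -∞. Boundedness after s applications
bounds the transform times q^(2ks). -/
theorem isDecay_hankel (h : IsBesselParam q w) (hu : IsEvenTaylor q u) :
    IsDecay (hankel q w u) := by
  refine isDecay_of_mul_pow_le h.sq_pos h.sq_lt_one fun s => ?_
  induction s generalizing u with
  | zero => simpa using exists_norm_hankel_le h hu.decay
  | succ s ih =>
    obtain ⟨C, hC⟩ := ih (hu.besselLap h.q_pos h.q_lt_one w)
    refine ⟨q ^ 2 * C, fun k => ?_⟩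
    have h1 := hC k
    have hk := zpow_pos h.sq_pos k
    have hq := h.q_pos
    rw [hu.hankel_besselLap h, norm_mul, Complex.norm_real, norm_neg, sq_zpow_eq,
      Real.norm_of_nonneg (by positivity)] at h1
    calc ‖hankel q w u k‖ * ((q ^ 2) ^ k) ^ (s + 1)
        = q ^ 2 * ((q ^ 2) ^ k / q ^ 2 * ‖hankel q w u k‖ * ((q ^ 2) ^ k) ^ s) := by
          field_simp
          ring
      _ ≤ q ^ 2 * C := by gcongr

end IsEvenTaylor

/-- Every function of `S_{*q,β}` is the `q`-Bessel transform of a rapid sequence. -/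
theorem exists_isBesselRep {f : ℝ → ℂ} (hq0 : 0 < q) (hq1 : q < 1) {β : ℝ} (hβ : -1 < β)
    (hf : f ∈ qSchwartzMoment q β) : ∃ F, IsBesselRep q (q ^ (2 * β + 2)) f F := by
  obtain ⟨hf, hmom⟩ := hf
  have h := isBesselParam_rpow hq0 hq1 hβ
  have hu := hf.isEvenTaylor hq0 hq1
  have hN : (besselNorm q (q ^ (2 * β + 2)) : ℂ) ≠ 0 :=
    Complex.ofReal_ne_zero.2 (besselNorm_pos h).ne'
  have hM : ∀ l : ℕ, ∑' n : ℤ, f (q ^ n) * (((q ^ (2 * β + 2) * (q ^ 2) ^ l) ^ n : ℝ) : ℂ) = 0 := by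
    intro l
    have := hmom l
    rw [qInt_moment hq0] at this
    refine (mul_eq_zero.1 this).resolve_left (Complex.ofReal_ne_zero.2 (sub_pos.2 hq1).ne')
  have hr : IsRapid (hankel q (q ^ (2 * β + 2)) fun n => f (q ^ n)) := by
    -- Decay at -∞ comes from smoothness. At +∞ the vanishing moments delete all terms of the
    -- asymptotic expansion, so only the remainder O(q^(2ks)) is left.
    refine (hu.isDecay_hankel h).isRapid h.sq_pos h.sq_lt_one fun s => ?_
    obtain ⟨C, hC⟩ := exists_besselSynth_sub_le h (hu.decay.summable_moment h) s
    refine ⟨C, fun k => ?_⟩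
    have := hC _ (zpow_mem_qReals k)
    simp_rw [hM, mul_zero, zero_mul, Finset.sum_const_zero, sub_zero] at this
    rwa [besselSynth_zpow h, sq_zpow_eq] at this
  refine ⟨fun k => (besselNorm q (q ^ (2 * β + 2)) : ℂ)⁻¹ * hankel q (q ^ (2 * β + 2))
    (fun n => f (q ^ n)) k, IsBesselRep.of_zpow h (hr.const_mul _) hf.even ?_ fun n => ?_⟩
  · exact (hf.differentiable 0).continuousWithinAt.tendsto.comp (tendsto_nhdsWithin_iff.2
      ⟨tendsto_zpow_natCast_atTop hq0 hq1, .of_forall fun n => zpow_mem_qReals _⟩)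
  · have := hankel_hankel h (hu.decay.summable h.w_pos h.w_lt_one) n
    rw [hankel]
    simp_rw [mul_assoc]
    rw [tsum_mul_left]
    simp_rw [← mul_assoc]
    rw [← hankel, this, inv_mul_cancel_left₀ hN]

end evenTaylor

end Expansion

/-! ### Generalized translation and convolution on the transform side. -/

section Convolution

open Filter Topology

section convolution

variable {q w : ℝ}

theorem summable_hankel (h : IsBesselParam q w) {a : ℤ → ℂ}
    (ha : Summable fun n => ‖a n‖ * w ^ n) (k : ℤ) :
    Summable fun n => a n * latticeJ q w (n + k) * ((w ^ n : ℝ) : ℂ) := by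
  obtain ⟨C, hC0, hC⟩ := exists_norm_latticeJ_le h
  refine (ha.mul_left C).of_norm_bounded fun n => ?_
  have hw := zpow_pos h.w_pos n
  rw [norm_mul, norm_mul, Complex.norm_real, Real.norm_of_nonneg hw.le, mul_comm ‖a n‖, mul_assoc]
  gcongr
  exact hC _

/-- The discrete `q`-Bessel transform is symmetric. -/
theorem tsum_hankel_mul (h : IsBesselParam q w) {a b : ℤ → ℂ}
    (ha : Summable fun n => ‖a n‖ * w ^ n) (hb : Summable fun n => ‖b n‖ * w ^ n) :
    ∑' n, hankel q w a n * b n * ((w ^ n : ℝ) : ℂ) =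
      ∑' k, a k * hankel q w b k * ((w ^ k : ℝ) : ℂ) := by
  obtain ⟨C, hC0, hC⟩ := exists_norm_latticeJ_le h
  have hw := h.w_pos
  set f : ℤ → ℤ → ℂ := fun n k => a k * latticeJ q w (k + n) * ((w ^ k : ℝ) : ℂ) *
    (b n * ((w ^ n : ℝ) : ℂ)) with hf
  have hfs : Summable (Function.uncurry f) := by
    refine ((hb.mul_left C).mul_of_nonneg ha
      (fun n => by positivity) (fun k => by positivity)).of_norm_bounded fun ⟨n, k⟩ => ?_
    simp only [Function.uncurry, hf]
    rw [norm_mul, norm_mul, norm_mul, norm_mul, Complex.norm_real, Complex.norm_real,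
      Real.norm_of_nonneg (zpow_pos hw n).le, Real.norm_of_nonneg (zpow_pos hw k).le]
    calc ‖a k‖ * ‖latticeJ q w (k + n)‖ * w ^ k * (‖b n‖ * w ^ n)
        ≤ ‖a k‖ * C * w ^ k * (‖b n‖ * w ^ n) := by gcongr; exact hC _
      _ = _ := by ring
  have h1 : ∀ n, ∑' k, f n k = hankel q w a n * b n * ((w ^ n : ℝ) : ℂ) := fun n => by
    rw [hankel, mul_assoc, ← tsum_mul_right]
  have h2 : ∀ k, ∑' n, f n k = a k * hankel q w b k * ((w ^ k : ℝ) : ℂ) := fun k => by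
    rw [hankel, ← tsum_mul_left, ← tsum_mul_right]
    refine tsum_congr fun n => ?_
    simp only [hf]
    rw [add_comm k n]
    ring
  rw [← tsum_congr h1, ← tsum_congr h2]
  exact hfs.tsum_comm.symm

/-- The powers q^(2kn) explode for k = -N, but J(q^(-N)) = O(q^(N(N+1))) completes the square: the
total exponent is d² - d with d = n - N. It dominates any linear function of d up to a constant,
which gives an arbitrarily small ratio t in n at the price of an exponential in k. -/
theorem exists_pow_mul_latticeJ_le (h : IsBesselParam q w) {t : ℝ} (ht : 0 < t) :
    ∃ C r : ℝ, 0 ≤ C ∧ 0 < r ∧ ∀ (n : ℕ) (k : ℤ),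
      q ^ (n * (n - 1)) * ((q ^ 2) ^ k) ^ n * ‖latticeJ q w k‖ ≤ C * t ^ n * (1 + r ^ k) := by
  have hq := h.q_pos
  have hq1 := h.q_lt_one
  obtain ⟨B, hB0, hB⟩ := exists_norm_latticeJ_le h
  obtain ⟨D, hD⟩ := exists_pow_mul_pow_le hq hq1 t⁻¹
  obtain ⟨E, hE⟩ := exists_besselJ_neg_le h
  obtain ⟨a, ha⟩ := exists_pow_lt_of_lt_one ht hq1
  have hD0 : 0 ≤ D := by
    have := hD 0
    simp only [zero_mul, pow_zero, mul_one] at this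
    linarith
  have hE0 : 0 ≤ E := by simpa using (abs_nonneg _).trans (hE 0)
  refine ⟨D * B + E * (q ^ ((a + 1) ^ 2))⁻¹, q ^ (2 * a + 1), by positivity, by positivity,
    fun n k => ?_⟩
  have hr := zpow_pos (pow_pos hq (2 * a + 1)) k
  rcases le_or_gt 0 k with hk | hk
  · have h1 : ((q ^ 2) ^ k) ^ n ≤ 1 :=
      pow_le_one₀ (zpow_pos h.sq_pos k).le (zpow_le_one₀ h.sq_pos h.sq_lt_one.le hk)
    have h2 := hD n
    rw [inv_pow, ← div_eq_mul_inv, div_le_iff₀ (by positivity)] at h2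
    have h3 := zpow_pos h.sq_pos k
    calc q ^ (n * (n - 1)) * ((q ^ 2) ^ k) ^ n * ‖latticeJ q w k‖
        ≤ D * t ^ n * 1 * B := by gcongr; exact hB k
      _ = D * B * t ^ n * 1 := by ring
      _ ≤ _ := by
        gcongr
        · exact le_add_of_nonneg_right (by positivity)
        · exact le_add_of_nonneg_right hr.le
  · obtain ⟨N, rfl⟩ : ∃ N : ℕ, k = -(N : ℤ) := ⟨k.natAbs, by omega⟩
    have h1 : ‖latticeJ q w (-(N : ℤ))‖ ≤ E * q ^ (N * (N + 1)) := by
      simpa [latticeJ] using hE N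
    have h2 : q ^ (n * (n - 1)) * ((q ^ 2) ^ (-(N : ℤ))) ^ n * q ^ (N * (N + 1)) ≤
        (q ^ ((a + 1) ^ 2))⁻¹ * (q ^ (2 * a + 1)) ^ n * (q ^ (2 * a + 1)) ^ (-(N : ℤ)) := by
      have e1 : q ^ (n * (n - 1)) = q ^ ((n : ℤ) * (n - 1)) := by
        rw [← zpow_natCast]
        congr 1
        cases n <;> simp
      have e2 : ((q ^ 2) ^ (-(N : ℤ))) ^ n = q ^ (-2 * (N : ℤ) * n) := by
        rw [← zpow_natCast, ← zpow_natCast, ← zpow_mul, ← zpow_mul]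
        congr 1
        push_cast
        ring
      have e3 : q ^ (N * (N + 1)) = q ^ ((N : ℤ) * (N + 1)) := by
        rw [← zpow_natCast]
        push_cast
        rfl
      have e4 : (q ^ ((a + 1) ^ 2))⁻¹ = q ^ (-((a : ℤ) + 1) ^ 2) := by
        rw [zpow_neg, ← zpow_natCast]
        push_cast
        rfl
      have e5 : (q ^ (2 * a + 1)) ^ n = q ^ ((2 * (a : ℤ) + 1) * n) := by
        rw [zpow_mul, zpow_natCast, ← zpow_natCast q]
        push_cast
        rfl
      have e6 : (q ^ (2 * a + 1)) ^ (-(N : ℤ)) = q ^ ((2 * (a : ℤ) + 1) * (-(N : ℤ))) := by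
        rw [zpow_mul, ← zpow_natCast q]
        push_cast
        rfl
      rw [e1, e2, e3, e4, e5, e6, ← zpow_add₀ hq.ne', ← zpow_add₀ hq.ne', ← zpow_add₀ hq.ne',
        ← zpow_add₀ hq.ne']
      refine zpow_le_zpow_right_of_le_one₀ hq hq1.le ?_
      -- This is d² - d ≥ (2a+1)d - (a+1)², that is (d - (a+1))² ≥ 0.
      nlinarith [sq_nonneg ((n : ℤ) - N - (a + 1))]
    have h3 : (q ^ (2 * a + 1)) ^ n ≤ t ^ n := by
      gcongr
      exact (pow_le_pow_of_le_one hq.le hq1.le (by omega)).trans ha.le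
    have h4 := zpow_pos h.sq_pos (-(N : ℤ))
    calc q ^ (n * (n - 1)) * ((q ^ 2) ^ (-(N : ℤ))) ^ n * ‖latticeJ q w (-(N : ℤ))‖
        ≤ q ^ (n * (n - 1)) * ((q ^ 2) ^ (-(N : ℤ))) ^ n * (E * q ^ (N * (N + 1))) := by
          gcongr
      _ = E * (q ^ (n * (n - 1)) * ((q ^ 2) ^ (-(N : ℤ))) ^ n * q ^ (N * (N + 1))) := by ring
      _ ≤ E * ((q ^ ((a + 1) ^ 2))⁻¹ * (q ^ (2 * a + 1)) ^ n *
          (q ^ (2 * a + 1)) ^ (-(N : ℤ))) := by gcongr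
      _ ≤ E * ((q ^ ((a + 1) ^ 2))⁻¹ * t ^ n * (q ^ (2 * a + 1)) ^ (-(N : ℤ))) := by gcongr
      _ = E * (q ^ ((a + 1) ^ 2))⁻¹ * t ^ n * (q ^ (2 * a + 1)) ^ (-(N : ℤ)) := by ring
      _ ≤ _ := by
        gcongr
        · exact le_add_of_nonneg_left (by positivity)
        · exact le_add_of_nonneg_left zero_le_one

/-- Absolute convergence that permits summing the translation series under the `q`-Bessel sum. The
exponential in k left by `exists_pow_mul_latticeJ_le` is absorbed by F. -/
theorem summable_translate (h : IsBesselParam q w) {F : ℤ → ℂ} (hF : IsRapid F) (x : ℝ) (m : ℤ) :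
    Summable fun jk : ℕ × ℤ => (((-1) ^ jk.1 * besselCoeff q w jk.1 *
      ((x * q ^ jk.2) ^ 2) ^ jk.1 : ℝ) : ℂ) *
        (F jk.2 * latticeJ q w (jk.2 + m) * ((w ^ jk.2 : ℝ) : ℂ)) := by
  have hw := h.w_pos
  set y := x ^ 2 * ((q ^ 2) ^ m)⁻¹ with hy
  have hqm := zpow_pos h.sq_pos m
  have hy0 : 0 ≤ y := by positivity
  obtain ⟨M, hM0, hM⟩ := exists_besselCoeff_le h
  -- With (x q^k)² = q^(2(k+m)) y the series in j has ratio t y, and this t keeps it below 1/2.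
  obtain ⟨C, r, hC0, hr, hC⟩ := exists_pow_mul_latticeJ_le h
    (t := (2 * (y + 1))⁻¹) (by positivity)
  have hgeo : Summable fun j : ℕ => ((2 * (y + 1))⁻¹ * y) ^ j := by
    refine summable_geometric_of_lt_one (by positivity) ?_
    rw [inv_mul_lt_iff₀ (by positivity)]
    linarith
  have hk : Summable fun k : ℤ => ‖F k‖ * w ^ k * (1 + r ^ (k + m)) := by
    refine ((hF.summable hw).add ((hF.summable (mul_pos hw hr)).mul_right (r ^ m))).congr
      fun k => ?_
    rw [mul_zpow, zpow_add₀ hr.ne']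
    ring
  refine ((hgeo.mul_left (M * C)).mul_of_nonneg hk (fun j => by positivity)
    (fun k => by positivity)).of_norm_bounded fun ⟨j, k⟩ => ?_
  have hwk := zpow_pos hw k
  have hc := besselCoeff_pos h j
  simp only
  rw [norm_mul, norm_mul, norm_mul, Complex.norm_real, Complex.norm_real,
    Real.norm_of_nonneg hwk.le, norm_mul, norm_mul, norm_pow, norm_neg, norm_one, one_pow, one_mul,
    Real.norm_of_nonneg hc.le, Real.norm_of_nonneg (by positivity)]
  have e : (x * q ^ k) ^ 2 = (q ^ 2) ^ (k + m) * y := by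
    rw [hy, mul_pow, sq_zpow_eq, zpow_add₀ h.sq_pos.ne']
    field_simp
  have hkm := zpow_pos h.sq_pos (k + m)
  rw [e, mul_pow ((q ^ 2) ^ (k + m)), mul_pow _ y]
  calc besselCoeff q w j * (((q ^ 2) ^ (k + m)) ^ j * y ^ j) *
        (‖F k‖ * ‖latticeJ q w (k + m)‖ * w ^ k)
      ≤ M * q ^ (j * (j - 1)) * (((q ^ 2) ^ (k + m)) ^ j * y ^ j) *
        (‖F k‖ * ‖latticeJ q w (k + m)‖ * w ^ k) := by gcongr; exact hM j
    _ = M * y ^ j * (‖F k‖ * w ^ k) *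
        (q ^ (j * (j - 1)) * ((q ^ 2) ^ (k + m)) ^ j * ‖latticeJ q w (k + m)‖) := by ring
    _ ≤ M * y ^ j * (‖F k‖ * w ^ k) * (C * (2 * (y + 1))⁻¹ ^ j * (1 + r ^ (k + m))) :=
        mul_le_mul_of_nonneg_left (hC j (k + m)) (by positivity)
    _ = _ := by ring

theorem qBesselOp_zpow (hq0 : 0 < q) (hq1 : q < 1) (β : ℝ) (f : ℝ → ℂ) (n : ℤ) :
    qBesselOp q β f (q ^ n) =
      ((q ^ 2 / (1 - q) ^ 2 : ℝ) : ℂ) *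
        besselLap q (q ^ (2 * β + 2)) (fun n => f (q ^ n)) n := by
  have hne := hq0.ne'
  have hn := zpow_pos hq0 n
  have e1 : q⁻¹ * q ^ n = q ^ (n - 1) := by rw [zpow_sub_one₀ hne, mul_comm]
  have e2 : q * q ^ (n - 1) = q ^ n := by rw [← e1, mul_inv_cancel_left₀ hne]
  have e3 : q * q ^ n = q ^ (n + 1) := by rw [zpow_add_one₀ hne, mul_comm]
  have ec : q ^ (2 * β + 2) = q ^ (2 * β + 1) * q := by
    rw [← Real.rpow_add_one hne]
    ring_nf
  rw [qBesselOp, besselLap, e1, qDeriv_of_ne (zpow_pos hq0 _).ne', e2,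
    qDeriv_of_ne (zpow_pos hq0 _).ne', e2, qDeriv_of_ne hn.ne', e3, ec]
  generalize q ^ (2 * β + 1) = c
  generalize f (q ^ (n - 1)) = f₁
  generalize f (q ^ n) = f₂
  generalize f (q ^ (n + 1)) = f₃
  rw [zpow_sub_one₀ hne]
  generalize q ^ n = X at hn
  have h1 : (1 - q : ℂ) ≠ 0 := by
    rw [sub_ne_zero]
    exact_mod_cast hq1.ne'
  have h2 : (q : ℂ) ≠ 0 := Complex.ofReal_ne_zero.2 hne
  have h3 : (X : ℂ) ≠ 0 := Complex.ofReal_ne_zero.2 hn.ne'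
  push_cast
  generalize hD : (1 - q : ℂ) = D at h1 ⊢
  field_simp
  ring

/-- The kernel J(q^(n+k)) is an eigenvector in n with an eigenvalue that depends on k alone, so the
operator acts as a multiplier on G. -/
theorem besselLap_hankel (h : IsBesselParam q w) {G : ℤ → ℂ} (hG : IsRapid G) (n : ℤ) :
    besselLap q w (hankel q w G) n =
      hankel q w (fun k => G k * ((-((q ^ k) ^ 2 / q ^ 2) : ℝ) : ℂ)) n := by
  have hs := fun m => summable_hankel h (hG.summable h.w_pos) m
  simp only [besselLap, hankel]
  rw [← tsum_mul_left, ← tsum_mul_left (f := fun k =>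
      G k * latticeJ q w (k + (n + 1)) * ((w ^ k : ℝ) : ℂ)),
    ← (hs _).tsum_sub ((hs _).mul_left _),
    ← ((hs _).sub ((hs _).mul_left _)).tsum_add ((hs _).mul_left _), ← tsum_mul_left]
  refine tsum_congr fun k => ?_
  have := besselLap_latticeJ h k n
  simp only [besselLap] at this
  rw [show n - 1 + k = k + (n - 1) by ring, show n + 1 + k = k + (n + 1) by ring, add_comm n k]
    at this
  linear_combination G k * ((w ^ k : ℝ) : ℂ) * this

theorem iterate_qBesselOp_zpow (hq0 : 0 < q) (hq1 : q < 1) {β : ℝ} (hβ : -1 < β) {f : ℝ → ℂ}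
    {F : ℤ → ℂ} (hF : IsRapid F) (hf : ∀ n : ℤ, f (q ^ n) = hankel q (q ^ (2 * β + 2)) F n)
    (j : ℕ) : IsRapid (fun k => F k * (((-((q ^ k) ^ 2 / (1 - q) ^ 2)) ^ j : ℝ) : ℂ)) ∧
      ∀ n : ℤ, (qBesselOp q β)^[j] f (q ^ n) = hankel q (q ^ (2 * β + 2))
        (fun k => F k * (((-((q ^ k) ^ 2 / (1 - q) ^ 2)) ^ j : ℝ) : ℂ)) n := by
  have h := isBesselParam_rpow hq0 hq1 hβ
  have h1q : 1 - q ≠ 0 := (sub_pos.2 hq1).ne'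
  induction j with
  | zero => simpa using ⟨hF, hf⟩
  | succ j ih =>
    obtain ⟨ih1, ih2⟩ := ih
    constructor
    · convert (ih1.mul_ofReal_zpow h.sq_pos).const_mul ((-((1 - q) ^ 2)⁻¹ : ℝ) : ℂ) using 2 with k
      rw [pow_succ, sq_zpow_eq]
      push_cast
      ring
    · intro n
      rw [Function.iterate_succ_apply', qBesselOp_zpow hq0 hq1]
      simp_rw [ih2]
      rw [besselLap_hankel h ih1, hankel, hankel, ← tsum_mul_left]
      refine tsum_congr fun k => ?_
      have hc : q ^ 2 / (1 - q) ^ 2 * -((q ^ k) ^ 2 / q ^ 2) = -((q ^ k) ^ 2 / (1 - q) ^ 2) := by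
        field_simp
      rw [pow_succ, ← hc]
      push_cast
      ring

theorem qBesselCoeff_eq (β : ℝ) (n : ℕ) :
    qBesselCoeff q β n = (1 - q) ^ (2 * n) * besselCoeff q (q ^ (2 * β + 2)) n := by
  rw [qBesselCoeff, besselCoeff, mul_div_assoc]

theorem qTranslateTerm_eq (hq0 : 0 < q) (hq1 : q < 1) {β : ℝ} (hβ : -1 < β) {f : ℝ → ℂ}
    {F : ℤ → ℂ} (hf : IsBesselRep q (q ^ (2 * β + 2)) f F) (x : ℝ) (m : ℤ) (j : ℕ) :
    qTranslateTerm q β x f (q ^ m) j =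
      ∑' k : ℤ, (((-1) ^ j * besselCoeff q (q ^ (2 * β + 2)) j * ((x * q ^ k) ^ 2) ^ j : ℝ) : ℂ) *
        (F k * latticeJ q (q ^ (2 * β + 2)) (k + m) * (((q ^ (2 * β + 2)) ^ k : ℝ) : ℂ)) := by
  have h := isBesselParam_rpow hq0 hq1 hβ
  have h1q : (1 - q) ^ 2 ≠ 0 := pow_ne_zero _ (sub_pos.2 hq1).ne'
  rw [qTranslateTerm, (iterate_qBesselOp_zpow hq0 hq1 hβ hf.rapid (hf.zpow_eq h) j).2 m, hankel,
    ← tsum_mul_left]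
  refine tsum_congr fun k => ?_
  have e : qBesselCoeff q β j * x ^ (2 * j) * (-((q ^ k) ^ 2 / (1 - q) ^ 2)) ^ j =
      (-1) ^ j * besselCoeff q (q ^ (2 * β + 2)) j * ((x * q ^ k) ^ 2) ^ j := by
    rw [qBesselCoeff_eq, neg_pow, div_pow, pow_mul, pow_mul, mul_pow x, mul_pow (x ^ 2)]
    have := pow_ne_zero j h1q
    field_simp
  rw [← e]
  push_cast
  ring

/-- The j-th iterate of the operator multiplies F(k) by a j-th power. Summing over j first, the
translation coefficients assemble to the power series of J(x q^k). -/
theorem hasSum_qTranslateTerm (hq0 : 0 < q) (hq1 : q < 1) {β : ℝ} (hβ : -1 < β) {f : ℝ → ℂ}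
    {F : ℤ → ℂ} (hf : IsBesselRep q (q ^ (2 * β + 2)) f F) (x : ℝ) (m : ℤ) :
    HasSum (qTranslateTerm q β x f (q ^ m)) (hankel q (q ^ (2 * β + 2))
      (fun k => F k * (besselJ q (q ^ (2 * β + 2)) (x * q ^ k) : ℝ)) m) := by
  have h := isBesselParam_rpow hq0 hq1 hβ
  have hs := summable_translate h hf.rapid x m
  have h1 : Summable (qTranslateTerm q β x f (q ^ m)) :=
    hs.prod.congr fun j => (qTranslateTerm_eq hq0 hq1 hβ hf x m j).symm
  have h2 : ∑' j, qTranslateTerm q β x f (q ^ m) j = hankel q (q ^ (2 * β + 2))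
      (fun k => F k * (besselJ q (q ^ (2 * β + 2)) (x * q ^ k) : ℝ)) m := by
    rw [tsum_congr (qTranslateTerm_eq hq0 hq1 hβ hf x m)]
    have := hs.tsum_comm
      (f := fun j k => (((-1) ^ j * besselCoeff q (q ^ (2 * β + 2)) j *
        ((x * q ^ k) ^ 2) ^ j : ℝ) : ℂ) *
        (F k * latticeJ q (q ^ (2 * β + 2)) (k + m) * (((q ^ (2 * β + 2)) ^ k : ℝ) : ℂ)))
    rw [← this, hankel]
    refine tsum_congr fun k => ?_
    rw [tsum_mul_right, ← Complex.ofReal_tsum, ← besselJ]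
    ring
  rw [← h2]
  exact h1.hasSum

theorem IsRapid.mul_besselJ (h : IsBesselParam q w) {F : ℤ → ℂ} (hF : IsRapid F) {x : ℝ}
    (hx : x ∈ qReals q) : IsRapid fun k => F k * (besselJ q w (x * q ^ k) : ℝ) := by
  intro t ht
  obtain ⟨C, hC⟩ := hF t ht
  obtain ⟨B, hB0, hB⟩ := exists_besselJ_le h
  refine ⟨B * C, fun k => ?_⟩
  rw [norm_mul, Complex.norm_real, Real.norm_eq_abs, mul_comm, mul_assoc]
  gcongr
  · exact hB _ (mul_zpow_mem_qReals h.q_pos.ne' hx k)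
  · exact hC k

theorem qConvIntegrand_zpow_mul (hq0 : 0 < q) (hq1 : q < 1) {β : ℝ} (hβ : -1 < β) {f : ℝ → ℂ}
    {F : ℤ → ℂ} (hf : IsBesselRep q (q ^ (2 * β + 2)) f F) (g : ℝ → ℂ) (x : ℝ) (n : ℤ) :
    qConvIntegrand q β f g x (q ^ n) * ((q ^ n : ℝ) : ℂ) =
      hankel q (q ^ (2 * β + 2)) (fun k => F k * (besselJ q (q ^ (2 * β + 2)) (x * q ^ k) : ℝ)) n *
        g (q ^ n) * (((q ^ (2 * β + 2)) ^ n : ℝ) : ℂ) := by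
  have := zpow_rpow_mul_zpow hq0 β 0 n
  simp only [Nat.cast_zero, mul_zero, zero_add, pow_zero, mul_one] at this
  rw [qConvIntegrand, qTranslate, (hasSum_qTranslateTerm hq0 hq1 hβ hf x n).tsum_eq, ← this]
  push_cast
  ring

theorem IsBesselRep.qConvDefined (hq0 : 0 < q) (hq1 : q < 1) {β : ℝ} (hβ : -1 < β) {f g : ℝ → ℂ}
    {F G : ℤ → ℂ} (hf : IsBesselRep q (q ^ (2 * β + 2)) f F)
    (hg : IsBesselRep q (q ^ (2 * β + 2)) g G) : QConvDefined q β f g := by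
  have h := isBesselParam_rpow hq0 hq1 hβ
  refine fun x hx => ⟨fun m => (hasSum_qTranslateTerm hq0 hq1 hβ hf x m).summable, ?_⟩
  rw [QIntegrable]
  simp_rw [qConvIntegrand_zpow_mul hq0 hq1 hβ hf]
  obtain ⟨C, hC⟩ := IsEvenTaylor.exists_norm_hankel_le h (hf.rapid.mul_besselJ h hx).isDecay
  refine (((hg.isDecay h).summable h.w_pos h.w_lt_one).mul_left C).of_norm_bounded fun n => ?_
  rw [norm_mul, norm_mul, Complex.norm_real, Real.norm_of_nonneg (zpow_pos h.w_pos n).le, mul_assoc]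
  have := zpow_pos h.w_pos n
  gcongr
  exact hC n

/-- The translate of f is the transform of F(k) J(x q^k). By symmetry of the transform it can be
moved onto g, whose transform is `besselNorm` times G. -/
theorem IsBesselRep.qConv (hq0 : 0 < q) (hq1 : q < 1) {β : ℝ} (hβ : -1 < β) {f g : ℝ → ℂ}
    {F G : ℤ → ℂ} (hf : IsBesselRep q (q ^ (2 * β + 2)) f F)
    (hg : IsBesselRep q (q ^ (2 * β + 2)) g G) :
    IsBesselRep q (q ^ (2 * β + 2)) (qConv q β f g) fun k =>
      (((1 - q) * qBesselConst q β * besselNorm q (q ^ (2 * β + 2)) : ℝ) : ℂ) * (F k * G k) := by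
  have h := isBesselParam_rpow hq0 hq1 hβ
  refine ⟨(hf.rapid.mul hg.rapid).const_mul _, fun x hx => ?_⟩
  rw [_root_.qConv, qInt]
  simp_rw [qConvIntegrand_zpow_mul hq0 hq1 hβ hf]
  rw [tsum_hankel_mul h ((hf.rapid.mul_besselJ h hx).summable h.w_pos)
    ((hg.isDecay h).summable h.w_pos h.w_lt_one), ← tsum_mul_left, ← tsum_mul_left, besselSynth]
  refine tsum_congr fun k => ?_
  rw [hg.hankel_eq h]
  push_cast
  ring

end convolution

end Convolution

/-! ### The kernel of the two integral transforms and Sonine's formula. -/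

section Kernel

open Filter Topology

section kernel

variable {q α : ℝ}

/-- The `q`-beta constant `∑ K(q ^ i) q ^ i` of the kernel of order `α`. -/
noncomputable def kernelConst (q α : ℝ) : ℝ :=
  qPochInf (q ^ 2) (q ^ 2) / qPochInf (q ^ (2 * α + 1)) (q ^ 2) *
    (qPochInf (q ^ (2 * α + 2)) (q ^ 2) / qPochInf q (q ^ 2))

theorem sq_lt_one_of_lt_one (hq0 : 0 < q) (hq1 : q < 1) : q ^ 2 < 1 :=
  pow_lt_one₀ hq0.le hq1 two_ne_zero

theorem qKernel_neg (s : ℝ) : qKernel q α (-s) = qKernel q α s := by simp [qKernel]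

theorem qKernel_zero : qKernel q α 0 = 1 := by simp [qKernel, qPochInf_zero]

/-- The numerator contains a zero factor. Hence the Weyl integral may run over the whole positive
lattice. -/
theorem qKernel_inv_pow (hq0 : 0 < q) (n : ℕ) : qKernel q α ((q ^ (n + 1))⁻¹) = 0 := by
  rw [qKernel, qPochInf_eq_zero (k := n), zero_div]
  have : (q ^ (n + 1)) ≠ 0 := by positivity
  rw [inv_pow, mul_assoc, ← pow_succ', pow_right_comm q (n + 1) 2,
    inv_mul_cancel₀ (by positivity)]

theorem qKernel_pow (hq0 : 0 < q) (hq1 : q < 1) (hα : -1 / 2 < α) (i : ℕ) :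
    qKernel q α (q ^ i) =
      qPochInf (q ^ 2) (q ^ 2) / qPochInf (q ^ (2 * α + 1)) (q ^ 2) *
        (qPoch (q ^ (2 * α + 1)) (q ^ 2) i / qPoch (q ^ 2) (q ^ 2) i) := by
  have hp0 : 0 < q ^ 2 := by positivity
  have hp1 := sq_lt_one_of_lt_one hq0 hq1
  have ha0 : 0 < q ^ (2 * α + 1) := Real.rpow_pos_of_pos hq0 _
  have ha1 : q ^ (2 * α + 1) < 1 := Real.rpow_lt_one hq0.le hq1 (by linarith)
  rw [qKernel, pow_right_comm q i 2, mul_comm _ (q ^ 2), mul_comm _ (q ^ (2 * α + 1)),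
    qPochInf_eq_mul hp0 hp1 (q ^ 2) i, qPochInf_eq_mul hp0 hp1 (q ^ (2 * α + 1)) i]
  have h1 := (qPoch_pos hp0 hp1 hp0.le hp1 i).ne'
  have h2 := (qPoch_pos hp0 hp1 ha0.le ha1 i).ne'
  have h3 := (qPochInf_pos hp0 hp1 (by positivity) (mul_pow_lt_one hp0 hp1 ha0.le ha1 i)).ne'
  field_simp

theorem exists_qKernel_le (hq0 : 0 < q) (hq1 : q < 1) (hα : -1 / 2 < α) :
    ∃ C, 0 ≤ C ∧ ∀ s ∈ qReals q, |qKernel q α s| ≤ C := by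
  have hp0 : 0 < q ^ 2 := by positivity
  have hp1 := sq_lt_one_of_lt_one hq0 hq1
  have ha0 : 0 < q ^ (2 * α + 1) := Real.rpow_pos_of_pos hq0 _
  have ha1 : q ^ (2 * α + 1) < 1 := Real.rpow_lt_one hq0.le hq1 (by linarith)
  have hA := qPochInf_pos hp0 hp1 ha0.le ha1
  have hA1 := qPochInf_le_one hp0 hp1 ha0.le ha1
  have hz : ∀ n : ℤ, |qKernel q α (q ^ n)| ≤ (qPochInf (q ^ (2 * α + 1)) (q ^ 2))⁻¹ := by
    intro n
    rcases le_or_gt 0 n with hn | hn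
    · obtain ⟨i, rfl⟩ := Int.eq_ofNat_of_zero_le hn
      rw [zpow_natCast, qKernel, pow_right_comm q i 2, mul_comm _ (q ^ 2),
        mul_comm _ (q ^ (2 * α + 1))]
      have h1 := mul_pow_lt_one hp0 hp1 hp0.le hp1 i
      have h2 := mul_pow_lt_one hp0 hp1 ha0.le ha1 i
      have h3 := qPochInf_pos hp0 hp1 (by positivity) h1
      have h4 := qPochInf_pos hp0 hp1 (by positivity) h2
      rw [abs_of_pos (div_pos h3 h4), ← one_div]
      refine div_le_div₀ zero_le_one (qPochInf_le_one hp0 hp1 (by positivity) h1) hA ?_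
      rw [qPochInf_eq_mul hp0 hp1 (q ^ (2 * α + 1)) i]
      exact mul_le_of_le_one_left h4.le (qPoch_le_one hp0 hp1 ha0.le ha1 i)
    · obtain ⟨i, rfl⟩ : ∃ i : ℕ, n = -((i + 1 : ℕ) : ℤ) := ⟨n.natAbs - 1, by omega⟩
      rw [zpow_neg, zpow_natCast, qKernel_inv_pow hq0, abs_zero]
      positivity
  refine ⟨(qPochInf (q ^ (2 * α + 1)) (q ^ 2))⁻¹, by positivity, fun s hs => ?_⟩
  rcases hs with rfl | ⟨n, rfl | rfl⟩
  · rw [qKernel_zero, abs_one]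
    exact (one_le_inv₀ hA).2 hA1
  · exact hz n
  · rw [qKernel_neg]
    exact hz n

theorem tendsto_qKernel_pow (hq0 : 0 < q) (hq1 : q < 1) (hα : -1 / 2 < α) :
    Tendsto (fun i : ℕ => qKernel q α (q ^ i)) atTop (𝓝 1) := by
  have hp0 : 0 < q ^ 2 := by positivity
  have hp1 := sq_lt_one_of_lt_one hq0 hq1
  have ha0 : 0 < q ^ (2 * α + 1) := Real.rpow_pos_of_pos hq0 _
  have ha1 : q ^ (2 * α + 1) < 1 := Real.rpow_lt_one hq0.le hq1 (by linarith)
  have := (tendsto_qPochInf_mul_pow hp0 hp1 hp0.le hp1).div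
    (tendsto_qPochInf_mul_pow hp0 hp1 ha0.le ha1) one_ne_zero
  rw [div_one] at this
  refine this.congr fun i => ?_
  simp only [Pi.div_apply]
  rw [qKernel, pow_right_comm q i 2, mul_comm _ (q ^ 2), mul_comm _ (q ^ (2 * α + 1))]

/-- The `q`-binomial theorem in base q² with a = q^(2α+1) and z = q^(2l+1), since K(q^i) is
proportional to (a;q²)_i / (q²;q²)_i. -/
theorem hasSum_qKernel (hq0 : 0 < q) (hq1 : q < 1) (hα : -1 / 2 < α) (l : ℕ) :
    HasSum (fun i : ℕ => qKernel q α (q ^ i) * q ^ i * ((q ^ i) ^ 2) ^ l)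
      (kernelConst q α * (qPoch q (q ^ 2) l / qPoch (q ^ (2 * α + 2)) (q ^ 2) l)) := by
  have hp0 : 0 < q ^ 2 := by positivity
  have hp1 := sq_lt_one_of_lt_one hq0 hq1
  have ha0 : 0 < q ^ (2 * α + 1) := Real.rpow_pos_of_pos hq0 _
  have ha1 : q ^ (2 * α + 1) < 1 := Real.rpow_lt_one hq0.le hq1 (by linarith)
  have hw0 : 0 < q ^ (2 * α + 2) := Real.rpow_pos_of_pos hq0 _
  have hw1 : q ^ (2 * α + 2) < 1 := Real.rpow_lt_one hq0.le hq1 (by linarith)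
  have hlt := mul_pow_lt_one hp0 hp1 hq0.le hq1 l
  have h := (qBinomial hp0 hp1 ha0.le ha1 (z := q * (q ^ 2) ^ l) (by positivity) hlt).mul_left
    (qPochInf (q ^ 2) (q ^ 2) / qPochInf (q ^ (2 * α + 1)) (q ^ 2))
  have haq : q ^ (2 * α + 1) * q = q ^ (2 * α + 2) := by
    rw [← Real.rpow_add_one hq0.ne']
    ring_nf
  have e : kernelConst q α * (qPoch q (q ^ 2) l / qPoch (q ^ (2 * α + 2)) (q ^ 2) l) =
      qPochInf (q ^ 2) (q ^ 2) / qPochInf (q ^ (2 * α + 1)) (q ^ 2) *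
        (qPochInf (q ^ (2 * α + 1) * (q * (q ^ 2) ^ l)) (q ^ 2) /
          qPochInf (q * (q ^ 2) ^ l) (q ^ 2)) := by
    rw [kernelConst, ← mul_assoc (q ^ (2 * α + 1)), haq, qPochInf_eq_mul hp0 hp1 q l,
      qPochInf_eq_mul hp0 hp1 (q ^ (2 * α + 2)) l]
    have h1 := (qPoch_pos hp0 hp1 hq0.le hq1 l).ne'
    have h2 := (qPoch_pos hp0 hp1 hw0.le hw1 l).ne'
    have h3 := (qPochInf_pos hp0 hp1 (by positivity) hlt).ne'
    have h4 := (qPochInf_pos hp0 hp1 ha0.le ha1).ne'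
    generalize q ^ (2 * α + 2) = W at h2 ⊢
    field_simp
  rw [e]
  refine h.congr_fun fun i => ?_
  rw [qKernel_pow hq0 hq1 hα, mul_pow q, ← pow_mul (q ^ 2), ← pow_mul q i 2, ← pow_mul q (i * 2),
    ← pow_mul q 2]
  ring_nf

theorem isBesselParam_self (hq0 : 0 < q) (hq1 : q < 1) : IsBesselParam q q :=
  ⟨hq0, hq1, hq0, hq1⟩

theorem summable_qKernel_pow_mul (hq0 : 0 < q) (hq1 : q < 1) (hα : -1 / 2 < α) :
    Summable fun i : ℕ => |qKernel q α (q ^ i)| * q ^ i := by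
  obtain ⟨C, hC0, hC⟩ := exists_qKernel_le hq0 hq1 hα
  refine .of_nonneg_of_le (fun i => by positivity) (fun i => ?_)
    ((summable_geometric_of_lt_one hq0.le hq1).mul_left C)
  gcongr
  simpa using hC _ (zpow_mem_qReals (i : ℤ))

/-- The `q`-analogue of Sonine's first integral that relates the orders `-1/2` and `α`. -/
theorem tsum_qKernel_mul_besselJ (hq0 : 0 < q) (hq1 : q < 1) (hα : -1 / 2 < α) (y : ℝ) :
    ∑' i : ℕ, qKernel q α (q ^ i) * q ^ i * besselJ q q (y * q ^ i) =
      kernelConst q α * besselJ q (q ^ (2 * α + 2)) y := by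
  have h := isBesselParam_self hq0 hq1
  have hw := isBesselParam_rpow hq0 hq1 (β := α) (by linarith)
  set f : ℕ → ℕ → ℝ := fun i l => qKernel q α (q ^ i) * q ^ i *
    ((-1) ^ l * besselCoeff q q l * ((y * q ^ i) ^ 2) ^ l) with hf
  have hfs : Summable (Function.uncurry f) := by
    refine ((summable_qKernel_pow_mul hq0 hq1 hα).mul_of_nonneg (summable_besselCoeff h (y ^ 2))
      (fun i => by positivity) (fun l => mul_nonneg (besselCoeff_pos h l).le
        (by positivity))).of_norm_bounded fun ⟨i, l⟩ => ?_
    have hc := (besselCoeff_pos h l).le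
    simp only [Function.uncurry, hf]
    rw [norm_mul, norm_mul, norm_mul, norm_mul, norm_pow (-1 : ℝ), norm_neg, norm_one, one_pow,
      one_mul, Real.norm_of_nonneg hc, Real.norm_of_nonneg (by positivity : 0 ≤ q ^ i),
      Real.norm_of_nonneg (by positivity : 0 ≤ ((y * q ^ i) ^ 2) ^ l), Real.norm_eq_abs, mul_pow y]
    gcongr
    refine mul_le_of_le_one_right (sq_nonneg y) ?_
    exact pow_le_one₀ (by positivity) (pow_le_one₀ hq0.le hq1.le)
  have h1 : ∀ i, ∑' l, f i l = qKernel q α (q ^ i) * q ^ i * besselJ q q (y * q ^ i) := fun i => by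
    rw [besselJ, ← tsum_mul_left]
  -- The l-th kernel moment replaces (q;q²)_l by (q^(2α+2);q²)_l in the denominator of the
  -- coefficient, which changes the order from -1/2 to α.
  have h2 : ∀ l, ∑' i, f i l = kernelConst q α *
      ((-1) ^ l * besselCoeff q (q ^ (2 * α + 2)) l * (y ^ 2) ^ l) := fun l => by
    have e : ∀ i, f i l = (-1) ^ l * besselCoeff q q l * (y ^ 2) ^ l *
        (qKernel q α (q ^ i) * q ^ i * ((q ^ i) ^ 2) ^ l) := fun i => by
      simp only [hf]
      rw [mul_pow y, mul_pow (y ^ 2)]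
      ring
    rw [tsum_congr e, tsum_mul_left, (hasSum_qKernel hq0 hq1 hα l).tsum_eq, besselCoeff, besselCoeff]
    have h1 := (qPoch_pos h.sq_pos h.sq_lt_one hq0.le hq1 l).ne'
    have h2 := (qPoch_pos h.sq_pos h.sq_lt_one hw.w_pos.le hw.w_lt_one l).ne'
    field_simp
  rw [← tsum_congr h1, besselJ, ← tsum_mul_left, ← tsum_congr h2]
  exact hfs.tsum_comm.symm

theorem kernelConst_pos (hq0 : 0 < q) (hq1 : q < 1) (hα : -1 / 2 < α) : 0 < kernelConst q α := by
  have hp0 : 0 < q ^ 2 := by positivity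
  have hp1 := sq_lt_one_of_lt_one hq0 hq1
  have ha0 : 0 < q ^ (2 * α + 1) := Real.rpow_pos_of_pos hq0 _
  have ha1 : q ^ (2 * α + 1) < 1 := Real.rpow_lt_one hq0.le hq1 (by linarith)
  have hw0 : 0 < q ^ (2 * α + 2) := Real.rpow_pos_of_pos hq0 _
  have hw1 : q ^ (2 * α + 2) < 1 := Real.rpow_lt_one hq0.le hq1 (by linarith)
  exact mul_pos (div_pos (qPochInf_pos hp0 hp1 hp0.le hp1) (qPochInf_pos hp0 hp1 ha0.le ha1))
    (div_pos (qPochInf_pos hp0 hp1 hw0.le hw1) (qPochInf_pos hp0 hp1 hq0.le hq1))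

theorem qGamma_pos (hq0 : 0 < q) (hq1 : q < 1) {x : ℝ} (hx : 0 < x) : 0 < qGamma (q ^ 2) x := by
  have hp0 : 0 < q ^ 2 := by positivity
  have hp1 := sq_lt_one_of_lt_one hq0 hq1
  exact mul_pos (div_pos (qPochInf_pos hp0 hp1 hp0.le hp1)
    (qPochInf_pos hp0 hp1 (Real.rpow_pos_of_pos hp0 _).le (Real.rpow_lt_one hp0.le hp1 hx)))
    (Real.rpow_pos_of_pos (sub_pos.2 hp1) _)

/-- The constant in front of R_{α,q} is the reciprocal of (1 - q) `kernelConst`; the powers of 1 -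
q² differ by one factor (1 + q)(1 - q). -/
theorem kernelConst_eq (hq0 : 0 < q) (hq1 : q < 1) (hα : -1 / 2 < α) :
    (1 + q) * qGamma (q ^ 2) (α + 1) * ((1 - q) * kernelConst q α) =
      qGamma (q ^ 2) (1 / 2) * qGamma (q ^ 2) (α + 1 / 2) := by
  have hp0 : 0 < q ^ 2 := by positivity
  have hp1 := sq_lt_one_of_lt_one hq0 hq1
  have ha0 : 0 < q ^ (2 * α + 1) := Real.rpow_pos_of_pos hq0 _
  have ha1 : q ^ (2 * α + 1) < 1 := Real.rpow_lt_one hq0.le hq1 (by linarith)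
  have hw0 : 0 < q ^ (2 * α + 2) := Real.rpow_pos_of_pos hq0 _
  have hw1 : q ^ (2 * α + 2) < 1 := Real.rpow_lt_one hq0.le hq1 (by linarith)
  have hpow : ∀ x : ℝ, (q ^ 2) ^ x = q ^ (2 * x) := fun x => by
    rw [← Real.rpow_natCast, ← Real.rpow_mul hq0.le]
    norm_num
  have h1 : (1 - q ^ 2) ^ (1 - 1 / 2 : ℝ) * (1 - q ^ 2) ^ (1 - (α + 1 / 2)) =
      (1 - q ^ 2) ^ (1 - (α + 1)) * ((1 + q) * (1 - q)) := by
    rw [← Real.rpow_add (sub_pos.2 hp1), show (1 + q) * (1 - q) = 1 - q ^ 2 by ring,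
      ← Real.rpow_add_one (sub_pos.2 hp1).ne']
    congr 1
    ring
  rw [qGamma, qGamma, qGamma, hpow, hpow, hpow, kernelConst,
    show 2 * (α + 1) = 2 * α + 2 by ring, show 2 * (α + 1 / 2) = 2 * α + 1 by ring,
    show 2 * (1 / 2 : ℝ) = 1 by norm_num, Real.rpow_one]
  have e1 := (qPochInf_pos hp0 hp1 hp0.le hp1).ne'
  have e2 := (qPochInf_pos hp0 hp1 ha0.le ha1).ne'
  have e3 := (qPochInf_pos hp0 hp1 hw0.le hw1).ne'
  have e4 := (qPochInf_pos hp0 hp1 hq0.le hq1).ne'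
  generalize qPochInf (q ^ 2) (q ^ 2) = P at *
  generalize qPochInf (q ^ (2 * α + 1)) (q ^ 2) = A at *
  generalize qPochInf (q ^ (2 * α + 2)) (q ^ 2) = W at *
  generalize qPochInf q (q ^ 2) = Q at *
  calc _ = P / A * (P / Q) * ((1 - q ^ 2) ^ (1 - (α + 1)) * ((1 + q) * (1 - q))) := by
        field_simp
    _ = _ := by rw [← h1]; field_simp

end kernel

end Kernel

/-! ### Riemann–Liouville and Weyl transforms on the transform side. -/

section Transforms

open Filter Topology

section transforms

variable {q α : ℝ}

theorem rpow_neg_half (q : ℝ) : q ^ (2 * (-1 / 2 : ℝ) + 2) = q := by norm_num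

theorem rpow_two_mul_add_two (hq0 : 0 < q) (α : ℝ) :
    q ^ (2 * α + 2) = q ^ (2 * α + 1) * q := by
  rw [← Real.rpow_add_one hq0.ne']
  ring_nf

/-! ### The `q`-Riemann–Liouville transform -/

theorem summable_qRL (hq0 : 0 < q) (hq1 : q < 1) (hα : -1 / 2 < α) {F : ℤ → ℂ} (hF : IsRapid F)
    {x : ℝ} (hx : x ∈ qReals q) :
    Summable fun ik : ℕ × ℤ => ((qKernel q α (q ^ ik.1) * q ^ ik.1 *
      besselJ q q (x * q ^ ik.2 * q ^ ik.1) : ℝ) : ℂ) * (F ik.2 * ((q ^ ik.2 : ℝ) : ℂ)) := by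
  have h := isBesselParam_self hq0 hq1
  obtain ⟨B, hB0, hB⟩ := exists_besselJ_le h
  refine (((summable_qKernel_pow_mul hq0 hq1 hα).mul_right B).mul_of_nonneg (hF.summable hq0)
      (fun i => by positivity) (fun k => by positivity)).of_norm_bounded fun ⟨i, k⟩ => ?_
  simp only
  rw [norm_mul, norm_mul, Complex.norm_real, Complex.norm_real,
    Real.norm_of_nonneg (zpow_pos hq0 k).le, norm_mul, norm_mul,
    Real.norm_of_nonneg (by positivity : 0 ≤ q ^ i), Real.norm_eq_abs, Real.norm_eq_abs]
  gcongr
  exact hB _ (mul_pow_mem_qReals hq0.ne' (mul_zpow_mem_qReals hq0.ne' hx k) i)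

theorem qRLIntegrand_mul (hq0 : 0 < q) {f : ℝ → ℂ} {F : ℤ → ℂ} (hf : IsBesselRep q q f F)
    {x : ℝ} (hx : x ∈ qReals q) (i : ℕ) :
    qRLIntegrand q α f x (1 * q ^ i) * ((q ^ i : ℝ) : ℂ) =
      ∑' k : ℤ, ((qKernel q α (q ^ i) * q ^ i * besselJ q q (x * q ^ k * q ^ i) : ℝ) : ℂ) *
        (F k * ((q ^ k : ℝ) : ℂ)) := by
  rw [one_mul, qRLIntegrand, hf.eq _ (mul_pow_mem_qReals hq0.ne' hx i), besselSynth,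
    ← tsum_mul_left, ← tsum_mul_right]
  refine tsum_congr fun k => ?_
  rw [mul_right_comm x]
  push_cast
  ring

theorem IsBesselRep.qRLDefined (hq0 : 0 < q) (hq1 : q < 1) (hα : -1 / 2 < α) {f : ℝ → ℂ}
    {F : ℤ → ℂ} (hf : IsBesselRep q q f F) : QRLDefined q α f :=
  fun _ hx => (summable_qRL hq0 hq1 hα hf.rapid hx).prod.congr fun i =>
    (qRLIntegrand_mul hq0 hf hx i).symm

/-- Sonine's formula raises the order of each Bessel function from -1/2 to α. The weight q^k must
then be rewritten with (q^(2α+2))^k, and the quotient is the multiplier. -/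
theorem IsBesselRep.qRL (hq0 : 0 < q) (hq1 : q < 1) (hα : -1 / 2 < α) {f : ℝ → ℂ}
    {F : ℤ → ℂ} (hf : IsBesselRep q q f F) :
    IsBesselRep q (q ^ (2 * α + 2)) (qRL q α f)
      fun k => F k * ((((q ^ (2 * α + 1))⁻¹ ^ k : ℝ)) : ℂ) := by
  have ha0 : 0 < q ^ (2 * α + 1) := Real.rpow_pos_of_pos hq0 _
  refine ⟨hf.rapid.mul_ofReal_zpow (inv_pos.2 ha0), fun x hx => ?_⟩
  have hs := summable_qRL hq0 hq1 hα hf.rapid hx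
  have hc := hs.tsum_comm (f := fun i k => ((qKernel q α (q ^ i) * q ^ i *
      besselJ q q (x * q ^ k * q ^ i) : ℝ) : ℂ) * (F k * ((q ^ k : ℝ) : ℂ)))
  rw [_root_.qRL, qIntTo, tsum_congr (qRLIntegrand_mul hq0 hf hx), ← hc, ← mul_assoc,
    ← Complex.ofReal_mul, ← tsum_mul_left, besselSynth]
  refine tsum_congr fun k => ?_
  rw [tsum_mul_right, ← Complex.ofReal_tsum, tsum_qKernel_mul_besselJ hq0 hq1 hα, ← mul_assoc,
    ← Complex.ofReal_mul]
  have e1 : (1 + q) * qGamma (q ^ 2) (α + 1) /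
      (qGamma (q ^ 2) (1 / 2) * qGamma (q ^ 2) (α + 1 / 2)) * ((1 - q) * 1) *
      (kernelConst q α * besselJ q (q ^ (2 * α + 2)) (x * q ^ k)) =
      besselJ q (q ^ (2 * α + 2)) (x * q ^ k) := by
    have := kernelConst_eq hq0 hq1 hα
    have hG := (mul_pos (qGamma_pos hq0 hq1 (x := 1 / 2) (by norm_num))
      (qGamma_pos hq0 hq1 (x := α + 1 / 2) (by linarith))).ne'
    rw [← this] at hG ⊢
    have hK := kernelConst_pos hq0 hq1 hα
    rw [div_mul_eq_mul_div, div_mul_eq_mul_div, div_eq_iff hG]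
    ring
  have e2 : q ^ k = (q ^ (2 * α + 1))⁻¹ ^ k * (q ^ (2 * α + 2)) ^ k := by
    rw [← mul_zpow, rpow_two_mul_add_two hq0, inv_mul_cancel_left₀ ha0.ne']
  rw [e1]
  nth_rewrite 2 [e2]
  push_cast
  ring

/-! ### The `q`-Weyl transform -/

theorem qWeylIntegrand_zpow_mul (hq0 : 0 < q) (f : ℝ → ℂ) (x : ℝ) (n : ℤ) :
    qWeylIntegrand q α f x (q ^ n) * ((q ^ n : ℝ) : ℂ) =
      (qKernel q α (x / q ^ n) : ℂ) * f (q ^ n) * (((q ^ (2 * α + 1)) ^ n : ℝ) : ℂ) := by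
  have : (q ^ (2 * α + 1)) ^ n = (q ^ n) ^ (2 * α) * q ^ n := by
    rw [zpow_rpow hq0, ← mul_zpow, Real.rpow_add_one hq0.ne']
  rw [qWeylIntegrand, this]
  push_cast
  ring

/-- Below q|x| the kernel is evaluated at its zeros ±q^(-(n+1)), so the subtracted integral
vanishes. At x = 0 the prefactor of that integral vanishes instead. -/
theorem qWeylIntegrand_low (hq0 : 0 < q) (f : ℝ → ℂ) {x : ℝ} (hx0 : x ≠ 0) (n : ℕ) : qWeylIntegrand q α f x (q * |x| * q ^ n) = 0 := by
  have hk : qKernel q α (x / (q * |x| * q ^ n)) = 0 := by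
    have hx' : |x| ≠ 0 := abs_ne_zero.2 hx0
    have e : |x| / (q * |x| * q ^ n) = (q ^ (n + 1))⁻¹ := by
      field_simp
      ring
    rcases abs_choice x with h | h
    · rw [h] at e hx' ⊢
      rw [e, qKernel_inv_pow hq0]
    · rw [← qKernel_neg, ← neg_div]
      nth_rewrite 1 [← h]
      rw [e, qKernel_inv_pow hq0]
  rw [qWeylIntegrand, hk]
  simp

theorem div_zpow_mem_qReals (hq0 : 0 < q) {x : ℝ} (hx : x ∈ qReals q) (n : ℤ) :
    x / q ^ n ∈ qReals q := by
  rw [div_eq_mul_inv, ← zpow_neg]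
  exact mul_zpow_mem_qReals hq0.ne' hx (-n)

theorem summable_qWeyl (hq0 : 0 < q) (hq1 : q < 1) (hα : -1 / 2 < α) {f : ℝ → ℂ}
    (hf : IsDecay fun n => f (q ^ n)) {x : ℝ} (hx : x ∈ qReals q) :
    Summable fun n : ℤ =>
      (qKernel q α (x / q ^ n) : ℂ) * f (q ^ n) * (((q ^ (2 * α + 1)) ^ n : ℝ) : ℂ) := by
  have ha0 : 0 < q ^ (2 * α + 1) := Real.rpow_pos_of_pos hq0 _
  have ha1 : q ^ (2 * α + 1) < 1 := Real.rpow_lt_one hq0.le hq1 (by linarith)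
  obtain ⟨C, hC0, hC⟩ := exists_qKernel_le hq0 hq1 hα
  refine ((hf.summable ha0 ha1).mul_left C).of_norm_bounded fun n => ?_
  have := zpow_pos ha0 n
  rw [norm_mul, norm_mul, Complex.norm_real, Complex.norm_real, Real.norm_of_nonneg this.le,
    Real.norm_eq_abs, mul_assoc]
  gcongr
  exact hC _ (div_zpow_mem_qReals hq0 hx n)

theorem IsDecay.qWeylDefined (hq0 : 0 < q) (hq1 : q < 1) (hα : -1 / 2 < α) {f : ℝ → ℂ}
    (hf : IsDecay fun n => f (q ^ n)) : QWeylDefined q α f := by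
  intro x hx
  constructor
  · rw [QIntegrable]
    simp_rw [qWeylIntegrand_zpow_mul hq0]
    exact summable_qWeyl hq0 hq1 hα hf hx
  · rw [QIntegrableTo]
    rcases eq_or_ne x 0 with rfl | hx0
    · simp only [abs_zero, mul_zero, zero_mul]
      refine Summable.mul_left _ ?_
      exact Complex.summable_ofReal.2 (summable_geometric_of_lt_one hq0.le hq1)
    · simp_rw [qWeylIntegrand_low hq0 f hx0, zero_mul]
      exact summable_zero

theorem qWeyl_eq (hq0 : 0 < q) (f : ℝ → ℂ) {x : ℝ} (hx : x ∈ qReals q) :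
    qWeyl q α f x =
      ((q * (1 + q⁻¹) ^ (-α + 1 / 2) / qGamma (q ^ 2) (α + 1 / 2) * (1 - q) : ℝ) : ℂ) *
        ∑' n : ℤ, (qKernel q α (x / q ^ n) : ℂ) * f (q ^ n) *
          (((q ^ (2 * α + 1)) ^ n : ℝ) : ℂ) := by
  have h0 : qIntTo q (q * |x|) (qWeylIntegrand q α f x) = 0 := by
    rw [qIntTo]
    rcases eq_or_ne x 0 with rfl | hx0
    · simp
    · simp_rw [qWeylIntegrand_low hq0 f hx0, zero_mul, tsum_zero, mul_zero]
  rw [qWeyl, h0, sub_zero, qInt]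
  simp_rw [qWeylIntegrand_zpow_mul hq0]
  rw [Complex.ofReal_mul, mul_assoc]

theorem qWeyl_neg (hq0 : 0 < q) (f : ℝ → ℂ) {x : ℝ} (hx : x ∈ qReals q) :
    qWeyl q α f (-x) = qWeyl q α f x := by
  rw [qWeyl_eq hq0 f hx, qWeyl_eq hq0 f (neg_mem_qReals hx)]
  simp_rw [neg_div, qKernel_neg]

theorem tendsto_qWeyl (hq0 : 0 < q) (hq1 : q < 1) (hα : -1 / 2 < α) {f : ℝ → ℂ}
    (hf : IsDecay fun n => f (q ^ n)) :
    Tendsto (fun m : ℕ => qWeyl q α f (q ^ (m : ℤ))) atTop (𝓝 (qWeyl q α f 0)) := by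
  have ha0 : 0 < q ^ (2 * α + 1) := Real.rpow_pos_of_pos hq0 _
  have ha1 : q ^ (2 * α + 1) < 1 := Real.rpow_lt_one hq0.le hq1 (by linarith)
  obtain ⟨C, hC0, hC⟩ := exists_qKernel_le hq0 hq1 hα
  rw [qWeyl_eq hq0 f zero_mem_qReals]
  simp_rw [fun m : ℤ => qWeyl_eq (α := α) hq0 f (zpow_mem_qReals (q := q) m)]
  refine Tendsto.const_mul _ ?_
  refine tendsto_tsum_of_dominated_convergence ((hf.summable ha0 ha1).mul_left C) (fun n => ?_)
    (.of_forall fun m n => ?_)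
  · refine Tendsto.mul_const _ (Tendsto.mul_const _ ?_)
    refine (Complex.continuous_ofReal.tendsto _).comp ?_
    rw [zero_div, qKernel_zero]
    have hN : Tendsto (fun m : ℕ => ((m : ℤ) - n).toNat) atTop atTop :=
      tendsto_atTop_mono (fun m => by omega) (tendsto_sub_atTop_nat n.natAbs)
    refine ((tendsto_qKernel_pow hq0 hq1 hα).comp hN).congr' ?_
    filter_upwards [eventually_ge_atTop n.natAbs] with m hm
    simp only [Function.comp]
    rw [← zpow_sub₀ hq0.ne', ← zpow_natCast, Int.toNat_of_nonneg (by omega)]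
  · have := zpow_pos ha0 n
    rw [norm_mul, norm_mul, Complex.norm_real, Complex.norm_real, Real.norm_of_nonneg this.le,
      Real.norm_eq_abs, mul_assoc]
    gcongr
    exact hC _ (div_zpow_mem_qReals hq0 (zpow_mem_qReals _) n)

theorem qKernel_zpow_of_notMem (hq0 : 0 < q) {i : ℤ} (hi : i ∉ Set.range ((↑) : ℕ → ℤ)) :
    qKernel q α (q ^ i) = 0 := by
  obtain ⟨n, rfl⟩ : ∃ n : ℕ, i = -((n + 1 : ℕ) : ℤ) := by
    refine ⟨i.natAbs - 1, ?_⟩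
    have : ¬ 0 ≤ i := fun h => hi ⟨i.toNat, Int.toNat_of_nonneg h⟩
    omega
  rw [zpow_neg, zpow_natCast, qKernel_inv_pow hq0]

/-- The substitution m = n + i separates the double series into a product, and q^(2α+1) q = q^(2α+2)
produces the weight of order α. -/
theorem summable_qWeyl_hankel (hq0 : 0 < q) (hq1 : q < 1) (hα : -1 / 2 < α) {u : ℤ → ℂ}
    (hu : IsDecay u) :
    Summable fun nm : ℤ × ℤ => ‖u nm.1‖ * (q ^ (2 * α + 1)) ^ nm.1 *
      (|qKernel q α (q ^ nm.2 / q ^ nm.1)| * q ^ nm.2) := by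
  have ha0 : 0 < q ^ (2 * α + 1) := Real.rpow_pos_of_pos hq0 _
  have hw := isBesselParam_rpow hq0 hq1 (β := α) (by linarith)
  rw [← (Equiv.prodShear (Equiv.refl ℤ) fun n : ℤ => Equiv.addRight n).summable_iff]
  have hK : Summable fun i : ℤ => |qKernel q α (q ^ i)| * q ^ i := by
    rw [← Function.Injective.summable_iff (g := ((↑) : ℕ → ℤ)) Nat.cast_injective]
    · simpa [Function.comp_def] using summable_qKernel_pow_mul hq0 hq1 hα
    · intro i hi
      rw [qKernel_zpow_of_notMem hq0 hi, abs_zero, zero_mul]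
  refine ((hu.summable hw.w_pos hw.w_lt_one).mul_of_nonneg hK (fun n => ?_) (fun i => ?_)).congr
    fun ⟨n, i⟩ => ?_
  · have := zpow_pos hw.w_pos n
    positivity
  · positivity
  · simp only [Function.comp, Equiv.prodShear_apply, Equiv.refl_apply, Equiv.coe_addRight]
    rw [zpow_add₀ hq0.ne', mul_div_cancel_right₀ _ (zpow_pos hq0 n).ne',
      rpow_two_mul_add_two hq0, mul_zpow]
    ring

/-- Sonine's formula in transposed form, again with m = n + i; negative i contribute nothing because
the kernel vanishes there. -/
theorem tsum_qKernel_mul_latticeJ (hq0 : 0 < q) (hq1 : q < 1) (hα : -1 / 2 < α) (n k : ℤ) :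
    ∑' m : ℤ, ((qKernel q α (q ^ m / q ^ n) : ℝ) : ℂ) * latticeJ q q (m + k) * ((q ^ m : ℝ) : ℂ) =
      ((kernelConst q α * q ^ n : ℝ) : ℂ) * latticeJ q (q ^ (2 * α + 2)) (n + k) := by
  have hq := hq0.ne'
  have e : ∑' m : ℤ, ((qKernel q α (q ^ m / q ^ n) : ℝ) : ℂ) * latticeJ q q (m + k) *
      ((q ^ m : ℝ) : ℂ) = ∑' i : ℤ, ((qKernel q α (q ^ i) * q ^ i *
        besselJ q q (q ^ (n + k) * q ^ i) * q ^ n : ℝ) : ℂ) := by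
    rw [← (Equiv.addRight n).tsum_eq]
    refine tsum_congr fun i => ?_
    simp only [Equiv.coe_addRight, latticeJ]
    rw [show i + n + k = (n + k) + i by ring, zpow_add₀ hq i n, zpow_add₀ hq (n + k) i,
      mul_div_cancel_right₀ _ (zpow_pos hq0 n).ne']
    push_cast
    ring
  rw [e, ← Complex.ofReal_tsum, tsum_mul_right,
    ← Function.Injective.tsum_eq (g := ((↑) : ℕ → ℤ)) Nat.cast_injective]
  · simp_rw [zpow_natCast]
    rw [tsum_qKernel_mul_besselJ hq0 hq1 hα, latticeJ]
    push_cast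
    ring
  · intro i hi
    by_contra hc
    exact hi (by simp [qKernel_zpow_of_notMem hq0 hc])

/-- The factor by which the `q`-Weyl transform multiplies `q`-Bessel transforms. -/
noncomputable def weylConst (q α : ℝ) : ℝ :=
  q * (1 + q⁻¹) ^ (-α + 1 / 2) / qGamma (q ^ 2) (α + 1 / 2) * (1 - q) * kernelConst q α

/-- The integrability that `hankel_hankel` requires, available before the Weyl transform is known to
be a `q`-Bessel sum. -/
theorem summable_qWeyl_zpow (hq0 : 0 < q) (hq1 : q < 1) (hα : -1 / 2 < α) {f : ℝ → ℂ}
    (hf : IsDecay fun n => f (q ^ n)) :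
    Summable fun m : ℤ => ‖qWeyl q α f (q ^ m)‖ * q ^ m := by
  have ha0 : 0 < q ^ (2 * α + 1) := Real.rpow_pos_of_pos hq0 _
  have hs := (summable_qWeyl_hankel hq0 hq1 hα hf).prod_symm
  refine .of_nonneg_of_le (fun m => ?_) (fun m => ?_) (hs.prod.mul_left
    ‖((q * (1 + q⁻¹) ^ (-α + 1 / 2) / qGamma (q ^ 2) (α + 1 / 2) * (1 - q) : ℝ) : ℂ)‖)
  · have := zpow_pos hq0 m
    positivity
  · have hm := zpow_pos hq0 m
    rw [qWeyl_eq hq0 f (zpow_mem_qReals m), norm_mul, mul_assoc]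
    refine mul_le_mul_of_nonneg_left ?_ (norm_nonneg _)
    rw [← Real.norm_of_nonneg hm.le, ← Complex.norm_real, ← norm_mul, ← tsum_mul_right]
    refine tsum_of_norm_bounded (hs.prod_factor m).hasSum fun n => ?_
    have hn := zpow_pos ha0 n
    rw [norm_mul, norm_mul, norm_mul, Complex.norm_real, Complex.norm_real, Complex.norm_real,
      Real.norm_of_nonneg hn.le, Real.norm_of_nonneg hm.le, Real.norm_eq_abs]
    simp only [Prod.swap]
    exact le_of_eq (by ring)

theorem hankel_qWeyl (hq0 : 0 < q) (hq1 : q < 1) (hα : -1 / 2 < α) {f : ℝ → ℂ}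
    (hf : IsDecay fun n => f (q ^ n)) (k : ℤ) :
    hankel q q (fun m => qWeyl q α f (q ^ m)) k =
      weylConst q α * hankel q (q ^ (2 * α + 2)) (fun n => f (q ^ n)) k := by
  have ha0 : 0 < q ^ (2 * α + 1) := Real.rpow_pos_of_pos hq0 _
  obtain ⟨B, hB0, hB⟩ := exists_norm_latticeJ_le (isBesselParam_self hq0 hq1)
  set g : ℤ → ℤ → ℂ := fun n m => f (q ^ n) * (((q ^ (2 * α + 1)) ^ n : ℝ) : ℂ) *
    (((qKernel q α (q ^ m / q ^ n) : ℝ) : ℂ) * latticeJ q q (m + k) * ((q ^ m : ℝ) : ℂ)) with hg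
  have hgs : Summable (Function.uncurry g) := by
    refine ((summable_qWeyl_hankel hq0 hq1 hα hf).mul_left B).of_norm_bounded fun ⟨n, m⟩ => ?_
    have hm := zpow_pos hq0 m
    have hn := zpow_pos ha0 n
    simp only [Function.uncurry, hg]
    rw [norm_mul, norm_mul, norm_mul, norm_mul, Complex.norm_real, Complex.norm_real,
      Complex.norm_real, Real.norm_of_nonneg hn.le, Real.norm_of_nonneg hm.le, Real.norm_eq_abs]
    calc ‖f (q ^ n)‖ * (q ^ (2 * α + 1)) ^ n *
          (|qKernel q α (q ^ m / q ^ n)| * ‖latticeJ q q (m + k)‖ * q ^ m)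
        ≤ ‖f (q ^ n)‖ * (q ^ (2 * α + 1)) ^ n * (|qKernel q α (q ^ m / q ^ n)| * B * q ^ m) := by
          gcongr
          exact hB _
      _ = _ := by ring
  have h1 : hankel q q (fun m => qWeyl q α f (q ^ m)) k =
      ((q * (1 + q⁻¹) ^ (-α + 1 / 2) / qGamma (q ^ 2) (α + 1 / 2) * (1 - q) : ℝ) : ℂ) *
        ∑' m, ∑' n, g n m := by
    rw [hankel, ← tsum_mul_left]
    refine tsum_congr fun m => ?_
    rw [qWeyl_eq hq0 f (zpow_mem_qReals m), mul_assoc, mul_assoc, ← tsum_mul_right]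
    congr 1
    refine tsum_congr fun n => ?_
    simp only [hg]
    ring
  have hc : ∑' m, ∑' n, g n m = ∑' n, ∑' m, g n m := hgs.tsum_comm
  have hwc : (weylConst q α : ℂ) =
      ((q * (1 + q⁻¹) ^ (-α + 1 / 2) / qGamma (q ^ 2) (α + 1 / 2) * (1 - q) : ℝ) : ℂ) *
        (kernelConst q α : ℂ) := by
    rw [weylConst, Complex.ofReal_mul]
  rw [h1, hc, hwc, mul_assoc, hankel]
  congr 1
  rw [← tsum_mul_left]
  refine tsum_congr fun n => ?_
  simp only [hg]
  rw [tsum_mul_left, tsum_qKernel_mul_latticeJ hq0 hq1 hα, rpow_two_mul_add_two hq0, mul_zpow]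
  push_cast
  ring

/-- The transform of order -1/2 of W f is `weylConst` times the transform of order α of f
(`hankel_qWeyl`), a multiple of F. Inverting at order -1/2 divides by its norm. -/
theorem IsBesselRep.qWeyl (hq0 : 0 < q) (hq1 : q < 1) (hα : -1 / 2 < α) {f : ℝ → ℂ}
    {F : ℤ → ℂ} (hf : IsBesselRep q (q ^ (2 * α + 2)) f F) :
    IsBesselRep q q (qWeyl q α f) fun k =>
      ((weylConst q α * besselNorm q (q ^ (2 * α + 2)) / besselNorm q q : ℝ) : ℂ) * F k := by
  have h := isBesselParam_self hq0 hq1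
  have hw := isBesselParam_rpow hq0 hq1 (β := α) (by linarith)
  have hd := hf.isDecay hw
  refine IsBesselRep.of_zpow h (hf.rapid.const_mul _) (fun x hx => qWeyl_neg hq0 f hx)
    (tendsto_qWeyl hq0 hq1 hα hd) fun n => ?_
  have h1 := hankel_hankel h (summable_qWeyl_zpow hq0 hq1 hα hd) n
  have hN : (besselNorm q q : ℂ) ≠ 0 := Complex.ofReal_ne_zero.2 (besselNorm_pos h).ne'
  rw [← mul_right_inj' hN, ← h1, hankel, hankel, ← tsum_mul_left]
  refine tsum_congr fun k => ?_
  rw [hankel_qWeyl hq0 hq1 hα hd, hf.hankel_eq hw]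
  push_cast
  field_simp

/-- The relation that both intertwining identities come down to. It combines `kernelConst_eq` with 1
+ q = q(1 + 1/q). -/
theorem qBesselConst_eq (hq0 : 0 < q) (hq1 : q < 1) (hα : -1 / 2 < α) :
    qBesselConst q α = qBesselConst q (-1 / 2) * weylConst q α := by
  have hK := kernelConst_eq hq0 hq1 hα
  have h1 := (qGamma_pos hq0 hq1 (x := 1 / 2) (by norm_num)).ne'
  have h2 := (qGamma_pos hq0 hq1 (x := α + 1 / 2) (by linarith)).ne'
  have h3 := (qGamma_pos hq0 hq1 (x := α + 1) (by linarith)).ne'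
  have h4 : 0 < 1 + q⁻¹ := by positivity
  rw [qBesselConst, qBesselConst, weylConst, show (-1 / 2 + 1 : ℝ) = 1 / 2 by norm_num,
    show -(-1 / 2 : ℝ) = 1 / 2 by norm_num]
  have e : (1 + q⁻¹) ^ (-α) * ((1 + q)) =
      (1 + q⁻¹) ^ (1 / 2 : ℝ) * (q * (1 + q⁻¹) ^ (-α + 1 / 2)) := by
    rw [mul_left_comm, ← Real.rpow_add h4, show 1 / 2 + (-α + 1 / 2) = -α + 1 by ring,
      Real.rpow_add_one h4.ne']
    field_simp
    ring
  generalize (1 + q⁻¹) ^ (-α) = X at *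
  generalize (1 + q⁻¹) ^ (1 / 2 : ℝ) = Y at *
  generalize (1 + q⁻¹) ^ (-α + 1 / 2) = Z at *
  generalize qGamma (q ^ 2) (α + 1) = G at *
  generalize qGamma (q ^ 2) (α + 1 / 2) = H at *
  generalize qGamma (q ^ 2) (1 / 2) = I at *
  generalize kernelConst q α = K at *
  have e2 : X / G = X * (I * H) / (G * (I * H)) := by field_simp
  rw [e2, ← hK]
  have : Y / I * (q * Z / H * (1 - q) * K) = (Y * (q * Z)) * (G * ((1 - q) * K)) / (G * (I * H)) := by
    field_simp
  rw [this, ← e, ← hK]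
  ring

theorem weylConst_pos (hq0 : 0 < q) (hq1 : q < 1) (hα : -1 / 2 < α) : 0 < weylConst q α := by
  have h1 := qGamma_pos hq0 hq1 (x := α + 1 / 2) (by linarith)
  have h2 := kernelConst_pos hq0 hq1 hα
  have h3 := sub_pos.2 hq1
  have h4 : 0 < (1 + q⁻¹) ^ (-α + 1 / 2) := Real.rpow_pos_of_pos (by positivity) _
  rw [weylConst]
  positivity

end transforms

end Transforms

/-! ### Uniqueness of representations and inversion of the Weyl transform. -/

section weylInverse

variable {q α : ℝ}

theorem IsBesselRep.eqOn_iff {w : ℝ} (h : IsBesselParam q w) {f g : ℝ → ℂ} {F G : ℤ → ℂ}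
    (hf : IsBesselRep q w f F) (hg : IsBesselRep q w g G) :
    Set.EqOn f g (qReals q) ↔ F = G := by
  constructor
  · intro he
    have hN : (besselNorm q w : ℂ) ≠ 0 := Complex.ofReal_ne_zero.2 (besselNorm_pos h).ne'
    funext k
    have h1 := hf.hankel_eq h k
    simp_rw [he (zpow_mem_qReals _)] at h1
    exact mul_left_cancel₀ hN (h1.symm.trans (hg.hankel_eq h k))
  · rintro rfl x hx
    rw [hf.eq x hx, hg.eq x hx]

theorem weylFactor_ne_zero (hq0 : 0 < q) (hq1 : q < 1) (hα : -1 / 2 < α) :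
    ((weylConst q α * besselNorm q (q ^ (2 * α + 2)) / besselNorm q q : ℝ) : ℂ) ≠ 0 := by
  have h1 := weylConst_pos hq0 hq1 hα
  have h2 := besselNorm_pos (isBesselParam_self hq0 hq1)
  have h3 := besselNorm_pos (isBesselParam_rpow hq0 hq1 (β := α) (by linarith))
  rw [Complex.ofReal_ne_zero]
  positivity

/-- The `q`-Weyl transform is onto, with an explicit preimage. -/
theorem IsBesselRep.exists_preimage (hq0 : 0 < q) (hq1 : q < 1) (hα : -1 / 2 < α) {g : ℝ → ℂ}
    {G : ℤ → ℂ} (hg : IsBesselRep q q g G) : ∃ h, IsQWeylPreimage q α g h := by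
  have hc := weylFactor_ne_zero hq0 hq1 hα
  set c := ((weylConst q α * besselNorm q (q ^ (2 * α + 2)) / besselNorm q q : ℝ) : ℂ) with hcdef
  have hr : IsBesselRep q (q ^ (2 * α + 2))
      (besselSynth q (q ^ (2 * α + 2)) fun k => c⁻¹ * G k) (fun k => c⁻¹ * G k) :=
    ⟨hg.rapid.const_mul _, fun _ _ => rfl⟩
  refine ⟨_, hr.mem_qSchwartzMoment hq0 hq1 (by linarith), ?_⟩
  rw [(hr.qWeyl hq0 hq1 hα).eqOn_iff (isBesselParam_self hq0 hq1) hg]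
  funext k
  rw [← hcdef, mul_inv_cancel_left₀ hc]

/-- Any preimage lies in S_{*q,α} and so has a representing sequence. Uniqueness at order -1/2
forces this to be G divided by the Weyl factor, which also proves injectivity. -/
theorem IsQWeylPreimage.isBesselRep (hq0 : 0 < q) (hq1 : q < 1) (hα : -1 / 2 < α) {g h : ℝ → ℂ}
    {G : ℤ → ℂ} (hg : IsBesselRep q q g G) (hh : IsQWeylPreimage q α g h) :
    IsBesselRep q (q ^ (2 * α + 2)) h fun k =>
      ((weylConst q α * besselNorm q (q ^ (2 * α + 2)) / besselNorm q q : ℝ) : ℂ)⁻¹ * G k := by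
  have hc := weylFactor_ne_zero hq0 hq1 hα
  obtain ⟨H, hH⟩ := exists_isBesselRep hq0 hq1 (by linarith) hh.1
  have h1 := ((hH.qWeyl hq0 hq1 hα).eqOn_iff (isBesselParam_self hq0 hq1) hg).1 hh.2
  rw [← h1]
  simp_rw [inv_mul_cancel_left₀ hc]
  exact hH

theorem exists_isBesselRep_self (hq0 : 0 < q) (hq1 : q < 1) {f : ℝ → ℂ}
    (hf : f ∈ qSchwartzMoment q (-1 / 2)) : ∃ F, IsBesselRep q q f F := by
  obtain ⟨F, hF⟩ := exists_isBesselRep hq0 hq1 (by norm_num) hf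
  rw [rpow_neg_half] at hF
  exact ⟨F, hF⟩

theorem IsBesselRep.qConv_self (hq0 : 0 < q) (hq1 : q < 1) {f g : ℝ → ℂ}
    {F G : ℤ → ℂ} (hf : IsBesselRep q q f F) (hg : IsBesselRep q q g G) :
    IsBesselRep q q (_root_.qConv q (-1 / 2) f g) fun k =>
      (((1 - q) * qBesselConst q (-1 / 2) * besselNorm q q : ℝ) : ℂ) * (F k * G k) := by
  have := IsBesselRep.qConv (f := f) (g := g) (F := F) (G := G) hq0 hq1 (β := -1 / 2) (by norm_num)
    (by rwa [rpow_neg_half]) (by rwa [rpow_neg_half])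
  rwa [rpow_neg_half] at this

theorem IsBesselRep.qConvDefined_self (hq0 : 0 < q) (hq1 : q < 1) {f g : ℝ → ℂ}
    {F G : ℤ → ℂ} (hf : IsBesselRep q q f F) (hg : IsBesselRep q q g G) :
    QConvDefined q (-1 / 2) f g :=
  IsBesselRep.qConvDefined (F := F) (G := G) hq0 hq1 (by norm_num) (by rwa [rpow_neg_half])
    (by rwa [rpow_neg_half])

end weylInverse

theorem mainTheorem10 (q α : ℝ) (hq0 : 0 < q) (hq1 : q < 1)
    (hq : ∃ r : ℤ, Real.log (1 - q) / Real.log q = r) (hα : -1 / 2 < α) :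
    (∀ f g : ℝ → ℂ, f ∈ qSchwartzMoment q α → g ∈ qSchwartzMoment q α →
      QConvDefined q α f g ∧ QWeylDefined q α (qConv q α f g) ∧
      QWeylDefined q α f ∧ QWeylDefined q α g ∧
      QConvDefined q (-1 / 2) (qWeyl q α f) (qWeyl q α g) ∧
      Set.EqOn (qWeyl q α (qConv q α f g))
        (qConv q (-1 / 2) (qWeyl q α f) (qWeyl q α g)) (qReals q)) ∧
    (∀ f g : ℝ → ℂ, f ∈ qSchwartzMoment q (-1 / 2) → g ∈ qSchwartzMoment q (-1 / 2) →
      (IsQWeylPreimage q α g (qWeylInv q α g) ∧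
        ∀ h : ℝ → ℂ, IsQWeylPreimage q α g h → Set.EqOn h (qWeylInv q α g) (qReals q)) ∧
      QConvDefined q (-1 / 2) f g ∧ QRLDefined q α (qConv q (-1 / 2) f g) ∧
      QRLDefined q α f ∧ QConvDefined q α (qRL q α f) (qWeylInv q α g) ∧
      Set.EqOn (qRL q α (qConv q (-1 / 2) f g))
        (qConv q α (qRL q α f) (qWeylInv q α g)) (qReals q)) := by
  have hβ : -1 < α := by linarith
  have h := isBesselParam_self hq0 hq1
  have hw := isBesselParam_rpow hq0 hq1 hβ
  have hN := (besselNorm_pos h).ne'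
  have hM := (besselNorm_pos hw).ne'
  have hW := (weylConst_pos hq0 hq1 hα).ne'
  have hA := qBesselConst_eq hq0 hq1 hα
  refine ⟨fun f g hf hg => ?_, fun f g hf hg => ?_⟩
  · obtain ⟨F, hF⟩ := exists_isBesselRep hq0 hq1 hβ hf
    obtain ⟨G, hG⟩ := exists_isBesselRep hq0 hq1 hβ hg
    have hFG := hF.qConv hq0 hq1 hβ hG
    have hWf := hF.qWeyl hq0 hq1 hα
    have hWg := hG.qWeyl hq0 hq1 hα
    refine ⟨hF.qConvDefined hq0 hq1 hβ hG, (hFG.isDecay hw).qWeylDefined hq0 hq1 hα,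
      (hF.isDecay hw).qWeylDefined hq0 hq1 hα, (hG.isDecay hw).qWeylDefined hq0 hq1 hα,
      hWf.qConvDefined_self hq0 hq1 hWg, ?_⟩
    rw [(hFG.qWeyl hq0 hq1 hα).eqOn_iff h (hWf.qConv_self hq0 hq1 hWg)]
    funext k
    -- Both sides have sequences proportional to F(k) G(k); the norms cancel and `hA` matches the
    -- factors.
    have e : weylConst q α * besselNorm q (q ^ (2 * α + 2)) / besselNorm q q *
        ((1 - q) * qBesselConst q α * besselNorm q (q ^ (2 * α + 2))) =
        (1 - q) * qBesselConst q (-1 / 2) * besselNorm q q *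
          (weylConst q α * besselNorm q (q ^ (2 * α + 2)) / besselNorm q q) *
          (weylConst q α * besselNorm q (q ^ (2 * α + 2)) / besselNorm q q) := by
      rw [hA]
      generalize besselNorm q (q ^ (2 * α + 2)) = M at *
      field_simp
    rw [← mul_assoc, ← Complex.ofReal_mul, e]
    push_cast
    ring
  · obtain ⟨F, hF⟩ := exists_isBesselRep_self hq0 hq1 hf
    obtain ⟨G, hG⟩ := exists_isBesselRep_self hq0 hq1 hg
    have hpre : IsQWeylPreimage q α g (qWeylInv q α g) :=
      Classical.epsilon_spec (hG.exists_preimage hq0 hq1 hα)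
    have hV := hpre.isBesselRep hq0 hq1 hα hG
    have hR := hF.qRL hq0 hq1 hα
    have hFG := hF.qConv_self hq0 hq1 hG
    refine ⟨⟨hpre, fun u hu => ((hu.isBesselRep hq0 hq1 hα hG).eqOn_iff hw hV).2 rfl⟩,
      hF.qConvDefined_self hq0 hq1 hG, hFG.qRLDefined hq0 hq1 hα, hF.qRLDefined hq0 hq1 hα,
      hR.qConvDefined hq0 hq1 hβ hV, ?_⟩
    rw [(hFG.qRL hq0 hq1 hα).eqOn_iff hw (hR.qConv hq0 hq1 hβ hV)]
    funext k
    -- The multiplier of R_{α,q} occurs once on each side, so again only the scalar relation `hA` is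
    -- needed.
    have e : (1 - q) * qBesselConst q (-1 / 2) * besselNorm q q =
        (1 - q) * qBesselConst q α * besselNorm q (q ^ (2 * α + 2)) *
          (weylConst q α * besselNorm q (q ^ (2 * α + 2)) / besselNorm q q)⁻¹ := by
      rw [hA]
      generalize besselNorm q (q ^ (2 * α + 2)) = M at *
      field_simp
    rw [e]
    push_cast
    ring
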